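/- **Setting.** Let $\mathbb F$ be a field of characteristic $0$ and $\mathfrak g$ a finite-dimensional absolutely simple Lie algebra over $\mathbb F$, graded by an element $H_0$: $\mathfrak g_i=\{x\mid [H_0,x]=ix\}$. Assume that $\mathfrak g_1$ is an absolutely irreducible $\mathfrak g_0$-module. An element $h$ is *1-simple* if it belongs to an $\mathfrak{sl}_2$-triple $(x,h,y)$ with $x\in\mathfrak g_1$, $y\in\mathfrak g_{-1}$; assume that the prehomogeneous space $(\mathfrak g_0,\mathfrak g_1)$ is regular, i.e. that $2H_0$ is 1-simple. For $h\in\mathfrak g$ put $E_i(h)=\{x\mid [h,x]=ix\}$. A 1-simple $h$ is *special* if $\bigoplus_{i>0}E_i(2H_0)\subset\bigoplus_{i\ge0}E_i(h)$ (sums over integers), and $h$ is *very special* if $h$ and $2H_0-h$ are both 1-simple special. Let $\mathfrak a\ni H_0$ be a maximal split abelian subalgebra of $\mathfrak g$ (all $\operatorname{ad}x$, $x\in\mathfrak a$, diagonalizable over $\mathbb F$), $\Delta\subset\mathfrak a^*$ its root system, $\mathfrak g^\lambda$ the root spaces, $\Delta_0=\{\lambda\in\Delta\mid\lambda(H_0)=0\}$.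 Assume $(\mathfrak g_0,\mathfrak g_1)$ is of classical type $(R_n,\alpha_k)$, $R\in\{B,C,BC,D\}$: there is a basis $\epsilon_1,\dots,\epsilon_n$ of $\mathfrak a^*$ in which $\Delta$ is the root system $R_n$ with its usual positive roots $\Delta^+$ and simple roots $\alpha_1,\dots,\alpha_n$ (Bourbaki), with $\alpha_k(H_0)=1$ and $\alpha_j(H_0)=0$ for $j\ne k$; here $1\le k\le n$, $k\le n-1$ if $R=C$ and $k\le n-2$ if $R=D$. Write $h_v\in\mathfrak a$ for $2v/(v,v)$ (standard scalar product in the coordinates $\epsilon_j$), so that $h_\alpha$ is the coroot of a root $\alpha$, and $h_{\epsilon_j}$ is defined by $\epsilon_i(h_{\epsilon_j})=2\delta_{ij}$ for every type. Let $G$ be the centralizer of $H_0$ in the group of those automorphisms of $\mathfrak g$ that are elementary (products of $\exp(\operatorname{ad}x)$ with $\operatorname{ad}x$ nilpotent) over $\overline{\mathbb F}$. For $H_1,\dots,H_p\in\mathfrak a$ write $\lambda\succ0$ if $\lambda(H_i)>0$, $i$ being the largest index with $\lambda(H_i)\neq0$, and let $P(H_1,\dots,H_p)=G_{\mathfrak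 t}\exp(\operatorname{ad}\mathfrak n_{\mathfrak t})$, where $G_{\mathfrak t}$ is the centralizer of $H_1,\dots,H_p$ in $G$ and $\mathfrak n_{\mathfrak t}=\bigoplus_{\lambda\in\Delta_0,\lambda\succ0}\mathfrak g^\lambda$. It is a *very special parabolic subgroup* if the $H_i$ are very special with $\sum_iH_i=2H_0$, and it is *standard* if $\{\lambda\in\Delta_0\mid\lambda\succ0\}=\{\lambda\in\Delta_0\cap\Delta^+\mid \lambda(H_i)\ne0\text{ for some }i\}$. Let $P_0=P(H^0_1,\dots,H^0_{p_0})$ with $p_0=k/2$ and $H^0_i=2(h_{2\epsilon_{k-2i+1}}+h_{2\epsilon_{k-2i+2}})$ if $R=C$ and $\mathfrak g$ is split (i.e. $\mathfrak a$ is a Cartan subalgebra), and $p_0=k$, $H^0_i=h_{\epsilon_{k-i+1}}$ otherwise. If $2k\le n$, let $P_0'=P(H_1',H_2')$ with $H'_1=\sum_{i=1}^kh_{\epsilon_i-\epsilon_{2k-i+1}}$, $H'_2=\sum_{i=1}^kh_{\epsilon_i+\epsilon_{2k-i+1}}$. **Proposition 2.4.3.** Let $P=P(H_1,\dots,H_p)$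 be a standard very special parabolic subgroup. Then * either $2k\le n$ and $P=P_0'$ — where, if $R=D$ and $n=2k$, this holds up to exchanging the simple roots $\alpha_{n-1}$ and $\alpha_n$, i.e. $P$ is either $P'_0$ or the subgroup obtained from the definition of $P'_0$ by replacing $\epsilon_n$ by $-\epsilon_n$; * or $P\supset P_0$, $k\ge2$, and there are integers $0=l_{p+1}<l_p<\dots<l_2<l_1=k$ such that $H_i=\sum_{l_{i+1}+1\le j\le l_i}h_{\epsilon_j}$ for $i=1,\dots,p$. -/

import Mathlib

open scoped TensorProduct Pointwise

noncomputable section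

namespace Prehom

section General

variable (K : Type*) [Field K] {L : Type*} [LieRing L] [LieAlgebra K L]

/-- `E_i(h) = {x | [h, x] = i x}`. For the grading element `H₀` this is the graded piece `L_i`. -/
def E (h : L) (i : ℤ) : Submodule K L :=
  Module.End.eigenspace (LieAlgebra.ad K L h) (i : K)

/-- `p(h) = ⨁_{i ≥ 0} E_i(h)`. -/
def parab (h : L) : Submodule K L := ⨆ i : ℕ, E K h (i : ℤ)

/-- `n(h) = ⨁_{i > 0} E_i(h)`. -/
def nilp (h : L) : Submodule K L := ⨆ i : ℕ, E K h ((i : ℤ) + 1)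

/-- `h` is 1-simple: it is the semisimple element of an `sl₂`-triple `(x, h, y)` with `x ∈ L_1` and
`y ∈ L_{-1}`. (The convention `[x, y] = -h` would only replace `y` by `-y`.) -/
def OneSimple (H₀ h : L) : Prop :=
  ∃ x ∈ E K H₀ 1, ∃ y ∈ E K H₀ (-1), IsSl2Triple h x y

/-- `h` is 1-simple special: 1-simple with `n(2H₀) ⊆ p(h)`. -/
def Special (H₀ h : L) : Prop :=
  OneSimple K H₀ h ∧ nilp K ((2 : K) • H₀) ≤ parab K h

/-- `h` is very special: both `h` and `2H₀ - h` are 1-simple special. -/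
def VerySpecial (H₀ h : L) : Prop :=
  Special K H₀ h ∧ Special K H₀ ((2 : K) • H₀ - h)

/-- The exponential of a nilpotent endomorphism (a finite sum). -/
def expNil (f : Module.End K L) : Module.End K L :=
  ∑ i ∈ Finset.range (nilpotencyClass f), ((i.factorial : K)⁻¹) • f ^ i

variable (L) in
/-- The group of elementary automorphisms, generated by the `exp (ad x)` with `ad x` nilpotent. -/
def elemAut : Subgroup (L ≃ₗ[K] L) :=
  Subgroup.closure {φ | ∃ x : L, IsNilpotent (LieAlgebra.ad K L x) ∧
    (φ : L →ₗ[K] L) = expNil K (LieAlgebra.ad K L x)}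

/-- A subalgebra which is abelian and split: all its `ad x` are diagonalizable over `K`. -/
def IsSplitAbelian (a : LieSubalgebra K L) : Prop :=
  (∀ x ∈ a, ∀ y ∈ a, ⁅x, y⁆ = 0) ∧
    ∀ x ∈ a, ⨆ μ : K, Module.End.eigenspace (LieAlgebra.ad K L x) μ = ⊤

end General

variable {F : Type*} [Field F] {g : Type*} [LieRing g] [LieAlgebra F g]

variable (F g) in
/-- `g` is absolutely simple: it is simple over an algebraic closure of `F`. -/
def AbsolutelySimple : Prop :=
  LieAlgebra.IsSimple (AlgebraicClosure F) (AlgebraicClosure F ⊗[F] g)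

variable (F) in
/-- `g_1` is an absolutely irreducible `g_0`-module: it is irreducible over an algebraic closure. -/
def AbsolutelyIrreducible (H₀ : g) : Prop :=
  E (AlgebraicClosure F) ((1 : AlgebraicClosure F) ⊗ₜ[F] H₀) 1 ≠ ⊥ ∧
  ∀ W : Submodule (AlgebraicClosure F) (AlgebraicClosure F ⊗[F] g),
    W ≤ E (AlgebraicClosure F) ((1 : AlgebraicClosure F) ⊗ₜ[F] H₀) 1 →
    (∀ x ∈ E (AlgebraicClosure F) ((1 : AlgebraicClosure F) ⊗ₜ[F] H₀) 0, ∀ w ∈ W, ⁅x, w⁆ ∈ W) →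
    W = ⊥ ∨ W = E (AlgebraicClosure F) ((1 : AlgebraicClosure F) ⊗ₜ[F] H₀) 1

variable (F) in
/-- Regularity of the (absolutely irreducible) prehomogeneous space: `2H₀` is 1-simple. -/
def Regular (H₀ : g) : Prop := OneSimple F H₀ ((2 : F) • H₀)

variable (F g) in
/-- `Aut₀(g)`: the automorphisms of `g` that are elementary over an algebraic closure of `F`. -/
def aut0 : Set (g ≃ₗ[F] g) :=
  {φ | (∀ x y, φ ⁅x, y⁆ = ⁅φ x, φ y⁆) ∧
    φ.baseChange F (AlgebraicClosure F) g g ∈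
      elemAut (AlgebraicClosure F) (AlgebraicClosure F ⊗[F] g)}

section Roots

variable {a : LieSubalgebra F g}

/-- The simultaneous eigenspace `g^lam` of `a`. -/
def rootSpace (lam : Module.Dual F a) : Submodule F g where
  carrier := {x | ∀ h : a, ⁅(h : g), x⁆ = lam h • x}
  add_mem' := by
    intro x y hx hy h
    rw [lie_add, hx h, hy h, smul_add]
  zero_mem' := by intro h; simp
  smul_mem' := by
    intro c x hx h
    rw [lie_smul, hx h, smul_comm]

variable (a) in
/-- The set `Δ` of roots of `(g, a)`. -/
def roots : Set (Module.Dual F a) :=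
  {lam | lam ≠ 0 ∧ rootSpace lam ≠ ⊥}

/-- `lam ≻ 0` with respect to `(H_1, …, H_p)`: `lam(H_i) > 0`, where `i` is the largest index such
that `lam(H_i) ≠ 0`. (For 1-simple `H_i` all values `lam(H_i)` are integers.) -/
def Succ {p : ℕ} (H : Fin p → a) (lam : Module.Dual F a) : Prop :=
  ∃ i, (∃ m : ℕ, 0 < m ∧ lam (H i) = (m : F)) ∧ ∀ j, i < j → lam (H j) = 0

/-- The roots `lam ∈ Δ_0` with `lam ≻ 0`. -/
def succRoots (H₀ : a) {p : ℕ} (H : Fin p → a) : Set (Module.Dual F a) :=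
  {lam | lam ∈ roots a ∧ lam H₀ = 0 ∧ Succ H lam}

/-- `n_t = ⨁ g^lam` over the `lam ∈ Δ_0` with `lam ≻ 0`. -/
def nilpT (H₀ : a) {p : ℕ} (H : Fin p → a) : Submodule F g :=
  ⨆ lam ∈ succRoots H₀ H, rootSpace lam

/-- `G_t`: the elements of `Aut₀(g)` fixing `H₀` (this is the group `G`) and `H_1, …, H_p`. -/
def GT (H₀ : a) {p : ℕ} (H : Fin p → a) : Set (g ≃ₗ[F] g) :=
  {φ | φ ∈ aut0 F g ∧ φ (H₀ : g) = H₀ ∧ ∀ i, φ (H i : g) = H i}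

/-- `N_t = exp (ad n_t)`. -/
def NT (H₀ : a) {p : ℕ} (H : Fin p → a) : Set (g ≃ₗ[F] g) :=
  {φ | ∃ x ∈ nilpT H₀ H, IsNilpotent (LieAlgebra.ad F g x) ∧
    (φ : g →ₗ[F] g) = expNil F (LieAlgebra.ad F g x)}

/-- The parabolic subgroup `P(H_1, …, H_p) = G_t N_t` of `G`. -/
def P (H₀ : a) {p : ℕ} (H : Fin p → a) : Set (g ≃ₗ[F] g) := GT H₀ H * NT H₀ H

/-- The data defining a very special parabolic subgroup: very special elements of `a` of
sum `2H₀`. -/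
def VerySpecialFamily (H₀ : a) {p : ℕ} (H : Fin p → a) : Prop :=
  (∀ i, VerySpecial F (H₀ : g) (H i : g)) ∧ ∑ i, H i = (2 : F) • H₀

/-- `P(H_1, …, H_p)` is standard for the set of positive roots `pos`:
`{lam ∈ Δ_0 | lam ≻ 0} = {lam ∈ Δ_0^+ | lam|_t ≠ 0}`. -/
def IsStandard (pos : Set (Module.Dual F a)) (H₀ : a) {p : ℕ} (H : Fin p → a) : Prop :=
  succRoots H₀ H = {lam | lam ∈ pos ∧ lam H₀ = 0 ∧ ∃ i, lam (H i) ≠ 0}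

end Roots

/-- The types of classical root systems considered. -/
inductive CType where
  | B | C | BC | D

section Classical

variable {a : LieSubalgebra F g} {n : ℕ} (e : Module.Basis (Fin n) F a)

/-- The coordinates `ε_1, …, ε_n` on `a` in a basis `e` of `a` (numbered from 1; `ε_j = 0` for `j`
outside `{1, …, n}`). -/
def eps (j : ℕ) : Module.Dual F a :=
  if h : 1 ≤ j ∧ j ≤ n then e.coord ⟨j - 1, by omega⟩ else 0

/-- `h_v = 2 v / (v, v)`, for the scalar product for which `e` is orthonormal: this is the coroot
of `v` if `v` is a root of a classical system in the coordinates `ε_j`; for every type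
`h_{ε_j} = 2 e_j`. -/
def coroot (v : Module.Dual F a) : a :=
  (2 / ∑ i, v (e i) ^ 2) • ∑ i, v (e i) • e i

/-- The positive roots of the system of type `R_n`. -/
def posRoots (R : CType) : Set (Module.Dual F a) :=
  {v | ∃ i j, 1 ≤ i ∧ i < j ∧ j ≤ n ∧ (v = eps e i - eps e j ∨ v = eps e i + eps e j)} ∪
  {v | (R = .B ∨ R = .BC) ∧ ∃ i, 1 ≤ i ∧ i ≤ n ∧ v = eps e i} ∪
  {v | (R = .C ∨ R = .BC) ∧ ∃ i, 1 ≤ i ∧ i ≤ n ∧ v = (2 : F) • eps e i}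

/-- The simple roots `α_1, …, α_n` of the system of type `R_n`, in the usual numbering. -/
def simpleRoot (R : CType) (j : ℕ) : Module.Dual F a :=
  if j < n then eps e j - eps e (j + 1)
  else match R with
    | .B => eps e n
    | .BC => eps e n
    | .C => (2 : F) • eps e n
    | .D => eps e (n - 1) + eps e n

/-- `(g_0, g_1)` is of classical type `(R_n, α_k)` in the coordinates given by `e`, with
`1 ≤ k ≤ n`, `k ≤ n - 1` if `R = C` and `k ≤ n - 2` if `R = D`. -/
def IsOfType (R : CType) (k : ℕ) (H₀ : a) : Prop :=
  roots a = posRoots e R ∪ -posRoots e R ∧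
  (∀ j, 1 ≤ j → j ≤ n → simpleRoot e R j H₀ = if j = k then 1 else 0) ∧
  1 ≤ k ∧ k ≤ n ∧ (R = .C → k + 1 ≤ n) ∧ (R = .D → k + 2 ≤ n)

open Classical in
/-- `P_0 = P(H_1, …, H_{p_0})`. If `R = C` and `g` is split (that is, `a` is a Cartan subalgebra),
`p_0 = k / 2` and `H_i = 2 (h_{2ε_{k-2i+1}} + h_{2ε_{k-2i+2}})`; otherwise `p_0 = k` and
`H_i = h_{ε_{k-i+1}}`. -/
def P0 (R : CType) (k : ℕ) (H₀ : a) : Set (g ≃ₗ[F] g) :=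
  if R = .C ∧ a.IsCartanSubalgebra then
    P H₀ (fun i : Fin (k / 2) =>
      (2 : F) • (coroot e ((2 : F) • eps e (k - 2 * (i + 1) + 1)) +
        coroot e ((2 : F) • eps e (k - 2 * (i + 1) + 2))))
  else
    P H₀ (fun i : Fin k => coroot e (eps e (k - (i + 1) + 1)))

/-- `P'_0 = P(H'_1, H'_2)` with `H'_1 = ∑ h_{ε_i - ε_{2k-i+1}}` and
`H'_2 = ∑ h_{ε_i + ε_{2k-i+1}}`, sums over `1 ≤ i ≤ k`; meant for `2k ≤ n`. -/
def P0' (k : ℕ) (H₀ : a) : Set (g ≃ₗ[F] g) :=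
  P H₀ ![∑ i ∈ Finset.Icc 1 k, coroot e (eps e i - eps e (2 * k - i + 1)),
    ∑ i ∈ Finset.Icc 1 k, coroot e (eps e i + eps e (2 * k - i + 1))]

/-- The basis obtained by replacing the last vector of `e` by its opposite. In these coordinates
`ε_n` is replaced by `-ε_n`, which for type `D` exchanges `α_{n-1}` and `α_n`. -/
def flipLast : Module.Basis (Fin n) F a :=
  e.unitsSMul (fun i => if (i : ℕ) + 1 = n then -1 else 1)

end Classical

end Prehom

end

noncomputable section

set_option linter.unusedSectionVars false

/-! A 1-simple `h` in `a`, with triple `(x, h, y)`, gives two tools. The vectors `x` and `y` are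
sums of root vectors for roots taking the values `±(1, 2)` on `(H₀, h)`, so an element of `a` killed
by all roots of degree 1 with value 2 on `h` commutes with the triple. The automorphism `exp (ad x)
exp (-ad y) exp (ad x)` therefore carries any weight to a weight with the opposite value on `h` and
the same values on such elements (`OneSimple.exists_mirror`). Moreover `h = [x, y]` is
Killing-orthogonal to such elements, in particular to `2H₀ - h` (`OneSimple.killingForm_eq_zero`).
If `h` is very special, roots of degree 1 take values in `{0, 1, 2}` on it, so its coordinates
satisfy `x_i ± x_j ∈ {0, 1, 2}` for `i ≤ k < j`. Mirroring `ε_i + ε_j` excludes half-integers, and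
also excludes the value 1 among the first `k` coordinates when the others vanish. Two kinds remain
(`IsOfType.classification`): first `k` coordinates in `{0, 2}` and the others 0, or first `k`
coordinates 1 and the others in `{0, 1, -1}`, not all 0. As the family sums to `2H₀`, either all its
members are of the first kind and partition `{1, …, k}`, or it consists of two members of the second
kind (`VerySpecialFamily.cases`). For two members of the second kind and `n ≥ 3`, the Killing form
on `a` is a multiple of the standard scalar product (`IsOfType.killingForm_basis`), and the
orthogonality of `h` and `2H₀ - h` says that exactly `k` of the last coordinates are nonzero.
Standardness puts them first with sign `+`, except for the last sign in type `D` with `n = 2k`; this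
is `P'_0`. For a partition, standardness makes the blocks intervals, and `P ⊇ P_0` says that a finer
ordered partition has a smaller parabolic subgroup (`IsPartition.P_subset_P`). In split type `C` the
blocks of `P_0` are pairs, so block sizes must be even: the bracket provides a nondegenerate skew
form on a space whose dimension is the block size (`IsOfType.even_card`). Over the given field, the
`sl₂`-triples of root vectors come from the nondegeneracy of the Killing form and the maximality of
`a` (`exists_sl2_of_mem_rootSpace`). -/

namespace Prehom

/-! ### Exponentials of nilpotent inner derivations. -/

section ExpNil

theorem expNil_eq_sum {K : Type*} [Field K] {L : Type*} [LieRing L] [LieAlgebra K L] {f : Module.End K L} {k : ℕ} (h : f ^ k = 0) :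
    expNil K f = ∑ i ∈ Finset.range k, ((i.factorial : K)⁻¹) • f ^ i := by
  have hle : nilpotencyClass f ≤ k := csInf_le' h
  have hz : ∀ i ∈ Finset.Ico (nilpotencyClass f) k, ((i.factorial : K)⁻¹) • f ^ i = 0 := by
    intro i hi
    rw [pow_eq_zero_of_le (Finset.mem_Ico.1 hi).1 (pow_nilpotencyClass ⟨k, h⟩), smul_zero]
  rw [← Finset.sum_range_add_sum_Ico _ hle, Finset.sum_eq_zero hz, add_zero, expNil]

variable {K : Type*} [Field K] [CharZero K] {L : Type*} [LieRing L] [LieAlgebra K L]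

theorem expNil_mul_neg {f : Module.End K L} (h : IsNilpotent f) :
    expNil K f * expNil K (-f) = 1 := by
  -- `IsNilpotent.exp` has rational coefficients; `L` becomes a rational vector space through `K`
  -- and the two series agree term by term.
  let _ : Module ℚ L := Module.compHom L (algebraMap ℚ K)
  have key : ∀ f : Module.End K L, expNil K f = IsNilpotent.exp f := fun f => by
    simp only [expNil, IsNilpotent.exp]
    exact Finset.sum_congr rfl fun i _ => inv_natCast_smul_eq K ℚ _ _
  rw [key, key]
  exact IsNilpotent.exp_mul_exp_neg_self h

theorem expNil_ad_lie {x : L} (h : IsNilpotent (LieAlgebra.ad K L x)) (y z : L) :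
    expNil K (LieAlgebra.ad K L x) ⁅y, z⁆ =
      ⁅expNil K (LieAlgebra.ad K L x) y, expNil K (LieAlgebra.ad K L x) z⁆ := by
  let _ : Module ℚ L := Module.compHom L (algebraMap ℚ K)
  have key : ∀ f : Module.End K L, expNil K f = IsNilpotent.exp f := fun f => by
    simp only [expNil, IsNilpotent.exp]
    exact Finset.sum_congr rfl fun i _ => inv_natCast_smul_eq K ℚ _ _
  rw [key]
  let _i := LieRing.toNonUnitalNonAssocRing L
  have : SMulCommClass K L L := LieAlgebra.smulCommClass K L
  have : IsScalarTower K L L := LieAlgebra.isScalarTower K L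
  refine Module.End.exp_mul_of_derivation K L (LieAlgebra.ad K L x) ?_ h y z
  intro a b
  change ⁅x, ⁅a, b⁆⁆ = ⁅a, ⁅x, b⁆⁆ + ⁅⁅x, a⁆, b⁆
  rw [leibniz_lie, add_comm]

/-- The automorphism `exp (ad x)` of `L`, for `ad x` nilpotent. -/
def expAd (x : L) (h : IsNilpotent (LieAlgebra.ad K L x)) : L ≃ₗ[K] L :=
  LinearEquiv.ofLinearMap (expNil K (LieAlgebra.ad K L x)) (expNil K (-LieAlgebra.ad K L x))
    (expNil_mul_neg h) (by have := expNil_mul_neg h.neg; rwa [neg_neg] at this)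

@[simp] theorem coe_expAd (x : L) (h : IsNilpotent (LieAlgebra.ad K L x)) :
    (expAd x h : L →ₗ[K] L) = expNil K (LieAlgebra.ad K L x) := rfl

theorem expAd_apply (x : L) (h : IsNilpotent (LieAlgebra.ad K L x)) (y : L) :
    expAd x h y = expNil K (LieAlgebra.ad K L x) y := rfl

theorem expAd_symm_apply (x : L) (h : IsNilpotent (LieAlgebra.ad K L x)) (y : L) :
    (expAd x h).symm y = expNil K (LieAlgebra.ad K L (-x)) y := by
  rw [map_neg]; rfl

theorem expAd_lie (x : L) (h : IsNilpotent (LieAlgebra.ad K L x)) (y z : L) :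
    expAd x h ⁅y, z⁆ = ⁅expAd x h y, expAd x h z⁆ := expNil_ad_lie h y z

/-- If `(ad x)^k y = 0`, the exponential series applied to `y` stops at `k`. -/
theorem expAd_apply_eq_sum (x : L) (h : IsNilpotent (LieAlgebra.ad K L x)) (y : L) {k : ℕ}
    (hk : ((LieAlgebra.ad K L x) ^ k) y = 0) :
    expAd x h y = ∑ i ∈ Finset.range k, ((i.factorial : K)⁻¹) • ((LieAlgebra.ad K L x) ^ i) y := by
  obtain ⟨m, hm⟩ := id h
  have hm' : (LieAlgebra.ad K L x) ^ (k + m) = 0 := pow_eq_zero_of_le (by omega) hm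
  rw [expAd_apply, expNil_eq_sum hm', LinearMap.sum_apply, Finset.sum_range_add,
    Finset.sum_eq_zero (s := Finset.range m), add_zero]
  · simp
  · intro i _
    rw [LinearMap.smul_apply, add_comm k i, pow_add, Module.End.mul_apply, hk, map_zero, smul_zero]

theorem expAd_apply_of_lie_eq_zero (x : L) (h : IsNilpotent (LieAlgebra.ad K L x)) (y : L)
    (hy : ⁅x, y⁆ = 0) : expAd x h y = y := by
  rw [expAd_apply_eq_sum x h y (k := 1) (by simpa using hy)]
  simp

/-- All terms of the exponential series beyond the constant one lie in `S`. -/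
theorem expAd_sub_self_mem (x : L) (h : IsNilpotent (LieAlgebra.ad K L x)) (y : L)
    (S : Submodule K L) (hy : ⁅x, y⁆ ∈ S) (hS : ∀ s ∈ S, ⁅x, s⁆ ∈ S) :
    expAd x h y - y ∈ S := by
  obtain ⟨m, hm⟩ := id h
  have hm' : (LieAlgebra.ad K L x) ^ (m + 1) = 0 := pow_eq_zero_of_le (by omega) hm
  have hpow : ∀ i, ((LieAlgebra.ad K L x) ^ (i + 1)) y ∈ S := by
    intro i
    induction i with
    | zero => simpa using hy
    | succ i ih => rw [pow_succ', Module.End.mul_apply]; exact hS _ ih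
  rw [expAd_apply, expNil_eq_sum hm', LinearMap.sum_apply, Finset.sum_range_succ']
  simp only [LinearMap.smul_apply, pow_zero, Nat.factorial_zero, Nat.cast_one, inv_one, one_smul,
    Module.End.one_apply, add_sub_cancel_right]
  exact Submodule.sum_mem _ fun i _ => S.smul_mem _ (hpow i)

end ExpNil

/-! ### Nilpotency of eigenvectors of a grading. -/

section Nilpotent

variable {K : Type*} [Field K] [CharZero K] {V : Type*} [AddCommGroup V] [Module K V]
  [FiniteDimensional K V]

/-- Nonzero powers `X ^ i` would be eigenvectors of `[A, ·]` for the distinct eigenvalues `i * c`,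
and there is room for finitely many only. -/
theorem isNilpotent_of_commutator_eq_smul {A X : Module.End K V} {c : K} (hc : c ≠ 0)
    (h : A * X - X * A = c • X) : IsNilpotent X := by
  by_contra hX
  have hne : ∀ i : ℕ, X ^ i ≠ 0 := fun i hi => hX ⟨i, hi⟩
  let D : Module.End K (Module.End K V) := LinearMap.mulLeft K A - LinearMap.mulRight K A
  have hD : ∀ i : ℕ, D (X ^ i) = ((i : K) * c) • X ^ i := by
    intro i
    induction i with
    | zero => simp [D]
    | succ i ih =>
      have ih' : A * X ^ i - X ^ i * A = ((i : K) * c) • X ^ i := ih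
      change A * X ^ (i + 1) - X ^ (i + 1) * A = _
      have : A * X ^ (i + 1) - X ^ (i + 1) * A
          = (A * X ^ i - X ^ i * A) * X + X ^ i * (A * X - X * A) := by
        rw [pow_succ]; noncomm_ring
      rw [this, ih', h]
      push_cast
      rw [smul_mul_assoc, mul_smul_comm, ← pow_succ, ← add_smul]
      ring_nf
  have hinj : Function.Injective fun i : ℕ => (i : K) * c := fun i j hij => by
    simpa [hc] using hij
  have hev : ∀ i : ℕ, D.HasEigenvector ((i : K) * c) (X ^ i) := fun i =>
    ⟨Module.End.mem_eigenspace_iff.2 (hD i), hne i⟩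
  have := (Module.End.eigenvectors_linearIndependent' D _ hinj _ hev).finite
  exact not_finite ℕ

theorem isNilpotent_ad_of_lie_eq_smul {L : Type*} [LieRing L] [LieAlgebra K L]
    [FiniteDimensional K L] {h x : L} {c : K} (hc : c ≠ 0) (hx : ⁅h, x⁆ = c • x) :
    IsNilpotent (LieAlgebra.ad K L x) := by
  refine isNilpotent_of_commutator_eq_smul (A := LieAlgebra.ad K L h) hc ?_
  ext y
  simp only [LinearMap.sub_apply, Module.End.mul_apply, LieAlgebra.ad_apply, LinearMap.smul_apply]
  rw [← lie_lie, hx, smul_lie]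

end Nilpotent

/-! ### The Weyl reflection of an `sl₂`-triple. -/

section Theta

variable {K : Type*} [Field K] [CharZero K] {L : Type*} [LieRing L] [LieAlgebra K L]
  [FiniteDimensional K L]

/-- The automorphism `exp (ad e) exp (-ad f) exp (ad e)` attached to an `sl₂`-triple maps `h` to
`-h` and fixes everything that commutes with the triple. -/
theorem exists_reflection {h e f : L} (t : IsSl2Triple h e f) :
    ∃ θ : L ≃ₗ[K] L, (∀ x y, θ ⁅x, y⁆ = ⁅θ x, θ y⁆) ∧ θ h = -h ∧
      ∀ v, ⁅v, e⁆ = 0 → ⁅v, f⁆ = 0 → θ v = v := by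
  have he := t.lie_h_e_smul K
  have hf := t.lie_lie_smul_f K
  have hef := t.lie_e_f
  have heh : ⁅e, h⁆ = -((2 : K) • e) := by rw [← lie_skew, he]
  have hfh : ⁅f, h⁆ = (2 : K) • f := by rw [← lie_skew, hf, neg_neg]
  have hfe : ⁅f, e⁆ = -h := by rw [← lie_skew, hef]
  have ne : IsNilpotent (LieAlgebra.ad K L e) :=
    isNilpotent_ad_of_lie_eq_smul (c := 2) two_ne_zero he
  have nf : IsNilpotent (LieAlgebra.ad K L (-f)) :=
    isNilpotent_ad_of_lie_eq_smul (h := h) (c := -2) (by simp) (by simp [hf])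
  have Eh : expAd e ne h = h - (2 : K) • e := by
    rw [expAd_apply_eq_sum e ne h (k := 2) (by simp [pow_succ, heh])]
    simp [Finset.sum_range_succ, heh, sub_eq_add_neg]
  have Ee : expAd e ne e = e := expAd_apply_of_lie_eq_zero _ _ _ (lie_self e)
  have Fh : expAd (-f) nf h = h - (2 : K) • f := by
    rw [expAd_apply_eq_sum (-f) nf h (k := 2) (by simp [pow_succ, hfh])]
    simp [Finset.sum_range_succ, hfh, sub_eq_add_neg]
  have Fe : expAd (-f) nf e = e + h - f := by
    rw [expAd_apply_eq_sum (-f) nf e (k := 3) (by simp [pow_succ, hfh, hfe])]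
    simp [Finset.sum_range_succ, hfh, hfe, sub_eq_add_neg, pow_succ, smul_smul, Nat.factorial]
  refine ⟨(expAd e ne).trans ((expAd (-f) nf).trans (expAd e ne)), ?_, ?_, ?_⟩
  · intro x y
    simp [expAd_lie]
  -- The three factors give `h ↦ h - 2e ↦ -h - 2e ↦ -h`.
  · simp only [LinearEquiv.trans_apply, Eh, map_sub, map_smul, Fh, Fe, map_add, Ee]
    module
  · intro v hve hvf
    have h1 : expAd e ne v = v := expAd_apply_of_lie_eq_zero _ _ _ (by rw [← lie_skew, hve, neg_zero])
    have h2 : expAd (-f) nf v = v :=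
      expAd_apply_of_lie_eq_zero _ _ _ (by rw [neg_lie, lie_skew, hvf])
    simp [h1, h2]

end Theta

/-! ### Linear algebra behind the Jacobson–Morozov theorem. -/

section Linear

variable {K : Type*} [Field K] {V : Type*} [AddCommGroup V] [Module K V]

/-- The eigenspaces already span and the generalized ones are independent, so none of the latter can
be larger. -/
theorem maxGenEigenspace_eq_of_iSup_eigenspace {f : Module.End K V}
    (hf : ⨆ μ, f.eigenspace μ = ⊤) (μ : K) : f.maxGenEigenspace μ = f.eigenspace μ := by
  have hle : f.eigenspace ≤ f.maxGenEigenspace := fun ν =>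
    (f.genEigenspace ν).mono le_top
  exact (congrFun ((f.independent_maxGenEigenspace.le_iff_eq_of_iSup_eq_top hf).1 hle) μ).symm

/-- The sum of all generalized eigenspaces contains `v` as soon as it contains `(f - c) v`. -/
theorem mem_iSup_maxGenEigenspace_of_sub_mem [FiniteDimensional K V] (f : Module.End K V) (c : K)
    {v : V} (h : f v - c • v ∈ ⨆ μ, f.maxGenEigenspace μ) : v ∈ ⨆ μ, f.maxGenEigenspace μ := by
  set U : Submodule K V := ⨆ (μ) (_ : μ ≠ c), f.maxGenEigenspace μ with hU
  let T : Module.End K V := f - c • 1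
  have hTU : ∀ x ∈ U, T x ∈ U := by
    intro x hx
    have : U ≤ U.comap T := by
      refine iSup₂_le fun μ hμ y hy => ?_
      have hm : Set.MapsTo T (f.maxGenEigenspace μ) (f.maxGenEigenspace μ) :=
        Module.End.mapsTo_maxGenEigenspace_of_comm
          ((Commute.refl f).sub_right ((Commute.one_right f).smul_right c)) μ
      exact (le_iSup₂ (f := fun μ (_ : μ ≠ c) => f.maxGenEigenspace μ) μ hμ) (hm hy)
    exact this hx
  -- `f - c` has no kernel on `U`, hence is invertible there; this allows the `U`-part of `(f - c)
  -- v` to be absorbed into `v`.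
  have hinj : Function.Injective (T.restrict hTU) := by
    rw [← LinearMap.ker_eq_bot, eq_bot_iff]
    rintro ⟨x, hx⟩ hx0
    have hx0' : T x = 0 := congrArg Subtype.val (LinearMap.mem_ker.1 hx0)
    have h1 : x ∈ f.maxGenEigenspace c := by
      refine (f.genEigenspace c).mono (le_top (a := 1)) ?_
      change x ∈ f.eigenspace c
      rw [Module.End.mem_eigenspace_iff]
      exact sub_eq_zero.1 (by simpa [T] using hx0')
    have := (Submodule.disjoint_def.1 (f.independent_maxGenEigenspace c)) x h1 hx
    simpa using this
  have hsurj := LinearMap.injective_iff_surjective.1 hinj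
  have hsplit : ⨆ μ, f.maxGenEigenspace μ = f.maxGenEigenspace c ⊔ U :=
    le_antisymm (iSup_le fun μ => by
      by_cases hμ : μ = c
      · subst hμ; exact le_sup_left
      · exact le_sup_of_le_right
          (le_iSup₂ (f := fun μ (_ : μ ≠ c) => f.maxGenEigenspace μ) μ hμ))
      (sup_le (le_iSup _ c) (iSup₂_le fun μ _ => le_iSup _ μ))
  rw [hsplit] at h ⊢
  obtain ⟨w, hw, u, hu, hwu⟩ := Submodule.mem_sup.1 h
  obtain ⟨⟨u', hu'⟩, hu''⟩ := hsurj ⟨u, hu⟩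
  have hTu : T u' = u := congrArg Subtype.val hu''
  have hv : T (v - u') = w := by
    rw [map_sub, hTu]
    simp only [T, LinearMap.sub_apply, LinearMap.smul_apply, Module.End.one_apply]
    rw [← hwu]; abel
  have hvc : v - u' ∈ f.maxGenEigenspace c := by
    rw [Module.End.mem_maxGenEigenspace] at hw ⊢
    obtain ⟨k, hk⟩ := hw
    refine ⟨k + 1, ?_⟩
    rw [pow_succ, Module.End.mul_apply]
    change ((f - c • 1) ^ k) (T (v - u')) = 0
    rw [hv, hk]
  exact Submodule.mem_sup.2 ⟨_, hvc, _, hu', by abel⟩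

variable {A B : Module.End K V}

theorem pow_succ_mul_sub_of_commute (hc : Commute A (A * B - B * A)) (s : ℕ) :
    A ^ (s + 1) * B - B * A ^ (s + 1) = ((s + 1 : ℕ) : K) • (A ^ s * (A * B - B * A)) := by
  induction s with
  | zero => simp
  | succ s ih =>
    have : A ^ (s + 1 + 1) * B - B * A ^ (s + 1 + 1)
        = A * (A ^ (s + 1) * B - B * A ^ (s + 1)) + (A * B - B * A) * A ^ (s + 1) := by
      rw [pow_succ' A (s + 1)]; noncomm_ring
    rw [this, ih, mul_smul_comm, ← mul_assoc, ← pow_succ', ← (hc.pow_left (s + 1)).eq]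
    push_cast
    module

/-- Jacobson's lemma. Commuting `B` through `A ^ (s + 1) * C ^ M = 0` gives `A ^ s * C ^ (2 * M + 1)
= 0`, since `s + 1` is invertible; the exponent of `A` descends to 0. -/
theorem isNilpotent_commutator [CharZero K] (hA : IsNilpotent A)
    (hc : Commute A (A * B - B * A)) : IsNilpotent (A * B - B * A) := by
  set C := A * B - B * A with hC
  obtain ⟨N, hN⟩ := hA
  have key : ∀ j ≤ N, ∃ M, A ^ (N - j) * C ^ M = 0 := by
    intro j
    induction j with
    | zero => exact fun _ => ⟨0, by simp [hN]⟩
    | succ j ih =>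
      intro hj
      obtain ⟨M, hM⟩ := ih (by omega)
      obtain ⟨s, hs⟩ : ∃ s, N - j = s + 1 := ⟨N - j - 1, by omega⟩
      have hs' : N - (j + 1) = s := by omega
      rw [hs] at hM
      rw [hs']
      refine ⟨M + (1 + M), ?_⟩
      have h1 : C ^ M * ((A ^ (s + 1) * B - B * A ^ (s + 1)) * C ^ M) = 0 := by
        have e : C ^ M * ((A ^ (s + 1) * B - B * A ^ (s + 1)) * C ^ M)
          = (C ^ M * A ^ (s + 1)) * B * C ^ M - C ^ M * B * (A ^ (s + 1) * C ^ M) := by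
          noncomm_ring
        rw [e, hM, ← (hc.pow_pow (s + 1) M).eq, hM]; simp
      rw [pow_succ_mul_sub_of_commute hc, ← hC, smul_mul_assoc, mul_smul_comm] at h1
      have h2 := (smul_eq_zero.1 h1).resolve_left (by exact_mod_cast Nat.succ_ne_zero s)
      rw [pow_add, pow_add, pow_one, ← mul_assoc, (hc.pow_pow s M).eq, mul_assoc, ← mul_assoc (A ^ s)]
      exact h2
  obtain ⟨M, hM⟩ := key N le_rfl
  exact ⟨M, by simpa using hM⟩

/-- If `A ^ (j + 1) * X = 0`, then `A ^ j * (A * B) ^ i * X` is a multiple of `C ^ i * A ^ j * X`,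
which vanishes for `i = M` because `C ^ M = 0`. Each factor `(A * B) ^ M` thus lowers the order of
annihilation by `A`. -/
theorem isNilpotent_mul_of_commute_commutator [CharZero K] (hA : IsNilpotent A)
    (hc : Commute A (A * B - B * A)) : IsNilpotent (A * B) := by
  obtain ⟨M, hM⟩ := isNilpotent_commutator hA hc
  set C := A * B - B * A with hC
  have key : ∀ j (X : Module.End K V), A ^ j * X = 0 → (A * B) ^ (j * M) * X = 0 := by
    intro j
    induction j with
    | zero => intro X hX; simpa using hX
    | succ j ih =>
      intro X hX
      have step : ∀ i, A ^ (j + 1) * ((A * B) ^ i * X) = 0 ∧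
          A ^ j * ((A * B) ^ i * X) = ((j + 1 : ℕ) : K) ^ i • (C ^ i * (A ^ j * X)) := by
        intro i
        induction i with
        | zero => simp [hX]
        | succ i ihi =>
          obtain ⟨h1, h2⟩ := ihi
          have e : A ^ j * ((A * B) ^ (i + 1) * X)
              = ((j + 1 : ℕ) : K) • (C * (A ^ j * ((A * B) ^ i * X))) := by
            have e1 : A ^ j * ((A * B) ^ (i + 1) * X)
                = (A ^ (j + 1) * B - B * A ^ (j + 1)) * ((A * B) ^ i * X)
                  + B * (A ^ (j + 1) * ((A * B) ^ i * X)) := by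
              rw [pow_succ' (A * B), pow_succ A]; noncomm_ring
            rw [e1, h1, mul_zero, add_zero, pow_succ_mul_sub_of_commute hc, ← hC,
              smul_mul_assoc, (hc.pow_left j).eq, mul_assoc]
          refine ⟨?_, ?_⟩
          · rw [pow_succ', mul_assoc, e, mul_smul_comm, ← mul_assoc, hc.eq, mul_assoc,
              ← mul_assoc A, ← pow_succ', h1, mul_zero, smul_zero]
          · rw [e, h2, mul_smul_comm, smul_smul, ← mul_assoc, ← pow_succ', ← pow_succ']
      have h2 := (step M).2
      rw [hM, zero_mul, smul_zero] at h2
      have := ih _ h2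
      rwa [← mul_assoc, ← pow_add, ← Nat.succ_mul] at this
  obtain ⟨N, hN⟩ := hA
  exact ⟨N * M, by simpa using key N 1 (by simpa using hN)⟩

/-- If `[A, Z] = H`, `[H, A] = 2 A` and `A` is nilpotent, then `H` is triangularizable. -/
theorem iSup_maxGenEigenspace_eq_top_of_commutators [CharZero K] [FiniteDimensional K V]
    {A Z H : Module.End K V} (hA : IsNilpotent A) (hH : A * Z - Z * A = H)
    (hHA : H * A - A * H = (2 : K) • A) : ⨆ μ, H.maxGenEigenspace μ = ⊤ := by
  obtain ⟨N, hN⟩ := hA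
  have hAH : ∀ j : ℕ, A ^ j * H = H * A ^ j - ((2 * j : ℕ) : K) • A ^ j := by
    intro j
    induction j with
    | zero => simp
    | succ j ih =>
      have h1 : A * H = H * A - (2 : K) • A := by rw [← hHA]; abel
      rw [pow_succ, mul_assoc, h1, mul_sub, ← mul_assoc, ih, mul_smul_comm, sub_mul,
        smul_mul_assoc, mul_assoc]
      push_cast
      module
  have hAZ : ∀ n : ℕ, A ^ (n + 1) * Z - Z * A ^ (n + 1)
      = ((n + 1 : ℕ) : K) • (H * A ^ n - (n : K) • A ^ n) := by
    intro n
    induction n with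
    | zero => simp [hH]
    | succ n ih =>
      have e : A ^ (n + 1 + 1) * Z - Z * A ^ (n + 1 + 1)
          = A ^ (n + 1) * (A * Z - Z * A) + (A ^ (n + 1) * Z - Z * A ^ (n + 1)) * A := by
        rw [pow_succ A (n + 1)]; noncomm_ring
      rw [e, hH, hAH, ih, smul_mul_assoc, sub_mul, mul_assoc, smul_mul_assoc, ← pow_succ]
      push_cast
      module
  set W := ⨆ μ, H.maxGenEigenspace μ with hW
  have key : ∀ j v, (A ^ j) v = 0 → v ∈ W := by
    intro j
    induction j with
    | zero => intro v hv; rw [pow_zero, Module.End.one_apply] at hv; rw [hv]; exact W.zero_mem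
    | succ j ih =>
      -- If `A ^ j v = A ^ n w` is killed by `A`, then `A ^ j` sends `(H - (n - 2j)) v` to `(H - n)
      -- A ^ j v = A ^ (n + 1) (Z w) / (n + 1)`. Repeating this raises `n` up to `N`, where `A ^ j v
      -- = 0` and the induction on `j` applies.
      have inner : ∀ m n, N ≤ n + m → ∀ v w, (A ^ j) v = (A ^ n) w → A ((A ^ j) v) = 0 → v ∈ W := by
        intro m
        induction m with
        | zero =>
          intro n hn v w hvw _
          refine ih v ?_
          rw [hvw, pow_eq_zero_of_le (by omega) hN, LinearMap.zero_apply]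
        | succ m ihm =>
          intro n hn v w hvw hv
          refine mem_iSup_maxGenEigenspace_of_sub_mem H ((n : K) - (2 * j : ℕ)) ?_
          have e : (A ^ j) (H v - ((n : K) - (2 * j : ℕ)) • v)
              = H ((A ^ j) v) - (n : K) • (A ^ j) v := by
            have := LinearMap.congr_fun (hAH j) v
            simp only [Module.End.mul_apply, LinearMap.sub_apply, LinearMap.smul_apply] at this
            rw [map_sub, this, map_smul]
            module
          refine ihm (n + 1) (by omega) _ (((n + 1 : ℕ) : K)⁻¹ • Z w) ?_ ?_
          · have h1 := LinearMap.congr_fun (hAZ n) w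
            simp only [Module.End.mul_apply, LinearMap.sub_apply, LinearMap.smul_apply] at h1
            have h2 : (A ^ (n + 1)) w = 0 := by rw [pow_succ', Module.End.mul_apply, ← hvw, hv]
            rw [h2, map_zero, sub_zero, ← hvw] at h1
            rw [e, map_smul, h1, smul_smul, inv_mul_cancel₀ (by exact_mod_cast Nat.succ_ne_zero n),
              one_smul]
          · rw [e, map_sub, map_smul, hv, smul_zero, sub_zero]
            have := LinearMap.congr_fun hHA ((A ^ j) v)
            simp only [Module.End.mul_apply, LinearMap.sub_apply, LinearMap.smul_apply, hv,
              map_zero, smul_zero, zero_sub, neg_eq_zero] at this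
            exact this
      intro v hv
      refine inner N 0 (by omega) v ((A ^ j) v) (by simp) ?_
      rw [← Module.End.mul_apply, ← pow_succ', hv]
  rw [eq_top_iff]
  intro v _
  exact key N v (by rw [hN, LinearMap.zero_apply])

end Linear

/-! ### Semisimple parts in Killing Lie algebras. -/

section SemisimplePart

variable {K : Type*} [Field K] {L : Type*} [LieRing L] [LieAlgebra K L]

theorem eq_zero_of_forall_lie_eq_zero (K : Type*) [Field K] {L : Type*} [LieRing L]
    [LieAlgebra K L] [FiniteDimensional K L] [LieAlgebra.IsKilling K L] {s : L} (h : ∀ x : L, ⁅s, x⁆ = 0) : s = 0 :=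
  (LieDerivation.IsKilling.ad_apply_eq_zero_iff K L s).1 (by ext x; simpa using h x)

/-- Otherwise some linear form `φ = κ(z, ·)` kills the image of `(ad e)²` but not `e`. Invariance
gives `(ad e)² z = 0`, so `ad e` commutes with `[ad e, ad z]` and `ad e * ad z` is nilpotent; its
trace `κ(e, z) = φ e` is then 0. -/
theorem exists_lie_lie_eq_two_smul [CharZero K] [FiniteDimensional K L]
    [LieAlgebra.IsKilling K L] {e : L} (hn : IsNilpotent (LieAlgebra.ad K L e)) :
    ∃ z : L, ⁅e, ⁅e, z⁆⁆ = -((2 : K) • e) := by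
  let T : Module.End K L := LieAlgebra.ad K L e * LieAlgebra.ad K L e
  have hT : ∀ x, T x = ⁅e, ⁅e, x⁆⁆ := fun x => rfl
  suffices he : e ∈ LinearMap.range T by
    obtain ⟨z, hz⟩ := he
    refine ⟨-((2 : K) • z), ?_⟩
    rw [← hT, map_neg, map_smul, hz]
  by_contra he
  obtain ⟨φ, hφe, hφ⟩ := Submodule.exists_le_ker_of_notMem he
  obtain ⟨z, hz⟩ := ((killingForm K L).toDual
    (LieAlgebra.IsKilling.killingForm_nondegenerate K L)).surjective φ
  have hφz : ∀ x, killingForm K L z x = φ x := fun x => by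
    rw [← hz, LinearMap.BilinForm.toDual_def]
  have hTz : T z = 0 := by
    have hall : ∀ x, killingForm K L (T z) x = 0 := by
      intro x
      have h0 : φ (T x) = 0 := hφ ⟨x, rfl⟩
      rw [← hφz, hT] at h0
      rw [hT, LieModule.traceForm_apply_lie_apply', LieModule.traceForm_apply_lie_apply', neg_neg]
      exact h0
    exact (LieAlgebra.IsKilling.killingForm_nondegenerate K L).1 _ hall
  apply hφe
  rw [← hφz, LieModule.traceForm_comm, LieModule.traceForm_apply_apply]
  refine (LinearMap.isNilpotent_trace_of_isNilpotent
    (isNilpotent_mul_of_commute_commutator (A := LieAlgebra.ad K L e) (B := LieAlgebra.ad K L z)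
      hn ?_)).eq_zero
  have hC : LieAlgebra.ad K L e * LieAlgebra.ad K L z - LieAlgebra.ad K L z * LieAlgebra.ad K L e
      = LieAlgebra.ad K L ⁅e, z⁆ := by ext x; simp
  rw [hC]
  ext x
  simp only [Module.End.mul_apply, LieAlgebra.ad_apply]
  rw [hT] at hTz
  rw [leibniz_lie, hTz, zero_lie, zero_add]

/-- The semisimple part of a triangularizable element of a Killing Lie algebra. -/
theorem exists_semisimple_part [FiniteDimensional K L] [LieAlgebra.IsKilling K L] {h : L}
    (hh : ⨆ μ, (LieAlgebra.ad K L h).maxGenEigenspace μ = ⊤) :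
    ∃ s : L, ∀ μ, ∀ x ∈ (LieAlgebra.ad K L h).maxGenEigenspace μ, ⁅s, x⁆ = μ • x := by
  classical
  let f := LieAlgebra.ad K L h
  have hI : DirectSum.IsInternal f.maxGenEigenspace :=
    DirectSum.isInternal_submodule_of_iSupIndep_of_iSup_eq_top f.independent_maxGenEigenspace hh
  let _ : DirectSum.Decomposition f.maxGenEigenspace := hI.chooseDecomposition
  let D : Module.End K L :=
    DirectSum.toModule K K L (fun μ => μ • (f.maxGenEigenspace μ).subtype) ∘ₗ
      (DirectSum.decomposeLinearEquiv f.maxGenEigenspace).toLinearMap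
  have hD : ∀ μ, ∀ x ∈ f.maxGenEigenspace μ, D x = μ • x := by
    intro μ x hx
    simp only [D, LinearMap.comp_apply, LinearEquiv.coe_coe, DirectSum.decomposeLinearEquiv_apply]
    rw [DirectSum.decompose_of_mem _ hx]
    erw [DirectSum.toModule_lof]
    simp
  -- Generalized eigenvalues add under the bracket, so `D` is a derivation, and derivations of a
  -- Killing Lie algebra are inner.
  have hleib : ∀ x y : L, D ⁅x, y⁆ = ⁅x, D y⁆ - ⁅y, D x⁆ := by
    intro x y
    have hx : x ∈ ⨆ μ, f.maxGenEigenspace μ := hh ▸ Submodule.mem_top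
    have hy : y ∈ ⨆ μ, f.maxGenEigenspace μ := hh ▸ Submodule.mem_top
    induction hx using Submodule.iSup_induction' with
    | zero => simp
    | add x x' _ _ h1 h2 => rw [add_lie, map_add, h1, h2, add_lie, map_add, lie_add]; abel
    | mem μ x hx =>
      induction hy using Submodule.iSup_induction' with
      | zero => simp
      | add y y' _ _ h1 h2 => rw [lie_add, map_add, h1, h2, map_add, add_lie, lie_add]; abel
      | mem ν y hy =>
        have hxy : ⁅x, y⁆ ∈ f.maxGenEigenspace (μ + ν) := LieModule.lie_mem_maxGenEigenspace_toEnd hx hy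
        rw [hD _ _ hxy, hD _ _ hx, hD _ _ hy, lie_smul, lie_smul, ← lie_skew x y]
        module
  obtain ⟨s, hs⟩ := LieDerivation.IsKilling.exists_eq_ad (R := K) (L := L) ⟨D, hleib⟩
  refine ⟨s, fun μ x hx => ?_⟩
  have := congrArg (fun E : LieDerivation K L L => E x) hs
  rw [← hD μ x hx]
  simpa using this

theorem iSup_eigenspace_semisimple_part {h s : L}
    (hh : ⨆ μ, (LieAlgebra.ad K L h).maxGenEigenspace μ = ⊤)
    (hs : ∀ μ, ∀ x ∈ (LieAlgebra.ad K L h).maxGenEigenspace μ, ⁅s, x⁆ = μ • x) :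
    ⨆ μ, (LieAlgebra.ad K L s).eigenspace μ = ⊤ := by
  rw [eq_top_iff, ← hh]
  exact iSup_mono fun μ x hx => Module.End.mem_eigenspace_iff.2 (hs μ x hx)

/-- `ad v` preserves the generalized eigenspaces of `ad h`, on which `ad s` is scalar; so `[v, s]`
is central. -/
theorem lie_semisimple_part_eq_zero [FiniteDimensional K L] [LieAlgebra.IsKilling K L] {h s : L}
    (hh : ⨆ μ, (LieAlgebra.ad K L h).maxGenEigenspace μ = ⊤)
    (hs : ∀ μ, ∀ x ∈ (LieAlgebra.ad K L h).maxGenEigenspace μ, ⁅s, x⁆ = μ • x)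
    {v : L} (hv : ⁅v, h⁆ = 0) : ⁅v, s⁆ = 0 := by
  rw [← lie_skew, neg_eq_zero]
  refine eq_zero_of_forall_lie_eq_zero K fun x => ?_
  have hx : x ∈ ⨆ μ, (LieAlgebra.ad K L h).maxGenEigenspace μ := hh ▸ Submodule.mem_top
  have hcomm : Commute (LieAlgebra.ad K L h) (LieAlgebra.ad K L v) := by
    ext x
    simp only [Module.End.mul_apply, LieAlgebra.ad_apply]
    rw [leibniz_lie h, ← lie_skew h v, hv, neg_zero, zero_lie, zero_add]
  induction hx using Submodule.iSup_induction' with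
  | zero => simp
  | add x y _ _ h1 h2 => rw [lie_add, h1, h2, add_zero]
  | mem μ x hx =>
    have hvx : ⁅v, x⁆ ∈ (LieAlgebra.ad K L h).maxGenEigenspace μ :=
      Module.End.mapsTo_maxGenEigenspace_of_comm hcomm μ hx
    rw [lie_lie, hs μ _ hvx, hs μ _ hx, lie_smul, sub_self]

theorem isNilpotent_ad_sub_semisimple_part [FiniteDimensional K L] {h s : L}
    (hh : ⨆ μ, (LieAlgebra.ad K L h).maxGenEigenspace μ = ⊤)
    (hs : ∀ μ, ∀ x ∈ (LieAlgebra.ad K L h).maxGenEigenspace μ, ⁅s, x⁆ = μ • x) : IsNilpotent (LieAlgebra.ad K L (h - s)) := by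
  rw [Module.End.isNilpotent_iff_of_finite]
  intro x
  have hx : x ∈ ⨆ μ, (LieAlgebra.ad K L h).maxGenEigenspace μ := hh ▸ Submodule.mem_top
  suffices x ∈ (LieAlgebra.ad K L (h - s)).maxGenEigenspace 0 by
    simpa [Module.End.mem_maxGenEigenspace] using this
  refine (iSup_le fun μ y hy => ?_ : _ ≤ (LieAlgebra.ad K L (h - s)).maxGenEigenspace 0) hx
  have key : ∀ n : ℕ, ((LieAlgebra.ad K L (h - s)) ^ n) y
      = ((LieAlgebra.ad K L h - μ • 1) ^ n) y := by
    intro n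
    induction n with
    | zero => rfl
    | succ n ih =>
      have hm : ((LieAlgebra.ad K L h - μ • 1) ^ n) y ∈ (LieAlgebra.ad K L h).maxGenEigenspace μ :=
        Module.End.mapsTo_maxGenEigenspace_of_comm
          (((Commute.refl _).sub_right ((Commute.one_right _).smul_right μ)).pow_right n) μ hy
      rw [pow_succ', pow_succ', Module.End.mul_apply, Module.End.mul_apply, ih]
      simp [hs μ _ hm]
  rw [Module.End.mem_maxGenEigenspace] at hy ⊢
  obtain ⟨k, hk⟩ := hy
  exact ⟨k, by rw [zero_smul, sub_zero, key, hk]⟩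

end SemisimplePart

/-! ### Weight decomposition under a split abelian subalgebra, and nondegeneracy of the Killing
form. -/

section RootSpaces

variable {F : Type*} [Field F] {g : Type*} [LieRing g] [LieAlgebra F g] {a : LieSubalgebra F g}

theorem lie_mem_rootSpace {lam mu : Module.Dual F a} {x y : g} (hx : x ∈ rootSpace lam)
    (hy : y ∈ rootSpace mu) : ⁅x, y⁆ ∈ rootSpace (lam + mu) := by
  intro h
  rw [leibniz_lie, hx h, hy h, smul_lie, lie_smul, LinearMap.add_apply, add_smul]

theorem mem_roots_of_ne_zero {lam : Module.Dual F a} (h0 : lam ≠ 0) {x : g}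
    (hx : x ∈ rootSpace lam) (hx0 : x ≠ 0) : lam ∈ roots a :=
  ⟨h0, fun h => hx0 (by rw [h] at hx; exact hx)⟩

theorem exists_ne_zero_of_mem_roots {lam : Module.Dual F a} (h : lam ∈ roots a) :
    ∃ x ∈ rootSpace lam, x ≠ 0 := (Submodule.ne_bot_iff _).1 h.2

/-- The sum of the root spaces `g^lam`, `lam ∈ S`. -/
def sumRoots (S : Set (Module.Dual F a)) : Submodule F g := ⨆ lam ∈ S, rootSpace lam

theorem rootSpace_le_sumRoots {S : Set (Module.Dual F a)} {lam : Module.Dual F a} (h : lam ∈ S) :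
    rootSpace lam ≤ sumRoots S := le_iSup₂ (f := fun l (_ : l ∈ S) => rootSpace l) lam h

theorem sumRoots_induction {S : Set (Module.Dual F a)} {p : g → Prop}
    (mem : ∀ lam ∈ S, ∀ x ∈ rootSpace lam, x ≠ 0 → p x) (zero : p 0)
    (add : ∀ x y, p x → p y → p (x + y)) {x : g} (hx : x ∈ sumRoots S) : p x := by
  rw [sumRoots, iSup_subtype'] at hx
  induction hx using Submodule.iSup_induction' with
  | zero => exact zero
  | add x y _ _ h1 h2 => exact add x y h1 h2
  | mem i x hx =>
    by_cases h : x = 0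
    · exact h ▸ zero
    · exact mem i i.2 x hx h

theorem sumRoots_le {S : Set (Module.Dual F a)} {W : Submodule F g}
    (h : ∀ lam ∈ S, ∀ x ∈ rootSpace lam, x ≠ 0 → x ∈ W) : sumRoots S ≤ W := fun _ hx =>
  sumRoots_induction h W.zero_mem (fun _ _ => W.add_mem) hx

theorem sumRoots_mono {S T : Set (Module.Dual F a)} (h : S ⊆ T) : sumRoots S ≤ sumRoots T :=
  sumRoots_le fun _ hl _ hx _ => rootSpace_le_sumRoots (h hl) hx

theorem lie_mem_sumRoots {S T U : Set (Module.Dual F a)}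
    (h : ∀ lam ∈ S, ∀ mu ∈ T, rootSpace (lam + mu) ≠ ⊥ → lam + mu ∈ U) {x y : g}
    (hx : x ∈ sumRoots S) (hy : y ∈ sumRoots T) : ⁅x, y⁆ ∈ sumRoots U := by
  refine sumRoots_induction (p := fun x => ⁅x, y⁆ ∈ sumRoots U) ?_ (by simp)
    (fun x x' h1 h2 => by rw [add_lie]; exact add_mem h1 h2) hx
  intro lam hl x hx _
  refine sumRoots_induction (p := fun y => ⁅x, y⁆ ∈ sumRoots U) ?_ (by simp)
    (fun y y' h1 h2 => by rw [lie_add]; exact add_mem h1 h2) hy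
  intro mu hm y hy _
  have hxy := lie_mem_rootSpace hx hy
  by_cases hb : rootSpace (lam + mu) = ⊥
  · rw [hb] at hxy
    rw [(Submodule.mem_bot F).1 hxy]
    exact zero_mem _
  · exact rootSpace_le_sumRoots (h lam hl mu hm hb) hxy

variable [FiniteDimensional F g]

theorem ad_commute_of_isSplitAbelian (hs : IsSplitAbelian F a) (v w : a) :
    Commute (LieAlgebra.ad F g v) (LieAlgebra.ad F g w) := by
  ext x
  simp only [Module.End.mul_apply, LieAlgebra.ad_apply]
  rw [leibniz_lie, hs.1 v v.2 w w.2, zero_lie, zero_add]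

theorem iSupIndep_rootSpace (hs : IsSplitAbelian F a) :
    iSupIndep fun lam : Module.Dual F a => rootSpace lam := by
  have h := Module.End.independent_iInf_maxGenEigenspace_of_forall_mapsTo
    (fun v : a => LieAlgebra.ad F g (v : g)) fun v w φ =>
      Module.End.mapsTo_maxGenEigenspace_of_comm (ad_commute_of_isSplitAbelian hs w v) φ
  refine (h.comp (f := fun lam : Module.Dual F a => (lam : a → F)) DFunLike.coe_injective).mono ?_
  intro lam x hx
  simp only [Function.comp_apply, Submodule.mem_iInf]
  intro v
  refine ((LieAlgebra.ad F g (v : g)).genEigenspace _).mono (le_top (a := 1)) ?_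
  change x ∈ (LieAlgebra.ad F g (v : g)).eigenspace _
  exact Module.End.mem_eigenspace_iff.2 (hx v)

theorem iSup_rootSpace (hs : IsSplitAbelian F a) :
    ⨆ lam : Module.Dual F a, rootSpace lam = ⊤ := by
  have hgen : ∀ (v : a) μ, (LieAlgebra.ad F g (v : g)).maxGenEigenspace μ
      = (LieAlgebra.ad F g (v : g)).eigenspace μ := fun v μ =>
    maxGenEigenspace_eq_of_iSup_eigenspace (hs.2 v v.2) μ
  have h := Module.End.iSup_iInf_maxGenEigenspace_eq_top_of_iSup_maxGenEigenspace_eq_top_of_commute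
    (fun v : a => LieAlgebra.ad F g (v : g))
    (fun v w _ => ad_commute_of_isSplitAbelian hs v w)
    (fun v => by simp only [hgen]; exact hs.2 v v.2)
  rw [eq_top_iff, ← h]
  refine iSup_le fun χ x hx => ?_
  simp only [hgen, Submodule.mem_iInf, Module.End.mem_eigenspace_iff, LieAlgebra.ad_apply] at hx
  by_cases hx0 : x = 0
  · rw [hx0]; exact zero_mem _
  have hinj : ∀ c d : F, c • x = d • x → c = d := fun c d hcd => smul_left_injective F hx0 hcd
  -- The joint eigenvalue of a nonzero vector is automatically linear.
  let lam : Module.Dual F a :=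
    { toFun := χ
      map_add' := fun v w => hinj _ _ (by
        rw [← hx, add_smul, ← hx, ← hx, ← add_lie]; rfl)
      map_smul' := fun c v => hinj _ _ (by
        rw [← hx, RingHom.id_apply, smul_eq_mul, mul_smul, ← hx, ← smul_lie]; rfl) }
  exact (le_iSup (fun lam : Module.Dual F a => rootSpace lam) lam) hx

open Classical in
/-- The projection onto the root space `g^lam`. -/
def rootProj (hs : IsSplitAbelian F a) (lam : Module.Dual F a) : Module.End F g :=
  let hI : DirectSum.IsInternal fun lam : Module.Dual F a => rootSpace lam :=
    DirectSum.isInternal_submodule_of_iSupIndep_of_iSup_eq_top (iSupIndep_rootSpace hs)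
      (iSup_rootSpace hs)
  letI := hI.chooseDecomposition
  (rootSpace lam).subtype ∘ₗ DirectSum.component F _ _ lam ∘ₗ
    (DirectSum.decomposeLinearEquiv fun lam : Module.Dual F a => rootSpace lam).toLinearMap

theorem rootProj_mem (hs : IsSplitAbelian F a) (lam : Module.Dual F a) (x : g) :
    rootProj hs lam x ∈ rootSpace lam := Subtype.property _

theorem rootProj_of_mem (hs : IsSplitAbelian F a) {lam : Module.Dual F a} {x : g}
    (hx : x ∈ rootSpace lam) : rootProj hs lam x = x := by
  classical
  let _ := (DirectSum.isInternal_submodule_of_iSupIndep_of_iSup_eq_top (iSupIndep_rootSpace hs)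
    (iSup_rootSpace hs)).chooseDecomposition
  exact DirectSum.decompose_of_mem_same (fun lam : Module.Dual F a => rootSpace lam) hx

theorem rootProj_of_mem_ne (hs : IsSplitAbelian F a) {lam mu : Module.Dual F a} {x : g}
    (hx : x ∈ rootSpace lam) (h : lam ≠ mu) : rootProj hs mu x = 0 := by
  classical
  let _ := (DirectSum.isInternal_submodule_of_iSupIndep_of_iSup_eq_top (iSupIndep_rootSpace hs)
    (iSup_rootSpace hs)).chooseDecomposition
  exact DirectSum.decompose_of_mem_ne (fun lam : Module.Dual F a => rootSpace lam) hx h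

theorem linearMap_ext_rootSpace (hs : IsSplitAbelian F a) {M : Type*} [AddCommGroup M] [Module F M]
    {f f' : g →ₗ[F] M} (h : ∀ lam : Module.Dual F a, ∀ x ∈ rootSpace lam, f x = f' x) : f = f' := by
  ext x
  have hx : x ∈ ⨆ lam : Module.Dual F a, rootSpace lam := iSup_rootSpace hs ▸ Submodule.mem_top
  induction hx using Submodule.iSup_induction' with
  | zero => simp
  | add x y _ _ h1 h2 => rw [map_add, map_add, h1, h2]
  | mem lam x hx => exact h lam x hx

theorem mem_sumRoots_of_rootProj (hs : IsSplitAbelian F a) {S : Set (Module.Dual F a)} {x : g}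
    (h : ∀ lam, rootProj hs lam x ≠ 0 → lam ∈ S) : x ∈ sumRoots S := by
  classical
  have hI : DirectSum.IsInternal fun lam : Module.Dual F a => rootSpace lam :=
    DirectSum.isInternal_submodule_of_iSupIndep_of_iSup_eq_top (iSupIndep_rootSpace hs)
      (iSup_rootSpace hs)
  let _ := hI.chooseDecomposition
  have := DirectSum.sum_support_decompose (fun lam : Module.Dual F a => rootSpace lam) x
  rw [← this]
  refine sum_mem fun lam hl => rootSpace_le_sumRoots (h lam ?_) (Subtype.property _)
  rw [DFinsupp.mem_support_toFun] at hl
  intro h0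
  exact hl (Subtype.ext h0)

theorem rootProj_lie (hs : IsSplitAbelian F a) {lam mu : Module.Dual F a} {x : g}
    (hx : x ∈ rootSpace lam) (y : g) :
    rootProj hs (lam + mu) ⁅x, y⁆ = ⁅x, rootProj hs mu y⁆ := by
  have : rootProj hs (lam + mu) ∘ₗ (LieAlgebra.ad F g x) = (LieAlgebra.ad F g x) ∘ₗ rootProj hs mu := by
    refine linearMap_ext_rootSpace hs fun nu z hz => ?_
    simp only [LinearMap.comp_apply, LieAlgebra.ad_apply]
    by_cases h : nu = mu
    · subst h
      rw [rootProj_of_mem hs hz, rootProj_of_mem hs (lie_mem_rootSpace hx hz)]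
    · rw [rootProj_of_mem_ne hs hz h,
        rootProj_of_mem_ne hs (lie_mem_rootSpace hx hz) (fun h' => h (add_left_cancel h')), lie_zero]
  exact LinearMap.congr_fun this y

theorem coe_mem_rootSpace_zero (hs : IsSplitAbelian F a) (v : a) :
    (v : g) ∈ rootSpace (0 : Module.Dual F a) := fun h => by
  rw [hs.1 h h.2 v v.2, LinearMap.zero_apply, zero_smul]

/-- A joint eigenvector of elements of `a` is a sum of root vectors with the same eigenvalues. -/
theorem mem_sumRoots_of_lie_eq_smul (hs : IsSplitAbelian F a) {I : Set (a × F)} {x : g}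
    (hx : ∀ i ∈ I, ⁅(i.1 : g), x⁆ = i.2 • x) :
    x ∈ sumRoots {lam : Module.Dual F a | rootSpace lam ≠ ⊥ ∧ ∀ i ∈ I, lam i.1 = i.2} := by
  refine mem_sumRoots_of_rootProj hs fun lam hl => ⟨?_, fun i hi => ?_⟩
  · rw [Submodule.ne_bot_iff]
    exact ⟨_, rootProj_mem hs lam x, hl⟩
  · have h1 := rootProj_lie hs (mu := lam) (coe_mem_rootSpace_zero hs i.1) x
    rw [zero_add, hx i hi, map_smul, rootProj_mem hs lam x i.1] at h1
    exact (smul_left_injective F hl h1).symm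

/-- The weight components of `x` satisfy the same eigenvalue equations, and one of them is nonzero.
The weight may be 0. -/
theorem exists_weight_of_lie_eq_smul (hs : IsSplitAbelian F a) {I : Set (a × F)} {x : g}
    (hx0 : x ≠ 0) (hx : ∀ i ∈ I, ⁅(i.1 : g), x⁆ = i.2 • x) :
    ∃ lam : Module.Dual F a, rootSpace lam ≠ ⊥ ∧ ∀ i ∈ I, lam i.1 = i.2 := by
  by_contra! hcon
  have := mem_sumRoots_of_lie_eq_smul hs hx
  rw [show {lam : Module.Dual F a | rootSpace lam ≠ ⊥ ∧ ∀ i ∈ I, lam i.1 = i.2} = ∅ by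
    ext lam
    simp only [Set.mem_ofPred_eq, Set.mem_empty_iff_false, iff_false, not_and]
    intro h h'
    obtain ⟨i, hi, hi'⟩ := hcon lam h
    exact hi' (h' i hi)] at this
  simp [sumRoots] at this
  exact hx0 this

variable [CharZero F]

/-- `ad v` is diagonalizable with integral eigenvalues `m`, so the trace of its square is `∑ m²
dim`, a positive integer. -/
theorem killingForm_self_ne_zero (hs : IsSplitAbelian F a) {v : a}
    (hint : ∀ lam ∈ roots a, ∃ m : ℤ, lam v = m) (hne : ∃ lam ∈ roots a, lam v ≠ 0) :
    killingForm F g v v ≠ 0 := by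
  classical
  set f := LieAlgebra.ad F g (v : g) with hf
  have hI : DirectSum.IsInternal f.eigenspace :=
    DirectSum.isInternal_submodule_of_iSupIndep_of_iSup_eq_top f.eigenspaces_iSupIndep
      (hs.2 v v.2)
  have hfin : {μ | f.eigenspace μ ≠ ⊥}.Finite :=
    WellFoundedGT.finite_ne_bot_of_iSupIndep f.eigenspaces_iSupIndep
  have hmaps : ∀ μ, Set.MapsTo (f ∘ₗ f) (f.eigenspace μ) (f.eigenspace μ) := fun μ x hx => by
    have hx' : f x = μ • x := Module.End.mem_eigenspace_iff.1 hx
    simp only [LinearMap.comp_apply, hx', map_smul]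
    exact Submodule.smul_mem _ _ (Submodule.smul_mem _ _ hx)
  have hev : ∀ μ, f.eigenspace μ ≠ ⊥ → ∃ m : ℤ, μ = m := by
    intro μ hμ
    obtain ⟨x, hx, hx0⟩ := (Submodule.ne_bot_iff _).1 hμ
    obtain ⟨lam, hl, hlv⟩ := exists_weight_of_lie_eq_smul hs (I := {(v, μ)}) hx0
      (by rintro _ rfl; exact Module.End.mem_eigenspace_iff.1 hx)
    have hlv : lam v = μ := hlv (v, μ) rfl
    by_cases h0 : lam = 0
    · exact ⟨0, by rw [← hlv, h0]; simp⟩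
    · obtain ⟨m, hm⟩ := hint lam ⟨h0, hl⟩
      exact ⟨m, by rw [← hm]; exact hlv.symm⟩
  choose! m hm using hev
  have htr : ∀ μ ∈ hfin.toFinset, LinearMap.trace F (f.eigenspace μ) ((f ∘ₗ f).restrict (hmaps μ))
      = ((m μ ^ 2 * Module.finrank F (f.eigenspace μ) : ℤ) : F) := by
    intro μ hμ
    have hμ' : f.eigenspace μ ≠ ⊥ := by simpa using hμ
    have : (f ∘ₗ f).restrict (hmaps μ) = (μ ^ 2) • LinearMap.id := by
      ext ⟨x, hx⟩
      have hx' : f x = μ • x := Module.End.mem_eigenspace_iff.1 hx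
      change f (f x) = μ ^ 2 • x
      rw [hx', map_smul, hx', smul_smul, pow_two]
    rw [this, map_smul, LinearMap.trace_id, smul_eq_mul]
    conv_lhs => rw [hm μ hμ']
    push_cast
    rw [← hm μ hμ']
  have hK : killingForm F g v v = LinearMap.trace F g (f ∘ₗ f) := rfl
  rw [hK, LinearMap.trace_eq_sum_trace_restrict' hI hfin hmaps, Finset.sum_congr rfl htr]
  rw [← Int.cast_sum]
  norm_cast
  obtain ⟨lam, hl, hlv⟩ := hne
  obtain ⟨x, hx, hx0⟩ := exists_ne_zero_of_mem_roots hl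
  have hxe : x ∈ f.eigenspace (lam v) := Module.End.mem_eigenspace_iff.2 (hx v)
  have hb : f.eigenspace (lam v) ≠ ⊥ := (Submodule.ne_bot_iff _).2 ⟨x, hxe, hx0⟩
  refine (Finset.sum_pos' (fun μ _ => by positivity) ⟨lam v, by simpa using hb, ?_⟩).ne'
  have h1 : m (lam v) ≠ 0 := fun h0 => hlv (by rw [hm _ hb, h0, Int.cast_zero])
  have h2 : 0 < Module.finrank F (f.eigenspace (lam v)) := by
    rw [Module.finrank_pos_iff]
    exact Submodule.nontrivial_iff_ne_bot.2 hb
  positivity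

/-- Over the algebraic closure the radical of the Killing form becomes an ideal of a simple algebra,
hence 0 or everything; the vector `v` rules out the latter. -/
theorem isKilling_of_absolutelySimple (hsimple : AbsolutelySimple F g) {v : g}
    (hv : killingForm F g v v ≠ 0) : LieAlgebra.IsKilling F g := by
  have : LieAlgebra.IsSimple (AlgebraicClosure F) (AlgebraicClosure F ⊗[F] g) := hsimple
  refine ⟨?_⟩
  set I := LieIdeal.killingCompl F g ⊤ with hI
  have hIv : ∀ x ∈ I, killingForm F g x v = 0 := fun x hx => by
    rw [LieIdeal.mem_killingCompl] at hx
    rw [LieModule.traceForm_comm]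
    exact hx v trivial
  rcases LieAlgebra.IsSimple.eq_bot_or_eq_top (R := AlgebraicClosure F)
    (I.baseChange (AlgebraicClosure F)) with h | h
  · rw [eq_bot_iff]
    intro x hx
    have h1 : (1 : AlgebraicClosure F) ⊗ₜ[F] x ∈ I.baseChange (AlgebraicClosure F) :=
      LieSubmodule.tmul_mem_baseChange_of_mem 1 hx
    rw [h, LieSubmodule.mem_bot] at h1
    have := Module.FaithfullyFlat.tensorProduct_mk_injective (A := F) (B := AlgebraicClosure F) g
    exact (LieSubmodule.mem_bot x).2 (this (by simpa using h1))
  · exfalso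
    have h1 : (1 : AlgebraicClosure F) ⊗ₜ[F] v ∈ I.baseChange (AlgebraicClosure F) := by
      rw [h]; trivial
    have key : ∀ y ∈ I.baseChange (AlgebraicClosure F),
        (killingForm F g).baseChange (AlgebraicClosure F) y ((1 : AlgebraicClosure F) ⊗ₜ[F] v) = 0 := by
      intro y hy
      rw [LieSubmodule.mem_baseChange_iff] at hy
      induction hy using Submodule.span_induction with
      | zero => simp
      | add y z _ _ h1 h2 => rw [map_add, LinearMap.add_apply, h1, h2, add_zero]
      | smul c y _ h1 => rw [map_smul, LinearMap.smul_apply, h1, smul_zero]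
      | mem y hy =>
        obtain ⟨x, hx, rfl⟩ := hy
        simp [hIv x hx]
    have := key _ h1
    simp at this
    exact hv this

end RootSpaces

/-! ### Triples through root vectors. -/

section Triples

variable {F : Type*} [Field F] [CharZero F] {g : Type*} [LieRing g] [LieAlgebra F g]
  [FiniteDimensional F g] {a : LieSubalgebra F g}

/-- A split element commuting with a maximal split abelian subalgebra `a` belongs to `a`. -/
theorem mem_of_commute_of_split (ha : Maximal (IsSplitAbelian F) a) {s : g}
    (hcomm : ∀ v ∈ a, ⁅v, s⁆ = 0)
    (hs : ⨆ μ, Module.End.eigenspace (LieAlgebra.ad F g s) μ = ⊤) : s ∈ a := by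
  -- Adding the line of `s` to `a` gives a split abelian subalgebra, since commuting diagonalizable
  -- operators are simultaneously diagonalizable; maximality of `a` then puts `s` in `a`.
  let b : LieSubalgebra F g :=
    { (a.toSubmodule ⊔ Submodule.span F {s} : Submodule F g) with
      lie_mem' := by
        intro x y hx hy
        obtain ⟨v, hv, x', hx', rfl⟩ := Submodule.mem_sup.1 hx
        obtain ⟨w, hw, y', hy', rfl⟩ := Submodule.mem_sup.1 hy
        obtain ⟨c, rfl⟩ := Submodule.mem_span_singleton.1 hx'
        obtain ⟨d, rfl⟩ := Submodule.mem_span_singleton.1 hy'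
        have : ⁅v + c • s, w + d • s⁆ = 0 := by
          simp [ha.prop.1 v hv w hw, hcomm v hv, ← lie_skew s w, hcomm w hw]
        rw [this]
        exact Submodule.zero_mem _ }
  have hb : IsSplitAbelian F b := by
    refine ⟨?_, ?_⟩
    · intro x hx y hy
      obtain ⟨v, hv, x', hx', rfl⟩ := Submodule.mem_sup.1 hx
      obtain ⟨w, hw, y', hy', rfl⟩ := Submodule.mem_sup.1 hy
      obtain ⟨c, rfl⟩ := Submodule.mem_span_singleton.1 hx'
      obtain ⟨d, rfl⟩ := Submodule.mem_span_singleton.1 hy'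
      simp [ha.prop.1 v hv w hw, hcomm v hv, ← lie_skew s w, hcomm w hw]
    · intro x hx
      obtain ⟨v, hv, x', hx', rfl⟩ := Submodule.mem_sup.1 hx
      obtain ⟨c, rfl⟩ := Submodule.mem_span_singleton.1 hx'
      let f : Bool → Module.End F g := fun i =>
        if i then LieAlgebra.ad F g v else LieAlgebra.ad F g s
      have hgen : ∀ i μ, (f i).maxGenEigenspace μ = (f i).eigenspace μ := by
        rintro (_ | _) μ
        · exact maxGenEigenspace_eq_of_iSup_eigenspace hs μ
        · exact maxGenEigenspace_eq_of_iSup_eigenspace (ha.prop.2 v hv) μ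
      have hc : Commute (LieAlgebra.ad F g v) (LieAlgebra.ad F g s) := by
        ext x
        simp only [Module.End.mul_apply, LieAlgebra.ad_apply]
        rw [leibniz_lie, hcomm v hv, zero_lie, zero_add]
      have h := Module.End.iSup_iInf_maxGenEigenspace_eq_top_of_iSup_maxGenEigenspace_eq_top_of_commute
        f (by rintro (_ | _) (_ | _) hij; exacts [absurd rfl hij, hc.symm, hc, absurd rfl hij])
        (by
          rintro (_ | _)
          · simp only [hgen]; exact hs
          · simp only [hgen]; exact ha.prop.2 v hv)
      rw [eq_top_iff, ← h]
      refine iSup_le fun χ => le_iSup_of_le (χ true + c * χ false) fun x hx => ?_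
      simp only [hgen, Submodule.mem_iInf, Module.End.mem_eigenspace_iff] at hx
      have h1 : ⁅v, x⁆ = χ true • x := hx true
      have h2 : ⁅s, x⁆ = χ false • x := hx false
      rw [Module.End.mem_eigenspace_iff]
      simp [h1, h2, add_smul, mul_smul]
  have hab : a ≤ b := fun x hx => Submodule.mem_sup_left hx
  exact ha.le_of_ge hb hab (Submodule.mem_sup_right (Submodule.mem_span_singleton_self s))

variable [LieAlgebra.IsKilling F g]

/-- The component of weight `-al` of a solution of `[e, [e, z]] = -2e` is again a solution. The
semisimple part of `[e, z]` commutes with `a` and is split, hence lies in `a`. The weight `al = 0`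
is allowed on purpose: it shows that the centralizer of `a` has no nonzero nilpotent element. -/
theorem exists_lie_eq_add_isNilpotent (ha : Maximal (IsSplitAbelian F) a) {al : Module.Dual F a}
    {e : g} (he : e ∈ rootSpace al) (hn : IsNilpotent (LieAlgebra.ad F g e)) (he0 : e ≠ 0) :
    ∃ z ∈ rootSpace (-al), ∃ s : a, al s = 2 ∧ IsNilpotent (LieAlgebra.ad F g (⁅e, z⁆ - s)) := by
  obtain ⟨z', hz'⟩ := exists_lie_lie_eq_two_smul hn
  set z := rootProj ha.prop (-al) z' with hz
  have hzm : z ∈ rootSpace (-al) := rootProj_mem _ _ _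
  have hz2 : ⁅e, ⁅e, z⁆⁆ = -((2 : F) • e) := by
    rw [hz, ← rootProj_lie ha.prop he, ← rootProj_lie ha.prop he, hz', add_neg_cancel, add_zero,
      map_neg, map_smul, rootProj_of_mem ha.prop he]
  set h := ⁅e, z⁆ with hh
  have hhe : ⁅h, e⁆ = (2 : F) • e := by rw [← lie_skew, hz2, neg_neg]
  have htri : ⨆ μ, (LieAlgebra.ad F g h).maxGenEigenspace μ = ⊤ := by
    refine iSup_maxGenEigenspace_eq_top_of_commutators (A := LieAlgebra.ad F g e)
      (Z := LieAlgebra.ad F g z) hn ?_ ?_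
    · ext x; simp [hh]
    · ext x
      simp only [LinearMap.sub_apply, Module.End.mul_apply, LieAlgebra.ad_apply,
        LinearMap.smul_apply]
      rw [← lie_lie, hhe, smul_lie]
  obtain ⟨s, hs⟩ := exists_semisimple_part htri
  have hh0 : h ∈ rootSpace (0 : Module.Dual F a) := by
    have := lie_mem_rootSpace he hzm
    rwa [add_neg_cancel] at this
  have hsa : s ∈ a := by
    refine mem_of_commute_of_split ha (fun v hv => ?_) (iSup_eigenspace_semisimple_part htri hs)
    refine lie_semisimple_part_eq_zero htri hs ?_
    have := hh0 ⟨v, hv⟩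
    simpa using this
  refine ⟨z, hzm, ⟨s, hsa⟩, ?_, isNilpotent_ad_sub_semisimple_part htri hs⟩
  have hemem : e ∈ (LieAlgebra.ad F g h).maxGenEigenspace 2 := by
    refine ((LieAlgebra.ad F g h).genEigenspace _).mono (le_top (a := 1)) ?_
    change e ∈ (LieAlgebra.ad F g h).eigenspace _
    exact Module.End.mem_eigenspace_iff.2 hhe
  have h1 := hs 2 e hemem
  have h2 := he ⟨s, hsa⟩
  exact smul_left_injective F he0 (h2.symm.trans h1)

/-- The centralizer of a maximal split abelian subalgebra contains no nonzero nilpotent element. -/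
theorem eq_zero_of_isNilpotent_of_mem_rootSpace_zero (ha : Maximal (IsSplitAbelian F) a) {x : g}
    (hx : x ∈ rootSpace (0 : Module.Dual F a)) (hn : IsNilpotent (LieAlgebra.ad F g x)) :
    x = 0 := by
  by_contra hx0
  -- For the weight 0 the conclusion `al s = 2` reads `0 = 2`.
  obtain ⟨z, -, s, hs, -⟩ := exists_lie_eq_add_isNilpotent ha hx hn hx0
  simp at hs

/-- Every nonzero root vector is part of an `sl₂`-triple of root vectors with neutral element
in `a`. -/
theorem exists_sl2_of_mem_rootSpace (ha : Maximal (IsSplitAbelian F) a) {al : Module.Dual F a}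
    (hal : al ≠ 0) {e : g} (he : e ∈ rootSpace al) (he0 : e ≠ 0) :
    ∃ f ∈ rootSpace (-al), ∃ h : a, al h = 2 ∧ IsSl2Triple (h : g) e f := by
  obtain ⟨v, hv⟩ : ∃ v, al v ≠ 0 := by
    by_contra! hcon
    exact hal (LinearMap.ext hcon)
  have hn : IsNilpotent (LieAlgebra.ad F g e) := isNilpotent_ad_of_lie_eq_smul hv (he v)
  obtain ⟨z, hz, s, hs, hns⟩ := exists_lie_eq_add_isNilpotent ha he hn he0
  -- The nilpotent part of `[e, z]` centralizes `a`, hence vanishes.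
  have hez : ⁅e, z⁆ = s := by
    refine sub_eq_zero.1 (eq_zero_of_isNilpotent_of_mem_rootSpace_zero ha (sub_mem ?_ ?_) hns)
    · have := lie_mem_rootSpace he hz
      rwa [add_neg_cancel] at this
    · exact coe_mem_rootSpace_zero ha.prop s
  have hse : ⁅(s : g), e⁆ = (2 : F) • e := by rw [he s, hs]
  refine ⟨z, hz, s, hs, ⟨?_, hez, ?_, ?_⟩⟩
  · intro h0
    rw [h0, zero_lie] at hse
    exact smul_ne_zero two_ne_zero he0 hse.symm
  · rw [hse, ofNat_smul_eq_nsmul]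
  · rw [hz s, LinearMap.neg_apply, hs, neg_smul, ofNat_smul_eq_nsmul]

theorem killingForm_coroot_eq_zero {al : Module.Dual F a} {e f : g} {h : a}
    (t : IsSl2Triple (h : g) e f) (hf : f ∈ rootSpace (-al)) {v : a} (hv : al v = 0) :
    killingForm F g h v = 0 := by
  rw [← t.lie_e_f, LieModule.traceForm_apply_lie_apply, ← lie_skew, hf v]
  simp [hv]

end Triples

/-! ### Mirrors attached to 1-simple elements, and values of very special elements. -/

section Mirror

variable {F : Type*} [Field F] [CharZero F] {g : Type*} [LieRing g] [LieAlgebra F g]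
  [FiniteDimensional F g] {a : LieSubalgebra F g}

/-- An `sl₂`-triple with neutral element `h ∈ a` reflects the weights of `a` in the
direction `h`. -/
theorem exists_mirror (hs : IsSplitAbelian F a) {h : a} {x y : g} (t : IsSl2Triple (h : g) x y)
    {lam : Module.Dual F a} (hl : rootSpace lam ≠ ⊥) :
    ∃ mu : Module.Dual F a, rootSpace mu ≠ ⊥ ∧ mu h = -lam h ∧
      ∀ v : a, ⁅(v : g), x⁆ = 0 → ⁅(v : g), y⁆ = 0 → mu v = lam v := by
  obtain ⟨θ, hθ, hθh, hθv⟩ := exists_reflection (K := F) t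
  obtain ⟨z, hz, hz0⟩ := (Submodule.ne_bot_iff _).1 hl
  let I : Set (a × F) :=
    {(h, -lam h)} ∪ {i | ⁅(i.1 : g), x⁆ = 0 ∧ ⁅(i.1 : g), y⁆ = 0 ∧ i.2 = lam i.1}
  obtain ⟨mu, hmu, hI⟩ := exists_weight_of_lie_eq_smul hs (I := I) (x := θ z)
    (by simpa using hz0) (by
      rintro i (rfl | ⟨hix, hiy, hi⟩)
      · have : (h : g) = θ (-(h : g)) := by rw [map_neg, hθh, neg_neg]
        change ⁅(h : g), θ z⁆ = (-lam h) • θ z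
        rw [this, ← hθ, neg_lie, hz h, ← neg_smul, map_smul]
      · rw [← hθv i.1 hix hiy, ← hθ, hz i.1, hi, map_smul])
  exact ⟨mu, hmu, hI (h, -lam h) (Or.inl rfl), fun v hx hy => hI (v, lam v) (Or.inr ⟨hx, hy, rfl⟩)⟩

theorem rootSpace_reflection_ne_bot (hs : IsSplitAbelian F a) {al : Module.Dual F a} {h : a}
    {e f : g} (he : e ∈ rootSpace al) (hf : f ∈ rootSpace (-al)) (hal : al h = 2)
    (t : IsSl2Triple (h : g) e f) {lam : Module.Dual F a} (hl : rootSpace lam ≠ ⊥) :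
    rootSpace (lam - lam h • al) ≠ ⊥ := by
  obtain ⟨mu, hmu, hmuh, hmuv⟩ := exists_mirror hs t hl
  -- `a` is the sum of the line of `h` and the kernel of `al`, and `mu` is known on both.
  have : lam - lam h • al = mu := by
    ext w
    have hv : al (w - (al w / 2) • h) = 0 := by simp [hal]
    have h1 := hmuv (w - (al w / 2) • h) (by rw [he, hv, zero_smul])
      (by rw [hf, LinearMap.neg_apply, hv, neg_zero, zero_smul])
    simp only [map_sub, map_smul, smul_eq_mul, hmuh] at h1
    simp only [LinearMap.sub_apply, LinearMap.smul_apply, smul_eq_mul]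
    linear_combination -h1
  rwa [this]

section OneSimple

variable {H₀ h : a}

theorem mem_sumRoots_of_mem_E (hs : IsSplitAbelian F a) {m : ℤ} (hm : m ≠ 0) {c : F} {x : g}
    (hx : x ∈ E F (H₀ : g) m) (hh : ⁅(h : g), x⁆ = c • x) :
    x ∈ sumRoots {lam | lam ∈ roots a ∧ lam H₀ = m ∧ lam h = c} := by
  refine sumRoots_mono ?_ (mem_sumRoots_of_lie_eq_smul hs (I := {(H₀, (m : F)), (h, c)}) ?_)
  · rintro lam ⟨hl, hI⟩
    have h1 : lam H₀ = m := hI (H₀, (m : F)) (by simp)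
    refine ⟨⟨?_, hl⟩, h1, hI (h, c) (by simp)⟩
    rintro rfl
    rw [LinearMap.zero_apply] at h1
    exact hm (by exact_mod_cast h1.symm)
  · rintro i (rfl | rfl)
    · exact Module.End.mem_eigenspace_iff.1 hx
    · exact hh

theorem lie_eq_zero_of_mem_sumRoots {S : Set (Module.Dual F a)} {v : a}
    (hv : ∀ lam ∈ S, lam v = 0) {x : g} (hx : x ∈ sumRoots S) : ⁅(v : g), x⁆ = 0 := by
  refine sumRoots_induction (p := fun x => ⁅(v : g), x⁆ = (0 : g)) ?_ (lie_zero _) ?_ hx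
  · intro lam hl x hx _
    rw [hx v, hv lam hl, zero_smul]
  · intro x y h1 h2
    rw [lie_add, h1, h2, add_zero]

/-- The root components of `x` and `y` have the values `±(1, 2)` on `(H₀, h)`. The last clause, a
criterion for commuting with the triple, is what the mirrors and the orthogonality relations use. -/
theorem OneSimple.exists_triple (hs : IsSplitAbelian F a) (hneg : ∀ lam ∈ roots a, -lam ∈ roots a)
    (ho : OneSimple F (H₀ : g) (h : g)) :
    ∃ x y : g, IsSl2Triple (h : g) x y ∧
      x ∈ sumRoots {lam | lam ∈ roots a ∧ lam H₀ = 1 ∧ lam h = 2} ∧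
      y ∈ sumRoots {lam | lam ∈ roots a ∧ lam H₀ = -1 ∧ lam h = -2} ∧
      ∀ v : a, (∀ be ∈ roots a, be H₀ = 1 → be h = 2 → be v = 0) →
        ⁅(v : g), x⁆ = 0 ∧ ⁅(v : g), y⁆ = 0 := by
  obtain ⟨x, hx, y, hy, t⟩ := ho
  have hx' := mem_sumRoots_of_mem_E hs one_ne_zero hx (t.lie_h_e_smul F)
  have hy' := mem_sumRoots_of_mem_E hs (by simp) hy
    (c := -2) (by rw [t.lie_lie_smul_f F, neg_smul])
  push_cast at hx' hy'
  refine ⟨x, y, t, hx', hy', fun v hv => ⟨lie_eq_zero_of_mem_sumRoots ?_ hx',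
    lie_eq_zero_of_mem_sumRoots ?_ hy'⟩⟩
  · rintro be ⟨h1, h2, h3⟩
    exact hv be h1 h2 h3
  · rintro be ⟨h1, h2, h3⟩
    have := hv (-be) (hneg be h1) (by simp [h2]) (by simp [h3])
    simpa using this

theorem OneSimple.ne_zero (ho : OneSimple F (H₀ : g) (h : g)) : h ≠ 0 := by
  obtain ⟨x, -, y, -, t⟩ := ho
  exact fun h0 => t.h_ne_zero (by rw [h0]; rfl)

theorem OneSimple.exists_root (hs : IsSplitAbelian F a)
    (ho : OneSimple F (H₀ : g) (h : g)) : ∃ be ∈ roots a, be H₀ = 1 ∧ be h = 2 := by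
  obtain ⟨x, hx, y, hy, t⟩ := ho
  have hx' := mem_sumRoots_of_mem_E hs one_ne_zero hx (t.lie_h_e_smul F)
  by_contra! hcon
  apply t.e_ne_zero
  have : sumRoots {lam | lam ∈ roots a ∧ lam H₀ = ((1 : ℤ) : F) ∧ lam h = 2} ≤ ⊥ :=
    sumRoots_le fun lam hl => absurd hl.2.2 (hcon lam hl.1 (by simpa using hl.2.1))
  exact this hx'

theorem OneSimple.exists_mirror (hs : IsSplitAbelian F a)
    (hneg : ∀ lam ∈ roots a, -lam ∈ roots a) (ho : OneSimple F (H₀ : g) (h : g))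
    {lam : Module.Dual F a} (hl : lam ∈ roots a) :
    ∃ mu : Module.Dual F a, rootSpace mu ≠ ⊥ ∧ mu h = -lam h ∧
      ∀ v : a, (∀ be ∈ roots a, be H₀ = 1 → be h = 2 → be v = 0) → mu v = lam v := by
  obtain ⟨x, y, t, -, -, hxy⟩ := ho.exists_triple hs hneg
  obtain ⟨mu, h1, h2, h3⟩ := Prehom.exists_mirror hs t hl.2
  exact ⟨mu, h1, h2, fun v hv => h3 v (hxy v hv).1 (hxy v hv).2⟩

/-- By invariance `κ(h, v) = κ([x, y], v) = κ(x, [y, v])`, and `v` commutes with `y`. -/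
theorem OneSimple.killingForm_eq_zero (hs : IsSplitAbelian F a)
    (hneg : ∀ lam ∈ roots a, -lam ∈ roots a) (ho : OneSimple F (H₀ : g) (h : g)) {v : a}
    (hv : ∀ be ∈ roots a, be H₀ = 1 → be h = 2 → be v = 0) : killingForm F g h v = 0 := by
  obtain ⟨x, y, t, -, -, hxy⟩ := ho.exists_triple hs hneg
  rw [← t.lie_e_f, LieModule.traceForm_apply_lie_apply, ← lie_skew, (hxy v hv).2]
  simp

theorem Special.exists_nat (hsp : Special F (H₀ : g) (h : g)) {lam : Module.Dual F a}
    (hl : lam ∈ roots a) (h1 : lam H₀ = 1) : ∃ q : ℕ, lam h = q := by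
  obtain ⟨x, hx, hx0⟩ := exists_ne_zero_of_mem_roots hl
  have hxn : x ∈ nilp F ((2 : F) • (H₀ : g)) := by
    -- The index `i` of `nilp` stands for the eigenvalue `i + 1`, and `x` has eigenvalue 2 under
    -- `2H₀`.
    refine Submodule.mem_iSup_of_mem 1 (Module.End.mem_eigenspace_iff.2 ?_)
    rw [LieAlgebra.ad_apply, smul_lie, hx H₀, h1, one_smul]
    norm_num
  have hxp := hsp.2 hxn
  by_contra! hcon
  apply hx0
  have hx1 : x ∈ Module.End.eigenspace (LieAlgebra.ad F g (h : g)) (lam h) :=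
    Module.End.mem_eigenspace_iff.2 (hx h)
  refine Submodule.disjoint_def.1
    ((LieAlgebra.ad F g (h : g)).eigenspaces_iSupIndep (lam h)) x hx1 ?_
  refine (iSup_le fun i => ?_ : parab F (h : g) ≤ _) hxp
  refine le_iSup₂_of_le (i : F) (fun h' => hcon i h'.symm) ?_
  simp [E]

/-- Both `lam h` and `lam (2H₀ - h) = 2 - lam h` are natural numbers. -/
theorem VerySpecial.values (hv : VerySpecial F (H₀ : g) (h : g)) {lam : Module.Dual F a}
    (hl : lam ∈ roots a) (h1 : lam H₀ = 1) : lam h = 0 ∨ lam h = 1 ∨ lam h = 2 := by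
  obtain ⟨q, hq⟩ := hv.1.exists_nat hl h1
  obtain ⟨r, hr⟩ := Special.exists_nat (h := (2 : F) • H₀ - h) hv.2 hl h1
  rw [map_sub, map_smul, h1, hq, smul_eq_mul, mul_one, sub_eq_iff_eq_add] at hr
  have : 2 = r + q := by exact_mod_cast hr
  rw [hq]
  have : q = 0 ∨ q = 1 ∨ q = 2 := by omega
  rcases this with rfl | rfl | rfl <;> simp

end OneSimple

end Mirror

/-! ### Roots in coordinates. -/

section Coordinates

variable {F : Type*} [Field F] [CharZero F] {g : Type*} [LieRing g] [LieAlgebra F g]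
  {a : LieSubalgebra F g} {n : ℕ} {e : Module.Basis (Fin n) F a} {R : CType} {k : ℕ} {H₀ : a}

theorem eps_succ (e : Module.Basis (Fin n) F a) (i : Fin n) : eps e (i + 1) = e.coord i := by
  rw [eps, dif_pos (by omega)]
  rfl

theorem eps_eq_coord (e : Module.Basis (Fin n) F a) {j : ℕ} (h1 : 1 ≤ j) (h2 : j ≤ n) :
    eps e j = e.coord ⟨j - 1, by omega⟩ := dif_pos ⟨h1, h2⟩

theorem coord_basis (e : Module.Basis (Fin n) F a) (i j : Fin n) :
    e.coord i (e j) = if j = i then 1 else 0 := by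
  rw [Module.Basis.coord_apply, Module.Basis.repr_self, Finsupp.single_apply]

theorem mem_posRoots_iff {lam : Module.Dual F a} : lam ∈ posRoots e R ↔
    (∃ i j : Fin n, i < j ∧ (lam = e.coord i - e.coord j ∨ lam = e.coord i + e.coord j)) ∨
    ((R = .B ∨ R = .BC) ∧ ∃ i : Fin n, lam = e.coord i) ∨
    ((R = .C ∨ R = .BC) ∧ ∃ i : Fin n, lam = (2 : F) • e.coord i) := by
  rw [posRoots, Set.mem_union, Set.mem_union, or_assoc]
  refine or_congr ⟨?_, ?_⟩ (or_congr (and_congr_right fun _ => ⟨?_, ?_⟩)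
    (and_congr_right fun _ => ⟨?_, ?_⟩))
  · rintro ⟨i, j, h1, h2, h3, h⟩
    rw [eps_eq_coord e h1 (by omega), eps_eq_coord e (by omega) h3] at h
    exact ⟨_, _, by rw [Fin.lt_def]; simp; omega, h⟩
  · rintro ⟨i, j, h, h'⟩
    refine ⟨i + 1, j + 1, by omega, by simpa using h, by omega, ?_⟩
    rw [eps_succ, eps_succ]
    exact h'
  · rintro ⟨i, h1, h2, rfl⟩
    exact ⟨_, eps_eq_coord e h1 h2⟩
  · rintro ⟨i, rfl⟩
    exact ⟨i + 1, by omega, by omega, (eps_succ e i).symm⟩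
  · rintro ⟨i, h1, h2, rfl⟩
    exact ⟨_, by rw [eps_eq_coord e h1 h2]⟩
  · rintro ⟨i, rfl⟩
    exact ⟨i + 1, by omega, by omega, by rw [eps_succ]⟩

theorem IsOfType.neg_mem (htype : IsOfType e R k H₀) {lam : Module.Dual F a} (h : lam ∈ roots a) :
    -lam ∈ roots a := by
  rw [htype.1] at h ⊢
  rcases h with h | h
  · exact Or.inr (by simpa using h)
  · exact Or.inl h

theorem IsOfType.sub_mem (htype : IsOfType e R k H₀) {i j : Fin n} (h : i ≠ j) :
    e.coord i - e.coord j ∈ roots a := by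
  rcases lt_or_gt_of_ne h with h | h
  · rw [htype.1]
    exact Or.inl (mem_posRoots_iff.2 (Or.inl ⟨i, j, h, Or.inl rfl⟩))
  · rw [← neg_sub]
    apply htype.neg_mem
    rw [htype.1]
    exact Or.inl (mem_posRoots_iff.2 (Or.inl ⟨j, i, h, Or.inl rfl⟩))

theorem IsOfType.add_mem (htype : IsOfType e R k H₀) {i j : Fin n} (h : i ≠ j) :
    e.coord i + e.coord j ∈ roots a := by
  rw [htype.1]
  rcases lt_or_gt_of_ne h with h | h
  · exact Or.inl (mem_posRoots_iff.2 (Or.inl ⟨i, j, h, Or.inr rfl⟩))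
  · exact Or.inl (mem_posRoots_iff.2 (Or.inl ⟨j, i, h, Or.inr (add_comm _ _)⟩))

/-- Consecutive coordinates of `H₀` agree except for a drop by 1 at `k`, and the last simple root
fixes the final coordinate. In types `C` and `D` the bound on `k` makes the last simple root vanish
on `H₀`. -/
theorem IsOfType.coord_H₀ (htype : IsOfType e R k H₀) (i : Fin n) :
    e.coord i H₀ = if (i : ℕ) < k then 1 else 0 := by
  obtain ⟨-, hsim, hk1, hkn, hC, hD⟩ := htype
  have hstep : ∀ j, 1 ≤ j → j < n → eps e j H₀ = eps e (j + 1) H₀ + if j = k then 1 else 0 := by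
    intro j h1 h2
    have := hsim j h1 h2.le
    rw [simpleRoot.eq_def, if_pos h2, LinearMap.sub_apply] at this
    rw [← this]; ring
  have hn : eps e n H₀ = if n = k then 1 else 0 := by
    have h := hsim n (by omega) le_rfl
    rw [simpleRoot.eq_def, if_neg (lt_irrefl n)] at h
    cases R with
    | B => exact h
    | BC => exact h
    | C =>
      have hne : n ≠ k := by have := hC rfl; omega
      simpa [hne] using h
    | D =>
      have hkn := hD rfl
      have hne : n ≠ k := by omega
      -- Here `k ≤ n - 2` also gives `ε_{n-1}(H₀) = ε_n(H₀)`, so their vanishing sum forces both to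
      -- be 0.
      have h2 := hstep (n - 1) (by omega) (by omega)
      rw [Nat.sub_add_cancel (by omega), if_neg (by omega), add_zero] at h2
      simp only [LinearMap.add_apply, h2, hne, if_false] at h
      rw [if_neg hne]
      have h3 : (2 : F) * eps e n H₀ = 0 := by rw [two_mul]; exact h
      simpa using h3
  have key : ∀ m j, j + m = n → 1 ≤ j → eps e j H₀ = if j ≤ k then 1 else 0 := by
    intro m
    induction m with
    | zero =>
      intro j hj _
      obtain rfl : j = n := by omega
      rw [hn]
      exact if_congr (by omega) rfl rfl
    | succ m ih =>
      intro j hj h1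
      rw [hstep j h1 (by omega), ih (j + 1) (by omega) (by omega)]
      split_ifs <;> first | omega | simp
  have := key (n - (i + 1)) (i + 1) (by omega) (by omega)
  rw [eps_succ] at this
  rw [this]
  exact if_congr (by omega) rfl rfl

/-- The roots taking the value `1` on `e i`. -/
theorem IsOfType.cases_of_apply_eq_one (htype : IsOfType e R k H₀) {lam : Module.Dual F a}
    (hl : lam ∈ roots a) {i : Fin n} (hi : lam (e i) = 1) :
    lam = e.coord i ∨ ∃ j, j ≠ i ∧ (lam = e.coord i + e.coord j ∨ lam = e.coord i - e.coord j) := by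
  rw [htype.1] at hl
  rcases hl with hl | hl
  · rcases mem_posRoots_iff.1 hl with ⟨p, q, hpq, rfl | rfl⟩ | ⟨-, p, rfl⟩ | ⟨-, p, rfl⟩ <;>
      simp only [LinearMap.sub_apply, LinearMap.add_apply, LinearMap.smul_apply, smul_eq_mul,
        coord_basis] at hi
    · by_cases h1 : i = p
      · subst h1; exact Or.inr ⟨q, hpq.ne', Or.inr rfl⟩
      · exfalso; rw [if_neg h1] at hi; split_ifs at hi <;> norm_num at hi
    · by_cases h1 : i = p
      · subst h1; exact Or.inr ⟨q, hpq.ne', Or.inl rfl⟩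
      · by_cases h2 : i = q
        · subst h2; exact Or.inr ⟨p, hpq.ne, Or.inl (add_comm _ _)⟩
        · simp [h1, h2] at hi
    · by_cases h1 : i = p
      · subst h1; exact Or.inl rfl
      · simp [h1] at hi
    · split_ifs at hi <;> norm_num at hi
  · rw [Set.mem_neg] at hl
    rw [← neg_neg lam] at hi ⊢
    generalize -lam = lam at *
    rcases mem_posRoots_iff.1 hl with ⟨p, q, hpq, rfl | rfl⟩ | ⟨-, p, rfl⟩ | ⟨-, p, rfl⟩ <;>
      simp only [LinearMap.neg_apply, LinearMap.sub_apply, LinearMap.add_apply,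
        LinearMap.smul_apply, smul_eq_mul, coord_basis] at hi
    · by_cases h1 : i = q
      · subst h1; exact Or.inr ⟨p, hpq.ne, Or.inr (neg_sub _ _)⟩
      · exfalso; rw [if_neg h1] at hi; split_ifs at hi <;> norm_num at hi
    · exfalso; split_ifs at hi <;> norm_num at hi
    · exfalso; split_ifs at hi <;> norm_num at hi
    · exfalso; split_ifs at hi <;> norm_num at hi

/-- The roots of degree one. -/
theorem IsOfType.cases_of_degree_one (htype : IsOfType e R k H₀) {lam : Module.Dual F a}
    (hl : lam ∈ roots a) (h1 : lam H₀ = 1) :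
    ∃ i : Fin n, (i : ℕ) < k ∧ (lam = e.coord i ∨ ∃ j : Fin n, k ≤ (j : ℕ) ∧
      (lam = e.coord i + e.coord j ∨ lam = e.coord i - e.coord j)) := by
  rw [htype.1] at hl
  rcases hl with hl | hl
  · rcases mem_posRoots_iff.1 hl with ⟨p, q, hpq, rfl | rfl⟩ | ⟨-, p, rfl⟩ | ⟨-, p, rfl⟩ <;>
      simp only [LinearMap.sub_apply, LinearMap.add_apply, LinearMap.smul_apply, smul_eq_mul,
        htype.coord_H₀] at h1
    · have hp : (p : ℕ) < k := by by_contra h; rw [if_neg h] at h1; split_ifs at h1 <;> norm_num at h1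
      have hq : k ≤ (q : ℕ) := by by_contra h; simp [hp, not_le.1 h] at h1
      exact ⟨p, hp, Or.inr ⟨q, hq, Or.inr rfl⟩⟩
    · have hp : (p : ℕ) < k := by
        by_contra h
        have : ¬ (q : ℕ) < k := by rw [Fin.lt_def] at hpq; omega
        simp [h, this] at h1
      have hq : k ≤ (q : ℕ) := by by_contra h; simp [hp, not_le.1 h] at h1
      exact ⟨p, hp, Or.inr ⟨q, hq, Or.inl rfl⟩⟩
    · have hp : (p : ℕ) < k := by by_contra h; simp [h] at h1
      exact ⟨p, hp, Or.inl rfl⟩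
    · split_ifs at h1 <;> norm_num at h1
  · rw [Set.mem_neg] at hl
    rw [← neg_neg lam] at h1 ⊢
    generalize -lam = lam at *
    rcases mem_posRoots_iff.1 hl with ⟨p, q, hpq, rfl | rfl⟩ | ⟨-, p, rfl⟩ | ⟨-, p, rfl⟩ <;>
      simp only [LinearMap.neg_apply, LinearMap.sub_apply, LinearMap.add_apply,
        LinearMap.smul_apply, smul_eq_mul, htype.coord_H₀] at h1
    · exfalso
      rw [Fin.lt_def] at hpq
      split_ifs at h1 <;> first | omega | norm_num at h1
    · exfalso; split_ifs at h1 <;> norm_num at h1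
    · exfalso; split_ifs at h1 <;> norm_num at h1
    · exfalso; split_ifs at h1 <;> norm_num at h1

end Coordinates

/-! ### The coordinates of a very special element. -/

section Classification

variable {F : Type*} [Field F] [CharZero F] {g : Type*} [LieRing g] [LieAlgebra F g]
  [FiniteDimensional F g] {a : LieSubalgebra F g} {n : ℕ} {e : Module.Basis (Fin n) F a}
  {R : CType} {k : ℕ} {H₀ : a}

theorem IsOfType.coord_values (htype : IsOfType e R k H₀) {h : a}
    (hv : VerySpecial F (H₀ : g) (h : g)) {i j : Fin n} (hi : (i : ℕ) < k) (hj : k ≤ (j : ℕ)) :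
    (e.coord i h + e.coord j h = 0 ∨ e.coord i h + e.coord j h = 1 ∨
      e.coord i h + e.coord j h = 2) ∧
    (e.coord i h - e.coord j h = 0 ∨ e.coord i h - e.coord j h = 1 ∨
      e.coord i h - e.coord j h = 2) := by
  have hij : i ≠ j := by rintro rfl; omega
  exact ⟨hv.values (htype.add_mem hij) (by simp [htype.coord_H₀, hi, not_lt.2 hj]),
    hv.values (htype.sub_mem hij) (by simp [htype.coord_H₀, hi, not_lt.2 hj])⟩

theorem IsOfType.coord_mem_roots (htype : IsOfType e R k H₀) (hR : R = .B ∨ R = .BC) (i : Fin n) :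
    e.coord i ∈ roots a := by
  rw [htype.1]
  exact Or.inl (mem_posRoots_iff.2 (Or.inr (Or.inl ⟨hR, i, rfl⟩)))

/-- The weight mirroring `ε_i + ε_j` with respect to a 1-simple `h`, when `e i` commutes with the
triple. -/
theorem IsOfType.exists_mirror_add (htype : IsOfType e R k H₀) (hs : IsSplitAbelian F a) {h : a}
    (ho : OneSimple F (H₀ : g) (h : g)) {i j : Fin n} (hij : i ≠ j)
    (hi : ∀ be ∈ roots a, be H₀ = 1 → be h = 2 → be (e i) = 0) :
    -(e.coord i h + e.coord j h) = e.coord i h ∨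
      ∃ l, l ≠ i ∧ (-(e.coord i h + e.coord j h) = e.coord i h + e.coord l h ∨
        -(e.coord i h + e.coord j h) = e.coord i h - e.coord l h) := by
  obtain ⟨mu, hmu, hmuh, hmuv⟩ :=
    ho.exists_mirror hs (fun _ => htype.neg_mem) (htype.add_mem hij)
  have h1 : mu (e i) = 1 := by
    rw [hmuv (e i) hi]
    simp [coord_basis, hij]
  have hmu' : mu ∈ roots a := ⟨by rintro rfl; simp at h1, hmu⟩
  rw [LinearMap.add_apply] at hmuh
  rw [← hmuh]
  rcases htype.cases_of_apply_eq_one hmu' h1 with rfl | ⟨l, hl, rfl | rfl⟩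
  · exact Or.inl rfl
  · exact Or.inr ⟨l, hl, Or.inl rfl⟩
  · exact Or.inr ⟨l, hl, Or.inr rfl⟩

/-- Some first coordinate `i` is 3/2 and another `i'` is 1/2. Roots of degree 1 with value 2 on `h`
vanish on `e i'`, so `ε_{i'} + ε_i`, of value 2, has a mirror of value -2 with `i'`-coordinate 1.
But roots with `i'`-coordinate 1 take no value below -1 on `h`. -/
theorem IsOfType.not_half_integral (htype : IsOfType e R k H₀) (hs : IsSplitAbelian F a) {h : a}
    (hv : VerySpecial F (H₀ : g) (h : g))
    (hlow : ∀ i : Fin n, (i : ℕ) < k → 2 * e.coord i h = 1 ∨ 2 * e.coord i h = 3)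
    (hhigh : ∀ j : Fin n, k ≤ (j : ℕ) → 2 * e.coord j h = 1 ∨ 2 * e.coord j h = -1) : False := by
  have hbe : ∀ be ∈ roots a, be H₀ = 1 → be h = 2 → ∃ i : Fin n, (i : ℕ) < k ∧
      2 * e.coord i h = 3 ∧ ∀ l : Fin n, (l : ℕ) < k → l ≠ i → be (e l) = 0 := by
    intro be h1 h2 h3
    obtain ⟨i, hi, rfl | ⟨j, hj, rfl | rfl⟩⟩ := htype.cases_of_degree_one h1 h2
    · have := hlow i hi
      exfalso; grind
    · refine ⟨i, hi, ?_, ?_⟩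
      · have := hlow i hi
        have := hhigh j hj
        rw [LinearMap.add_apply] at h3
        grind
      · intro l hl hli
        have : l ≠ j := by rintro rfl; omega
        simp [coord_basis, hli, this]
    · refine ⟨i, hi, ?_, ?_⟩
      · have := hlow i hi
        have := hhigh j hj
        rw [LinearMap.sub_apply] at h3
        grind
      · intro l hl hli
        have : l ≠ j := by rintro rfl; omega
        simp [coord_basis, hli, this]
  obtain ⟨be, h1, h2, h3⟩ := hv.1.1.exists_root hs
  obtain ⟨i, hi, hi3, -⟩ := hbe be h1 h2 h3
  -- A root of degree 1 with value 2 on `2H₀ - h` has value 0 on `h`, which forces a first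
  -- coordinate 1/2.
  obtain ⟨i', hi', hi1⟩ : ∃ i' : Fin n, (i' : ℕ) < k ∧ 2 * e.coord i' h = 1 := by
    obtain ⟨be, h1, h2, h3⟩ := OneSimple.exists_root (h := (2 : F) • H₀ - h) hs hv.2.1
    rw [map_sub, map_smul, h2, smul_eq_mul] at h3
    obtain ⟨i, hi, rfl | ⟨j, hj, rfl | rfl⟩⟩ := htype.cases_of_degree_one h1 h2 <;>
      refine ⟨i, hi, ?_⟩ <;> have := hlow i hi
    · exfalso; grind
    · have := hhigh j hj
      rw [LinearMap.add_apply] at h3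
      grind
    · have := hhigh j hj
      rw [LinearMap.sub_apply] at h3
      grind
  have hne : i' ≠ i := by rintro rfl; rw [hi1] at hi3; norm_num at hi3
  have hall : ∀ l : Fin n, 2 * e.coord l h = 1 ∨ 2 * e.coord l h = 3 ∨ 2 * e.coord l h = -1 := by
    intro l
    by_cases hl : (l : ℕ) < k
    · have := hlow l hl; tauto
    · have := hhigh l (not_lt.1 hl); tauto
  rcases htype.exists_mirror_add hs hv.1.1 hne (fun be h1 h2 h3 => by
    obtain ⟨q, -, hq3, hq⟩ := hbe be h1 h2 h3
    exact hq i' hi' (by rintro rfl; rw [hi1] at hq3; norm_num at hq3)) with h | ⟨l, -, h | h⟩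
  · grind
  · have := hall l
    grind
  · have := hall l
    grind

/-- Roots of degree 1 with value 2 on `h` involve, among the first `k` indices, only one whose
coordinate is 2; hence `e l` commutes with the triple whenever `l < k` and the coordinate at `l` is
not 2. This restricts the mirrors too much for a coordinate to be 1. -/
theorem IsOfType.coord_ne_one (htype : IsOfType e R k H₀) (hs : IsSplitAbelian F a) {h : a}
    (ho : OneSimple F (H₀ : g) (h : g))
    (hlow : ∀ i : Fin n, (i : ℕ) < k → e.coord i h = 0 ∨ e.coord i h = 1 ∨ e.coord i h = 2)
    (hhigh : ∀ j : Fin n, k ≤ (j : ℕ) → e.coord j h = 0) (i : Fin n) (hi : (i : ℕ) < k) :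
    e.coord i h ≠ 1 := by
  intro hi1
  have hbe : ∀ be ∈ roots a, be H₀ = 1 → be h = 2 → ∃ i : Fin n, (i : ℕ) < k ∧
      e.coord i h = 2 ∧ ∀ l : Fin n, (l : ℕ) < k → l ≠ i → be (e l) = 0 := by
    intro be h1 h2 h3
    obtain ⟨i, hi, rfl | ⟨j, hj, rfl | rfl⟩⟩ := htype.cases_of_degree_one h1 h2
    · exact ⟨i, hi, h3, fun l _ hl => by simp [coord_basis, hl]⟩
    · refine ⟨i, hi, by simpa [hhigh j hj] using h3, fun l hl hli => ?_⟩
      have : l ≠ j := by rintro rfl; omega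
      simp [coord_basis, hli, this]
    · refine ⟨i, hi, by simpa [hhigh j hj] using h3, fun l hl hli => ?_⟩
      have : l ≠ j := by rintro rfl; omega
      simp [coord_basis, hli, this]
  have hcomm : ∀ l : Fin n, (l : ℕ) < k → e.coord l h ≠ 2 →
      ∀ be ∈ roots a, be H₀ = 1 → be h = 2 → be (e l) = 0 := by
    intro l hl hl2 be h1 h2 h3
    obtain ⟨q, -, hq2, hq⟩ := hbe be h1 h2 h3
    exact hq l hl (by rintro rfl; exact hl2 hq2)
  have hi2 : e.coord i h ≠ 2 := by rw [hi1]; norm_num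
  obtain ⟨be, h1, h2, h3⟩ := ho.exists_root hs
  obtain ⟨j, hj, hj2, -⟩ := hbe be h1 h2 h3
  have hij : i ≠ j := by rintro rfl; exact hi2 hj2
  -- If such an `l` exists, the mirror of `ε_i + ε_l` can only be itself, so its value on `h` is 0,
  -- though it is at least 1. Otherwise `ε_i + ε_j` has value 3, while no root with `i`-coordinate 1
  -- has value -3.
  by_cases hone : ∃ l : Fin n, l ≠ i ∧ (l : ℕ) < k ∧ e.coord l h ≠ 2
  · obtain ⟨l, hli, hl, hl2⟩ := hone
    obtain ⟨mu, hmu, hmuh, hmuv⟩ :=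
      ho.exists_mirror hs (fun _ => htype.neg_mem) (htype.add_mem hli.symm)
    have hm1 : mu (e i) = 1 := by
      rw [hmuv (e i) (hcomm i hi hi2)]
      simp [coord_basis, hli.symm]
    have hm2 : mu (e l) = 1 := by
      rw [hmuv (e l) (hcomm l hl hl2)]
      simp [coord_basis, hli]
    have hmu' : mu ∈ roots a := ⟨by rintro rfl; simp at hm1, hmu⟩
    have hmu'' : mu = e.coord i + e.coord l := by
      rcases htype.cases_of_apply_eq_one hmu' hm1 with rfl | ⟨q, hq, rfl | rfl⟩
      · simp [coord_basis, hli] at hm2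
      · by_cases hql : l = q
        · rw [hql]
        · simp [coord_basis, hli, hql] at hm2
      · simp only [LinearMap.sub_apply, coord_basis, hli, if_false] at hm2
        split_ifs at hm2 <;> norm_num at hm2
    have := hlow l hl
    rw [hmu'', LinearMap.add_apply] at hmuh
    grind
  · push Not at hone
    have hall : ∀ l : Fin n, l ≠ i → e.coord l h = 0 ∨ e.coord l h = 2 := by
      intro l hl
      by_cases hlk : (l : ℕ) < k
      · exact Or.inr (hone l hl hlk)
      · exact Or.inl (hhigh l (not_lt.1 hlk))
    rcases htype.exists_mirror_add hs ho hij (hcomm i hi hi2) with h | ⟨l, hl, h | h⟩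
    · grind
    · have := hall l hl
      grind
    · have := hall l hl
      grind

/-- The coordinates of a very special element. -/
theorem IsOfType.classification (htype : IsOfType e R k H₀) (hs : IsSplitAbelian F a) {h : a}
    (hv : VerySpecial F (H₀ : g) (h : g)) :
    ((∀ i : Fin n, (i : ℕ) < k → e.coord i h = 0 ∨ e.coord i h = 2) ∧
      (∀ j : Fin n, k ≤ (j : ℕ) → e.coord j h = 0)) ∨
    ((∀ i : Fin n, (i : ℕ) < k → e.coord i h = 1) ∧
      (∀ j : Fin n, k ≤ (j : ℕ) → e.coord j h = 0 ∨ e.coord j h = 1 ∨ e.coord j h = -1) ∧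
      ∃ j : Fin n, k ≤ (j : ℕ) ∧ e.coord j h ≠ 0) := by
  obtain ⟨hroots, hsim, hk1, hkn, hC, hD⟩ := id htype
  by_cases hall : ∀ j : Fin n, k ≤ (j : ℕ) → e.coord j h = 0
  · left
    have hlow : ∀ i : Fin n, (i : ℕ) < k →
        e.coord i h = 0 ∨ e.coord i h = 1 ∨ e.coord i h = 2 := by
      intro i hi
      by_cases hkn' : k < n
      · have := (htype.coord_values hv hi (j := ⟨k, hkn'⟩) le_rfl).1
        rwa [hall ⟨k, hkn'⟩ le_rfl, add_zero] at this
      -- The equality `k = n` occurs only when the `ε_i` themselves are roots.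
      · have hR : R = .B ∨ R = .BC := by
          cases R with
          | B => exact Or.inl rfl
          | BC => exact Or.inr rfl
          | C => have := hC rfl; omega
          | D => have := hD rfl; omega
        exact hv.values (htype.coord_mem_roots hR i) (by simp [htype.coord_H₀, hi])
    refine ⟨fun i hi => ?_, hall⟩
    have := htype.coord_ne_one hs hv.1.1 hlow hall i hi
    have := hlow i hi
    tauto
  · right
    push Not at hall
    obtain ⟨j, hj, hj0⟩ := hall
    have hvals := fun {i j : Fin n} => htype.coord_values hv (i := i) (j := j)
    have h0 : ((⟨0, by omega⟩ : Fin n) : ℕ) < k := hk1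
    -- `2 x_j = (x_0 + x_j) - (x_0 - x_j)` is a nonzero integer between -2 and 2.
    have hj4 : (2 * e.coord j h = 1 ∨ 2 * e.coord j h = -1) ∨
        e.coord j h = 1 ∨ e.coord j h = -1 := by
      obtain ⟨h1, h2⟩ := hvals h0 hj
      clear hvals
      grind
    rcases hj4 with hj4 | hj4
    · exfalso
      have hlow : ∀ i : Fin n, (i : ℕ) < k → 2 * e.coord i h = 1 ∨ 2 * e.coord i h = 3 := by
        intro i hi
        obtain ⟨h1, h2⟩ := hvals hi hj
        clear hvals
        grind
      refine htype.not_half_integral hs hv hlow fun l hl => ?_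
      obtain ⟨h1, h2⟩ := hvals h0 hl
      have := hlow _ h0
      clear hvals hlow
      grind
    · have hlow : ∀ i : Fin n, (i : ℕ) < k → e.coord i h = 1 := by
        intro i hi
        obtain ⟨h1, h2⟩ := hvals hi hj
        clear hvals
        grind
      refine ⟨hlow, fun l hl => ?_, j, hj, hj0⟩
      obtain ⟨h1, h2⟩ := hvals h0 hl
      have := hlow _ h0
      clear hvals hlow
      grind

end Classification

/-! ### The Killing form on `a`. -/

section Killing

variable {F : Type*} [Field F] [CharZero F] {g : Type*} [LieRing g] [LieAlgebra F g]
  [FiniteDimensional F g] {a : LieSubalgebra F g} {n : ℕ} {e : Module.Basis (Fin n) F a}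
  {R : CType} {k : ℕ} {H₀ : a}

theorem IsOfType.exists_int (htype : IsOfType e R k H₀) {lam : Module.Dual F a}
    (hl : lam ∈ roots a) (i : Fin n) : ∃ m : ℤ, lam (e i) = m := by
  have hpos : ∀ lam ∈ posRoots e R, ∃ m : ℤ, lam (e i) = m := by
    intro lam hl
    have hc : ∀ j : Fin n, e.coord j (e i) = ((if i = j then 1 else 0 : ℤ) : F) := by
      intro j; rw [coord_basis]; push_cast; rfl
    rcases mem_posRoots_iff.1 hl with ⟨p, q, hpq, rfl | rfl⟩ | ⟨-, p, rfl⟩ | ⟨-, p, rfl⟩ <;>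
      simp only [LinearMap.sub_apply, LinearMap.add_apply, LinearMap.smul_apply, smul_eq_mul, hc]
    · exact ⟨_, (Int.cast_sub _ _).symm⟩
    · exact ⟨_, (Int.cast_add _ _).symm⟩
    · exact ⟨_, rfl⟩
    · exact ⟨2 * (if i = p then 1 else 0), by push_cast; rfl⟩
  rw [htype.1] at hl
  rcases hl with hl | hl
  · exact hpos _ hl
  · obtain ⟨m, hm⟩ := hpos _ hl
    exact ⟨-m, by rw [Int.cast_neg, ← hm, LinearMap.neg_apply, neg_neg]⟩

theorem IsOfType.killingForm_basis_ne_zero (htype : IsOfType e R k H₀) (hs : IsSplitAbelian F a)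
    (hn : 2 ≤ n) (i : Fin n) : killingForm F g (e i : a) (e i : a) ≠ 0 := by
  have : Nontrivial (Fin n) := Fin.nontrivial_iff_two_le.2 hn
  obtain ⟨j, hj⟩ := exists_ne i
  refine killingForm_self_ne_zero hs (fun lam hl => htype.exists_int hl i)
    ⟨_, htype.add_mem hj.symm, ?_⟩
  simp [coord_basis, hj.symm]

theorem IsOfType.isKilling (htype : IsOfType e R k H₀) (hs : IsSplitAbelian F a)
    (hsimple : AbsolutelySimple F g) (hn : 2 ≤ n) : LieAlgebra.IsKilling F g :=
  isKilling_of_absolutelySimple hsimple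
    (htype.killingForm_basis_ne_zero hs hn ⟨0, by omega⟩)

theorem IsOfType.add_smul_mem (htype : IsOfType e R k H₀) {i j : Fin n} (hij : i ≠ j) {s : F}
    (hs : s = 1 ∨ s = -1) : e.coord i + s • e.coord j ∈ roots a := by
  rcases hs with rfl | rfl
  · convert htype.add_mem hij using 1
    exact LinearMap.ext fun v => by simp
  · convert htype.sub_mem hij using 1
    exact LinearMap.ext fun v => by simp [sub_eq_add_neg]

theorem IsOfType.smul_add_smul_mem (htype : IsOfType e R k H₀) {i j : Fin n} (hij : i ≠ j) {s r : F}
    (hs : s = 1 ∨ s = -1) (hr : r = 1 ∨ r = -1) : s • e.coord i + r • e.coord j ∈ roots a := by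
  rcases hs with rfl | rfl
  · convert htype.add_smul_mem hij hr using 1
    exact LinearMap.ext fun v => by simp
  · convert htype.neg_mem (htype.add_smul_mem hij (s := -r) (by grind)) using 1
    exact LinearMap.ext fun v => by simp [add_comm]

/-- A root has at most two nonzero coordinates, and `c` already carries one. -/
theorem IsOfType.apply_mul_apply_eq_zero (htype : IsOfType e R k H₀) {mu : Module.Dual F a}
    (hmu : rootSpace mu ≠ ⊥) {c i j : Fin n} (hci : c ≠ i) (hcj : c ≠ j) (hij : i ≠ j)
    (hc : mu (e c) = 1 ∨ mu (e c) = -1) : mu (e i) * mu (e j) = 0 := by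
  have key : ∀ mu ∈ roots a, mu (e c) = 1 → mu (e i) * mu (e j) = 0 := by
    intro mu hmu hc
    rcases htype.cases_of_apply_eq_one hmu hc with rfl | ⟨l, hl, rfl | rfl⟩
    · simp [coord_basis, hci.symm]
    · by_cases h : i = l
      · subst h; simp [coord_basis, hcj.symm, hij.symm]
      · simp [coord_basis, hci.symm, h]
    · by_cases h : i = l
      · subst h; simp [coord_basis, hcj.symm, hij.symm]
      · simp [coord_basis, hci.symm, h]
  have hr : mu ∈ roots a := ⟨by rintro rfl; simp at hc, hmu⟩
  rcases hc with hc | hc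
  · exact key mu hr hc
  · have := key (-mu) (htype.neg_mem hr) (by simp [hc])
    simpa using this

variable [LieAlgebra.IsKilling F g]

/-- The neutral element of the triple of a root vector of `ε_i ± ε_j` is `e_i ± e_j`. -/
theorem IsOfType.exists_sl2_basis (htype : IsOfType e R k H₀) (ha : Maximal (IsSplitAbelian F) a)
    (hn : 3 ≤ n) {i j : Fin n} (hij : i ≠ j) {s : F} (hs : s = 1 ∨ s = -1) {x : g}
    (hx : x ∈ rootSpace (e.coord i + s • e.coord j)) (hx0 : x ≠ 0) :
    ∃ y ∈ rootSpace (-(e.coord i + s • e.coord j)),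
      IsSl2Triple ((e i + s • e j : a) : g) x y := by
  set al := e.coord i + s • e.coord j with hal
  have hs0 : s ≠ 0 := by rcases hs with rfl | rfl <;> simp
  have hs2 : s * s = 1 := by rcases hs with rfl | rfl <;> simp
  have hal0 : al ≠ 0 := by
    intro h
    have := LinearMap.congr_fun h (e i)
    simp [hal, coord_basis, hij] at this
  obtain ⟨y, hy, h, hh, t⟩ := exists_sl2_of_mem_rootSpace ha hal0 hx hx0
  refine ⟨y, hy, ?_⟩
  have hal2 : e.coord i h + s * e.coord j h = 2 := by
    simpa [hal] using hh
  -- Reflecting `ε_i + r ε_c` gives a weight with coordinates `1 - m`, `-s m`, `r` at `i`, `j`, `c`,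
  -- where `m` is the value on `h`; one of the first two must vanish.
  have hroot1 : ∀ c, c ≠ i → c ≠ j → ∀ r : F, r = 1 ∨ r = -1 →
      (e.coord i h + r * e.coord c h) * (1 - (e.coord i h + r * e.coord c h)) = 0 := by
    intro c hci hcj r hr
    have hmem : e.coord i + r • e.coord c ∈ roots a := htype.add_smul_mem hci.symm hr
    have hb := rootSpace_reflection_ne_bot ha.prop hx hy hh t hmem.2
    have := htype.apply_mul_apply_eq_zero hb hci hcj hij (by
      simpa [hal, coord_basis, hci, hcj, hci.symm, hcj.symm] using hr)
    simp [hal, coord_basis, hci, hcj, hci.symm, hcj.symm, hij, hij.symm] at this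
    simp only [Module.Basis.coord_apply]
    grind
  have hroot2 : ∀ c, c ≠ i → c ≠ j → ∀ r : F, r = 1 ∨ r = -1 →
      (s * e.coord j h + r * e.coord c h) * (1 - (s * e.coord j h + r * e.coord c h)) = 0 := by
    intro c hci hcj r hr
    have hmem : s • e.coord j + r • e.coord c ∈ roots a := htype.smul_add_smul_mem hcj.symm hs hr
    have hb := rootSpace_reflection_ne_bot ha.prop hx hy hh t hmem.2
    have := htype.apply_mul_apply_eq_zero hb hci hcj hij (by
      simpa [hal, coord_basis, hci, hcj, hci.symm, hcj.symm] using hr)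
    simp [hal, coord_basis, hci, hcj, hci.symm, hcj.symm, hij, hij.symm] at this
    simp only [Module.Basis.coord_apply]
    grind
  have hvals : ∀ c, c ≠ i → c ≠ j →
      e.coord i h = 1 ∧ s * e.coord j h = 1 ∧ e.coord c h = 0 := by
    intro c hci hcj
    have h1 := hroot1 c hci hcj 1 (Or.inl rfl)
    have h2 := hroot1 c hci hcj (-1) (Or.inr rfl)
    have h3 := hroot2 c hci hcj 1 (Or.inl rfl)
    have h4 := hroot2 c hci hcj (-1) (Or.inr rfl)
    clear hroot1 hroot2
    generalize e.coord i h = ti at *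
    generalize s * e.coord j h = tj at *
    generalize e.coord c h = tc at *
    obtain rfl : tj = 2 - ti := by linear_combination hal2
    -- For `m = ti + tc` the companion value `tj - tc` is `2 - m`; both are zeros of `t (1 - t)`,
    -- which forces `m = 1`.
    have e1 : ti + 1 * tc = 1 := by
      have : (ti + 1 * tc) * (1 - (ti + 1 * tc)) - (2 - ti + -1 * tc) * (1 - (2 - ti + -1 * tc))
        = 2 * (1 - (ti + 1 * tc)) := by ring
      rw [h1, h4] at this
      have h2' : (1 - (ti + 1 * tc)) = 0 := by simpa using this
      linear_combination -h2'
    have e2 : ti + -1 * tc = 1 := by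
      have : (ti + -1 * tc) * (1 - (ti + -1 * tc)) - (2 - ti + 1 * tc) * (1 - (2 - ti + 1 * tc))
        = 2 * (1 - (ti + -1 * tc)) := by ring
      rw [h2, h3] at this
      have h2' : (1 - (ti + -1 * tc)) = 0 := by simpa using this
      linear_combination -h2'
    have e3 : ti = 1 := by
      have : 2 * ti = 2 * 1 := by linear_combination e1 + e2
      exact mul_left_cancel₀ two_ne_zero this
    refine ⟨e3, by rw [e3]; norm_num, by linear_combination e1 - e3⟩
  -- The third index is the reason for assuming `n ≥ 3`.
  obtain ⟨c, hci, hcj⟩ : ∃ c : Fin n, c ≠ i ∧ c ≠ j := by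
    have : ({i, j} : Finset (Fin n)).card < (Finset.univ : Finset (Fin n)).card := by
      rw [Finset.card_pair hij, Finset.card_univ, Fintype.card_fin]; omega
    obtain ⟨c, -, hc⟩ := Finset.exists_mem_notMem_of_card_lt_card this
    exact ⟨c, by simpa using hc⟩
  have hheq : h = e i + s • e j := by
    refine e.repr.injective (Finsupp.ext fun l => ?_)
    change e.coord l h = e.coord l (e i + s • e j)
    rw [map_add, map_smul, coord_basis, coord_basis]
    by_cases hli : l = i
    · subst hli
      simp [hij.symm, (hvals c hci hcj).1, -Module.Basis.coord_apply]
    · by_cases hlj : l = j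
      · subst hlj
        have := (hvals c hci hcj).2.1
        simp [Ne.symm hli, -Module.Basis.coord_apply]
        calc e.coord l h = s * s * e.coord l h := by rw [hs2, one_mul]
          _ = s * (s * e.coord l h) := by ring
          _ = s := by rw [this, mul_one]
      · simp [Ne.symm hli, Ne.symm hlj, (hvals l hli hlj).2.2, -Module.Basis.coord_apply]
  rw [← hheq]
  exact t

theorem IsOfType.killingForm_pair (htype : IsOfType e R k H₀) (ha : Maximal (IsSplitAbelian F) a)
    (hn : 3 ≤ n) {i j : Fin n} (hij : i ≠ j) {s : F} (hs : s = 1 ∨ s = -1) {v : a}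
    (hv : e.coord i v + s * e.coord j v = 0) :
    killingForm F g ((e i + s • e j : a) : g) v = 0 := by
  have hmem : e.coord i + s • e.coord j ∈ roots a := htype.add_smul_mem hij hs
  obtain ⟨x, hx, hx0⟩ := exists_ne_zero_of_mem_roots hmem
  obtain ⟨y, hy, t⟩ := htype.exists_sl2_basis ha hn hij hs hx hx0
  exact killingForm_coroot_eq_zero t hy (by simpa using hv)

/-- Coroots are orthogonal to the kernels of their roots. So `e_c` is orthogonal to `e_i + e_j` and
`e_i - e_j`, hence to `e_i`; and `e_i + e_j` being orthogonal to `e_i - e_j` makes the lengths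
equal. -/
theorem IsOfType.killingForm_basis (htype : IsOfType e R k H₀) (ha : Maximal (IsSplitAbelian F) a)
    (hn : 3 ≤ n) : ∃ c : F, c ≠ 0 ∧ ∀ i j : Fin n,
      killingForm F g ((e i : a) : g) ((e j : a) : g) = if i = j then c else 0 := by
  have horth : ∀ i j : Fin n, i ≠ j → killingForm F g ((e i : a) : g) ((e j : a) : g) = 0 := by
    intro i c hic
    obtain ⟨j, hji, hjc⟩ : ∃ j : Fin n, j ≠ i ∧ j ≠ c := by
      have : ({i, c} : Finset (Fin n)).card < (Finset.univ : Finset (Fin n)).card := by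
        rw [Finset.card_pair hic, Finset.card_univ, Fintype.card_fin]; omega
      obtain ⟨j, -, hj⟩ := Finset.exists_mem_notMem_of_card_lt_card this
      exact ⟨j, by simpa using hj⟩
    have h1 := htype.killingForm_pair ha hn hji.symm (s := 1) (v := e c) (Or.inl rfl)
      (by simp [coord_basis, hic.symm, hjc.symm, -Module.Basis.coord_apply])
    have h2 := htype.killingForm_pair ha hn hji.symm (s := -1) (v := e c) (Or.inr rfl)
      (by simp [coord_basis, hic.symm, hjc.symm, -Module.Basis.coord_apply])
    simp only [AddMemClass.coe_add, SetLike.val_smul, map_add, map_smul,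
      LinearMap.add_apply, LinearMap.smul_apply, smul_eq_mul] at h1 h2
    have : 2 * killingForm F g ((e i : a) : g) ((e c : a) : g) = 0 := by
      linear_combination h1 + h2
    simpa using this
  have hdiag : ∀ i j : Fin n, killingForm F g ((e i : a) : g) ((e i : a) : g)
      = killingForm F g ((e j : a) : g) ((e j : a) : g) := by
    intro i j
    by_cases hij : i = j
    · rw [hij]
    have h1 := htype.killingForm_pair ha hn hij (s := 1) (v := e i - e j) (Or.inl rfl)
      (by simp [coord_basis, hij, Ne.symm hij, -Module.Basis.coord_apply])
    simp only [AddMemClass.coe_add, SetLike.val_smul, AddSubgroupClass.coe_sub, map_add,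
      map_smul, map_sub, LinearMap.add_apply, LinearMap.smul_apply, smul_eq_mul, horth i j hij,
      horth j i (Ne.symm hij)] at h1
    linear_combination h1
  refine ⟨_, htype.killingForm_basis_ne_zero ha.prop (by omega) ⟨0, by omega⟩, fun i j => ?_⟩
  by_cases hij : i = j
  · subst hij; rw [if_pos rfl]; exact hdiag _ _
  · rw [if_neg hij]; exact horth i j hij

/-- Roots with the values `(1, 2)` on `(H₀, h)` kill `2H₀ - h`, so `h` is orthogonal to `2H₀ - h`.
-/
theorem IsOfType.sum_coord_eq_zero (htype : IsOfType e R k H₀)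
    (ha : Maximal (IsSplitAbelian F) a) (hn : 3 ≤ n) {h : a} (ho : OneSimple F (H₀ : g) (h : g)) :
    ∑ i, e.coord i h * (2 * e.coord i H₀ - e.coord i h) = 0 := by
  obtain ⟨c, hc, hcb⟩ := htype.killingForm_basis ha hn
  have h0 := ho.killingForm_eq_zero ha.prop (fun _ => htype.neg_mem) (v := (2 : F) • H₀ - h)
    (fun be _ h1 h2 => by rw [map_sub, map_smul, h1, h2]; simp)
  have hsum : ∀ v : a, (v : g) = ∑ i, e.coord i v • ((e i : a) : g) := by
    intro v
    conv_lhs => rw [← e.sum_repr v]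
    rw [AddSubmonoidClass.coe_finset_sum]
    rfl
  rw [hsum h, hsum ((2 : F) • H₀ - h)] at h0
  simp only [map_sum, map_smul, LinearMap.sum_apply, LinearMap.smul_apply, hcb, smul_eq_mul,
    mul_ite, mul_zero, Finset.sum_ite_eq', Finset.mem_univ, if_true] at h0
  have h1 : c * ∑ i, e.coord i h * (2 * e.coord i H₀ - e.coord i h) = 0 := by
    rw [← h0, Finset.mul_sum]
    refine Finset.sum_congr rfl fun i _ => ?_
    rw [map_sub, map_smul, smul_eq_mul]
    ring
  exact (mul_eq_zero.1 h1).resolve_left hc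

end Killing

/-! ### Automorphisms elementary over the closure. -/

section AutZero

variable {F : Type*} [Field F] {g : Type*} [LieRing g] [LieAlgebra F g]

theorem mul_mem_aut0 {φ ψ : g ≃ₗ[F] g} (hφ : φ ∈ aut0 F g) (hψ : ψ ∈ aut0 F g) :
    φ * ψ ∈ aut0 F g := by
  refine ⟨fun x y => ?_, ?_⟩
  · rw [LinearEquiv.mul_apply, hψ.1, hφ.1]; rfl
  · rw [LinearEquiv.baseChange_mul]
    exact mul_mem hφ.2 hψ.2

theorem expAd_mem_aut0 [CharZero F] (x : g) (h : IsNilpotent (LieAlgebra.ad F g x)) :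
    expAd x h ∈ aut0 F g := by
  refine ⟨expAd_lie x h, Subgroup.subset_closure
    ⟨(1 : AlgebraicClosure F) ⊗ₜ[F] x, ?_, ?_⟩⟩ <;>
  have had : LieAlgebra.ad (AlgebraicClosure F) (AlgebraicClosure F ⊗[F] g) (1 ⊗ₜ[F] x)
      = (LieAlgebra.ad F g x).baseChange (AlgebraicClosure F) :=
    LieModule.toEnd_baseChange F (AlgebraicClosure F) g g x <;>
  obtain ⟨m, hm⟩ := id h <;>
  have hm' : ((LieAlgebra.ad F g x).baseChange (AlgebraicClosure F)) ^ m = 0 := by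
    rw [← LinearMap.baseChange_pow, hm, LinearMap.baseChange_zero]
  · rw [had]
    exact ⟨m, hm'⟩
  · rw [had, expNil_eq_sum hm', LinearEquiv.coe_baseChange, coe_expAd, expNil_eq_sum hm]
    ext y
    simp only [TensorProduct.AlgebraTensorModule.curry_apply, LinearMap.restrictScalars_self,
      TensorProduct.curry_apply, LinearMap.coe_restrictScalars, LinearMap.baseChange_tmul,
      LinearMap.sum_apply, LinearMap.smul_apply, ← LinearMap.baseChange_pow, TensorProduct.tmul_sum]
    refine Finset.sum_congr rfl fun i _ => ?_
    rw [TensorProduct.tmul_smul, inv_natCast_smul_eq F (AlgebraicClosure F)]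

end AutZero

/-! ### Inclusions between the subgroups `P(H_1, …, H_p)`. -/

section Inclusion

variable {F : Type*} [Field F] [CharZero F] {g : Type*} [LieRing g] [LieAlgebra F g]
  [FiniteDimensional F g] {a : LieSubalgebra F g}

theorem finite_weights (hs : IsSplitAbelian F a) :
    {lam : Module.Dual F a | rootSpace lam ≠ ⊥}.Finite :=
  WellFoundedGT.finite_ne_bot_of_iSupIndep (iSupIndep_rootSpace hs)

theorem rootSpace_ne_bot_of_mem {lam : Module.Dual F a} {x : g} (hx : x ∈ rootSpace lam)
    (hx0 : x ≠ 0) : rootSpace lam ≠ ⊥ := (Submodule.ne_bot_iff _).2 ⟨x, hx, hx0⟩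

theorem exists_bound (hs : IsSplitAbelian F a) (c : a) :
    ∃ M : ℕ, ∀ lam : Module.Dual F a, rootSpace lam ≠ ⊥ → ∀ q : ℤ, lam c = q → |q| < M := by
  classical
  let f : Module.Dual F a → ℤ := fun lam => if h : ∃ q : ℤ, lam c = q then h.choose else 0
  obtain ⟨B, hB⟩ := ((finite_weights hs).image fun lam => |f lam|).bddAbove
  refine ⟨B.toNat + 1, fun lam hl q hq => ?_⟩
  have h1 : |f lam| ≤ B := hB ⟨lam, hl, rfl⟩
  have hex : ∃ q : ℤ, lam c = q := ⟨q, hq⟩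
  have h2 : f lam = q := by
    have h3 : f lam = hex.choose := dif_pos hex
    have h4 := hq.symm.trans hex.choose_spec
    rw [h3]
    exact_mod_cast h4.symm
  rw [h2] at h1
  push_cast
  have := Int.self_le_toNat B
  omega

/-- An element of positive degree for a grading with integral degrees is nilpotent. -/
theorem isNilpotent_ad_of_mem_sumRoots (hs : IsSplitAbelian F a) {c : a}
    (hint : ∀ lam ∈ roots a, ∃ m : ℤ, lam c = m) {S : Set (Module.Dual F a)}
    (hS : ∀ lam ∈ S, ∃ m : ℕ, 0 < m ∧ lam c = m) {x : g} (hx : x ∈ sumRoots S) :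
    IsNilpotent (LieAlgebra.ad F g x) := by
  obtain ⟨M, hM⟩ := exists_bound hs c
  let G : ℤ → Set (Module.Dual F a) := fun j => {lam | ∃ q : ℤ, j ≤ q ∧ lam c = q}
  have hstep : ∀ j : ℤ, ∀ y ∈ sumRoots (G j), ⁅x, y⁆ ∈ sumRoots (G (j + 1)) := by
    intro j y hy
    refine lie_mem_sumRoots (T := G j) ?_ hx hy
    rintro lam hl mu ⟨q, hq, hq'⟩ -
    obtain ⟨m, hm, hm'⟩ := hS lam hl
    exact ⟨m + q, by omega, by rw [LinearMap.add_apply, hm', hq']; push_cast; rfl⟩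
  have htop : ∀ y : g, y ∈ sumRoots (G (-M)) := by
    intro y
    have hy : y ∈ ⨆ lam : Module.Dual F a, rootSpace lam := iSup_rootSpace hs ▸ Submodule.mem_top
    induction hy using Submodule.iSup_induction' with
    | zero => exact zero_mem _
    | add y z _ _ h1 h2 => exact add_mem h1 h2
    | mem lam y hy =>
      by_cases hy0 : y = 0
      · rw [hy0]; exact zero_mem _
      refine rootSpace_le_sumRoots ?_ hy
      have hb := rootSpace_ne_bot_of_mem hy hy0
      obtain ⟨q, hq⟩ : ∃ q : ℤ, lam c = q := by
        by_cases h0 : lam = 0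
        · exact ⟨0, by simp [h0]⟩
        · exact hint lam ⟨h0, hb⟩
      have := (abs_lt.1 (hM lam hb q hq)).1
      exact ⟨q, by omega, hq⟩
  have hpow : ∀ (j : ℕ) (y : g), ((LieAlgebra.ad F g x) ^ j) y ∈ sumRoots (G (-M + j)) := by
    intro j y
    induction j with
    | zero => simpa using htop y
    | succ j ih =>
      rw [pow_succ', Module.End.mul_apply]
      have := hstep _ _ ih
      push_cast
      rwa [add_assoc] at this
  refine ⟨2 * M, LinearMap.ext fun y => ?_⟩
  have h1 := hpow (2 * M) y
  have hbot : sumRoots (G (-M + (2 * M : ℕ))) ≤ ⊥ := by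
    refine sumRoots_le ?_
    rintro lam ⟨q, hq, hq'⟩ z hz hz0
    have := (abs_lt.1 (hM lam (rootSpace_ne_bot_of_mem hz hz0) q hq')).2
    push_cast at hq
    omega
  exact hbot h1

variable {H₀ c : a} {S : Set (Module.Dual F a)}

/-- The part of degree at least `m` of the sum of the root spaces of `S`. -/
def degGE (S : Set (Module.Dual F a)) (c : a) (m : ℕ) : Submodule F g :=
  sumRoots {lam | lam ∈ S ∧ ∃ q : ℕ, m ≤ q ∧ lam c = q}

theorem mem_degGE {lam : Module.Dual F a} (hl : lam ∈ S) {m q : ℕ} (hq : m ≤ q) (hq' : lam c = q)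
    {x : g} (hx : x ∈ rootSpace lam) : x ∈ degGE S c m :=
  rootSpace_le_sumRoots (S := {lam | lam ∈ S ∧ ∃ q : ℕ, m ≤ q ∧ lam c = q}) ⟨hl, q, hq, hq'⟩ hx

theorem degGE_anti {i j : ℕ} (h : i ≤ j) : degGE S c j ≤ degGE S c i :=
  sumRoots_mono fun _ ⟨h1, q, h2, h3⟩ => ⟨h1, q, h.trans h2, h3⟩

theorem degGE_one (hS : ∀ lam ∈ S, ∃ m : ℕ, 0 < m ∧ lam c = m) : degGE S c 1 = sumRoots S := by
  refine le_antisymm (sumRoots_mono fun _ h => h.1) (sumRoots_mono fun lam hl => ⟨hl, ?_⟩)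
  obtain ⟨m, hm, hm'⟩ := hS lam hl
  exact ⟨m, hm, hm'⟩

theorem exists_degGE_eq_bot (hs : IsSplitAbelian F a) (S : Set (Module.Dual F a)) (c : a) :
    ∃ M, degGE S c M = ⊥ := by
  obtain ⟨M, hM⟩ := exists_bound hs c
  refine ⟨M, eq_bot_iff.2 (sumRoots_le ?_)⟩
  rintro lam ⟨-, q, hq, hq'⟩ z hz hz0
  have := (abs_lt.1 (hM lam (rootSpace_ne_bot_of_mem hz hz0) q (by exact_mod_cast hq'))).2
  omega

theorem lie_mem_degGE {z : g} {T : Set (Module.Dual F a)} {i j : ℕ}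
    (hST : ∀ lam ∈ T, ∀ mu ∈ S, rootSpace (lam + mu) ≠ ⊥ → lam + mu ∈ S)
    (hT : ∀ lam ∈ T, ∃ q : ℕ, i ≤ q ∧ lam c = q) {y : g} (hz : z ∈ sumRoots T)
    (hy : y ∈ degGE S c j) : ⁅z, y⁆ ∈ degGE S c (i + j) := by
  refine lie_mem_sumRoots ?_ hz hy
  rintro lam hl mu ⟨hmu, q, hq, hq'⟩ hb
  obtain ⟨r, hr, hr'⟩ := hT lam hl
  exact ⟨hST lam hl mu hmu hb, r + q, by omega, by rw [LinearMap.add_apply, hr', hq']; push_cast; rfl⟩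

/-- In degree `q` the bracket with `c` on the right is multiplication by `-q`; modulo higher degree
only `q = m` remains. -/
theorem lie_grading_mem_degGE {m : ℕ} {x : g} (hx : x ∈ degGE S c m) :
    ⁅x, (c : g)⁆ ∈ degGE S c m ∧ (m : F) • x + ⁅x, (c : g)⁆ ∈ degGE S c (m + 1) := by
  refine sumRoots_induction (p := fun x => ⁅x, (c : g)⁆ ∈ degGE S c m ∧
    (m : F) • x + ⁅x, (c : g)⁆ ∈ degGE S c (m + 1)) ?_ (by simp) ?_ hx
  · rintro lam ⟨hl, q, hq, hq'⟩ x hx -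
    have e : ⁅x, (c : g)⁆ = -((q : F) • x) := by rw [← lie_skew, hx c, hq']
    rw [e]
    refine ⟨neg_mem (Submodule.smul_mem _ _ (mem_degGE hl hq hq' hx)), ?_⟩
    by_cases hqm : q = m
    · subst hqm
      simp
    · rw [← sub_eq_add_neg, ← sub_smul]
      exact Submodule.smul_mem _ _ (mem_degGE hl (by omega) hq' hx)
  · rintro x y ⟨h1, h2⟩ ⟨h3, h4⟩
    rw [add_lie]
    refine ⟨add_mem h1 h3, ?_⟩
    have := add_mem h2 h4
    rw [smul_add]
    convert this using 1
    abel

theorem eq_zero_of_mem_degGE_of_lie_eq_zero (hs : IsSplitAbelian F a) {x : g}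
    (hx : x ∈ degGE S c 1) (hxc : ⁅x, (c : g)⁆ = 0) : x = 0 := by
  obtain ⟨M, hM⟩ := exists_degGE_eq_bot hs S c
  have key : ∀ m : ℕ, x ∈ degGE S c (m + 1) := by
    intro m
    induction m with
    | zero => exact hx
    | succ m ih =>
      have := (lie_grading_mem_degGE ih).2
      rw [hxc, add_zero] at this
      have h2 := Submodule.smul_mem _ (((m + 1 : ℕ) : F)⁻¹) this
      rwa [smul_smul, inv_mul_cancel₀ (by exact_mod_cast Nat.succ_ne_zero m), one_smul] at h2
  have := degGE_anti (Nat.le_succ M) (key M)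
  rw [hM] at this
  exact this

/-- The orbit of `c` under `exp (ad n)` is `c + n`, for `n` a sum of root spaces of positive
degrees. -/
theorem exists_expAd_apply_eq (hs : IsSplitAbelian F a)
    (hint : ∀ lam ∈ roots a, ∃ m : ℤ, lam c = m)
    (hS : ∀ lam ∈ S, ∃ m : ℕ, 0 < m ∧ lam c = m)
    (hSS : ∀ lam ∈ S, ∀ mu ∈ S, rootSpace (lam + mu) ≠ ⊥ → lam + mu ∈ S)
    {v : g} (hv : v ∈ sumRoots S) :
    ∃ (w : g) (hw : IsNilpotent (LieAlgebra.ad F g w)),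
      w ∈ sumRoots S ∧ expAd w hw (c : g) = c + v := by
  have hnil : ∀ w ∈ sumRoots S, IsNilpotent (LieAlgebra.ad F g w) := fun w hw =>
    isNilpotent_ad_of_mem_sumRoots hs hint hS hw
  have hS' : ∀ lam ∈ S, ∃ q : ℕ, 1 ≤ q ∧ lam c = q := hS
  have hlie : ∀ {i j : ℕ} {x y : g}, x ∈ degGE S c i → y ∈ degGE S c j →
      ⁅x, y⁆ ∈ degGE S c (i + j) := fun {i j x y} hx hy =>
    lie_mem_degGE (T := {lam | lam ∈ S ∧ ∃ q : ℕ, i ≤ q ∧ lam c = q})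
      (fun lam hl => hSS lam hl.1) (fun lam hl => hl.2) hx hy
  have key : ∀ m : ℕ, ∃ (w : g) (hw : IsNilpotent (LieAlgebra.ad F g w)),
      w ∈ sumRoots S ∧ expAd w hw (c : g) - c - v ∈ degGE S c (m + 1) := by
    intro m
    induction m with
    | zero =>
      refine ⟨0, hnil 0 (zero_mem _), zero_mem _, ?_⟩
      rw [expAd_apply_of_lie_eq_zero _ _ _ (zero_lie _), sub_self, zero_sub, degGE_one hS]
      exact neg_mem hv
    | succ m ih =>
      obtain ⟨w, hw, hwS, hd⟩ := ih
      set d := expAd w hw (c : g) - c - v with hd'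
      -- Adding `u` to `w` changes the image of `c` by `[u, c]` to leading order, that is, by `-(m +
      -- 1) u = -d`; this cancels the error in degree `m + 1`.
      set u : g := (((m + 1 : ℕ) : F)⁻¹) • d with hu
      have huN : u ∈ degGE S c (m + 1) := Submodule.smul_mem _ _ hd
      have huS : u ∈ sumRoots S := by
        rw [← degGE_one hS]
        exact degGE_anti (by omega) huN
      have hw1 : w ∈ degGE S c 1 := by rwa [degGE_one hS]
      have hw'S : w + u ∈ sumRoots S := add_mem hwS huS
      have hw'1 : w + u ∈ degGE S c 1 := by rwa [degGE_one hS]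
      have hw' := hnil _ hw'S
      refine ⟨w + u, hw', hw'S, ?_⟩
      have hAw : ∀ j : ℕ, ((LieAlgebra.ad F g w) ^ (j + 1)) (c : g) ∈ degGE S c 1 := by
        intro j
        induction j with
        | zero => simpa using (lie_grading_mem_degGE hw1).1
        | succ j ih =>
          rw [pow_succ', Module.End.mul_apply]
          exact degGE_anti (by omega) (hlie hw1 ih)
      let D : ℕ → g := fun j => ((LieAlgebra.ad F g (w + u)) ^ j) (c : g)
        - ((LieAlgebra.ad F g w) ^ j) (c : g)
      have hDstep : ∀ j, D (j + 1) = ⁅w + u, D j⁆ + ⁅u, ((LieAlgebra.ad F g w) ^ j) (c : g)⁆ := by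
        intro j
        simp only [D, pow_succ', Module.End.mul_apply, LieAlgebra.ad_apply, lie_sub, add_lie]
        abel
      have hD0 : D 0 = 0 := by simp [D]
      have hD1 : D 1 = ⁅u, (c : g)⁆ := by rw [hDstep 0, hD0]; simp
      have hD2 : ∀ j, D (j + 2) ∈ degGE S c (m + 1 + 1) := by
        intro j
        induction j with
        | zero =>
          rw [hDstep 1, hD1]
          refine add_mem ?_ (hlie huN (hAw 0))
          have := hlie hw'1 (lie_grading_mem_degGE huN).1
          rwa [add_comm 1] at this
        | succ j ih =>
          rw [hDstep (j + 2)]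
          exact add_mem (degGE_anti (by omega) (hlie hw'1 ih)) (hlie huN (hAw (j + 1)))
      obtain ⟨K₁, hK₁⟩ := id hw
      obtain ⟨K₂, hK₂⟩ := id hw'
      have e1 := expAd_apply_eq_sum w hw (c : g) (k := K₁ + K₂ + 2)
        (by rw [pow_eq_zero_of_le (by omega) hK₁]; rfl)
      have e2 := expAd_apply_eq_sum (w + u) hw' (c : g) (k := K₁ + K₂ + 2)
        (by rw [pow_eq_zero_of_le (by omega) hK₂]; rfl)
      have e3 : expAd (w + u) hw' (c : g) - expAd w hw (c : g) - ⁅u, (c : g)⁆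
          ∈ degGE S c (m + 1 + 1) := by
        rw [e1, e2, ← Finset.sum_sub_distrib]
        have : ∀ j ∈ Finset.range (K₁ + K₂ + 2),
            ((j.factorial : F)⁻¹) • ((LieAlgebra.ad F g (w + u)) ^ j) (c : g)
            - ((j.factorial : F)⁻¹) • ((LieAlgebra.ad F g w) ^ j) (c : g)
            = ((j.factorial : F)⁻¹) • D j := fun j _ => (smul_sub _ _ _).symm
        rw [Finset.sum_congr rfl this, Finset.sum_range_succ', Finset.sum_range_succ']
        simp only [hD0, zero_add, hD1, Nat.factorial_one, Nat.cast_one, inv_one, one_smul,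
          smul_zero, add_zero, add_sub_cancel_right]
        exact sum_mem fun j _ => Submodule.smul_mem _ _ (hD2 j)
      have e4 : d + ⁅u, (c : g)⁆ ∈ degGE S c (m + 1 + 1) := by
        have h1 := Submodule.smul_mem _ (((m + 1 : ℕ) : F)⁻¹) (lie_grading_mem_degGE hd).2
        rwa [smul_add, smul_smul, inv_mul_cancel₀ (by exact_mod_cast Nat.succ_ne_zero m),
          one_smul, ← smul_lie, ← hu] at h1
      have := add_mem e3 e4
      convert this using 1
      rw [hd']
      abel
  obtain ⟨M, hM⟩ := exists_degGE_eq_bot hs S c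
  obtain ⟨w, hw, hwS, hd⟩ := key M
  have h0 := degGE_anti (Nat.le_succ M) hd
  rw [hM, Submodule.mem_bot, sub_sub, sub_eq_zero] at h0
  exact ⟨w, hw, hwS, h0⟩

/-- The element `c` is a single grading element for `P(H)`: the positive degrees for `c` in `Δ₀` are
exactly the roots `≻ 0`. A unipotent `exp (ad z)` of `P(H')` moves `c` inside `c + n`, which is the
orbit of `c` under `exp (ad n)`; correcting by `exp (ad w)` gives an element of the centralizer of
the `H i`. -/
theorem P_subset_P (hs : IsSplitAbelian F a) {p q : ℕ} {H' : Fin q → a} {H : Fin p → a}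
    (hspan : ∀ i, H i ∈ Submodule.span F (Set.range H'))
    (hc : c ∈ Submodule.span F (Set.range H))
    (hsucc : ∀ lam ∈ succRoots H₀ H', lam ∈ succRoots H₀ H ∨ ∀ i, lam (H i) = 0)
    (hpos : ∀ lam ∈ roots a, lam H₀ = 0 → (∃ m : ℕ, 0 < m ∧ lam c = m) → lam ∈ succRoots H₀ H)
    (hdeg : ∀ lam ∈ succRoots H₀ H, ∃ m : ℕ, 0 < m ∧ lam c = m)
    (hint : ∀ lam ∈ roots a, ∃ m : ℤ, lam c = m) : P H₀ H' ⊆ P H₀ H := by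
  rintro _ ⟨γ₀, hγ₀, ν, ⟨z, hz, hzn, hν⟩, rfl⟩
  set S := succRoots H₀ H with hSdef
  -- `L` is the set of Levi roots of `P(H)`, `S` that of its nilradical; `z` lies in the span of
  -- both kinds of root spaces.
  let L : Set (Module.Dual F a) := {lam | lam ∈ roots a ∧ lam H₀ = 0 ∧ ∀ i, lam (H i) = 0}
  have hLc : ∀ lam ∈ L, lam c = 0 := by
    intro lam hl
    have hle : Submodule.span F (Set.range H) ≤ LinearMap.ker lam := by
      rw [Submodule.span_le]
      rintro _ ⟨i, rfl⟩
      exact hl.2.2 i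
    exact hle hc
  have hSS : ∀ lam ∈ L ∪ S, ∀ mu ∈ S, rootSpace (lam + mu) ≠ ⊥ → lam + mu ∈ S := by
    intro lam hl mu hm hb
    obtain ⟨m, hm0, hm'⟩ := hdeg mu hm
    obtain ⟨r, hr, h0⟩ : ∃ r : ℕ, lam c = r ∧ lam H₀ = 0 := by
      rcases hl with hl | hl
      · exact ⟨0, by rw [hLc lam hl, Nat.cast_zero], hl.2.1⟩
      · obtain ⟨r, -, hr⟩ := hdeg lam hl
        exact ⟨r, hr, hl.2.1⟩
    have hval : (lam + mu) c = ((r + m : ℕ) : F) := by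
      rw [LinearMap.add_apply, hr, hm']; push_cast; rfl
    refine hpos _ ⟨?_, hb⟩ (by rw [LinearMap.add_apply, h0, hm.2.1, add_zero])
      ⟨r + m, by omega, hval⟩
    intro h
    rw [h, LinearMap.zero_apply] at hval
    have : r + m = 0 := by exact_mod_cast hval.symm
    omega
  have hzQ : z ∈ sumRoots (L ∪ S) := by
    refine sumRoots_mono ?_ hz
    intro lam hl
    rcases hsucc lam hl with h | h
    · exact Or.inr h
    · exact Or.inl ⟨hl.1, hl.2.1, h⟩
  have hQN : ∀ z ∈ sumRoots (L ∪ S), ∀ s ∈ sumRoots S, ⁅z, s⁆ ∈ sumRoots S := fun z hz s hs =>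
    lie_mem_sumRoots hSS hz hs
  have hQv : ∀ z ∈ sumRoots (L ∪ S), ∀ v : a, (∀ lam ∈ L, lam v = 0) → ⁅z, (v : g)⁆ ∈ sumRoots S := by
    intro z hz v hv
    refine sumRoots_induction (p := fun z => ⁅z, (v : g)⁆ ∈ sumRoots S) ?_ (by simp) ?_ hz
    · intro lam hl x hx _
      have e : ⁅x, (v : g)⁆ = -(lam v • x) := by rw [← lie_skew, hx v]
      rw [e]
      rcases hl with hl | hl
      · rw [hv lam hl]; simp
      · exact neg_mem (Submodule.smul_mem _ _ (rootSpace_le_sumRoots hl hx))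
    · intro x y h1 h2
      rw [add_lie]
      exact add_mem h1 h2
  have hQ0 : ∀ z ∈ sumRoots (L ∪ S), ⁅z, (H₀ : g)⁆ = 0 := by
    intro z hz
    rw [← lie_skew, lie_eq_zero_of_mem_sumRoots ?_ hz, neg_zero]
    rintro lam (hl | hl) <;> exact hl.2.1
  obtain rfl : ν = expAd z hzn := LinearEquiv.toLinearMap_injective hν
  have hzn' : IsNilpotent (LieAlgebra.ad F g (-z)) := by rw [map_neg]; exact hzn.neg
  have hv := expAd_sub_self_mem (-z) hzn' (c : g) (sumRoots S)
    (hQv _ (neg_mem hzQ) c hLc) (hQN _ (neg_mem hzQ))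
  obtain ⟨w, hw, hwS, hwc⟩ := exists_expAd_apply_eq hs hint hdeg
    (fun lam hl => hSS lam (Or.inr hl)) hv
  have hsymm : (expAd z hzn).symm (c : g) = expAd w hw (c : g) := by
    rw [hwc, expAd_symm_apply, expAd_apply]; abel
  have hwQ : w ∈ sumRoots (L ∪ S) := sumRoots_mono Set.subset_union_right hwS
  set γ : g ≃ₗ[F] g := expAd z hzn * expAd w hw with hγ
  have hγc : γ (c : g) = c := by
    rw [hγ, LinearEquiv.mul_apply, ← hsymm, LinearEquiv.apply_symm_apply]
  have hγ0 : γ (H₀ : g) = H₀ := by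
    rw [hγ, LinearEquiv.mul_apply, expAd_apply_of_lie_eq_zero w hw _ (hQ0 w hwQ),
      expAd_apply_of_lie_eq_zero z hzn _ (hQ0 z hzQ)]
  have hγaut : γ ∈ aut0 F g := mul_mem_aut0 (expAd_mem_aut0 z hzn) (expAd_mem_aut0 w hw)
  have hγH : ∀ i, γ (H i : g) = H i := by
    intro i
    have hL : ∀ lam ∈ L, lam (H i) = 0 := fun lam hl => hl.2.2 i
    have h1 := expAd_sub_self_mem w hw (H i : g) (sumRoots S) (hQv w hwQ _ hL) (hQN w hwQ)
    have h2 := expAd_sub_self_mem z hzn (H i : g) (sumRoots S) (hQv z hzQ _ hL) (hQN z hzQ)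
    have h3 := expAd_sub_self_mem z hzn _ (sumRoots S) (hQN z hzQ _ h1) (hQN z hzQ)
    have hmem : γ (H i : g) - H i ∈ sumRoots S := by
      have := add_mem (add_mem h3 h1) h2
      convert this using 1
      rw [hγ, LinearEquiv.mul_apply, map_sub]
      abel
    rw [← degGE_one hdeg] at hmem
    -- The difference lies in `n` and commutes with `c`, while `ad c` has only nonzero eigenvalues
    -- on `n`.
    refine sub_eq_zero.1 (eq_zero_of_mem_degGE_of_lie_eq_zero hs hmem ?_)
    have h4 : ⁅γ (H i : g), (c : g)⁆ = 0 := by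
      conv_lhs => rw [← hγc]
      rw [← hγaut.1, hs.1 _ (H i).2 _ c.2, map_zero]
    rw [sub_lie, h4, hs.1 _ (H i).2 _ c.2, sub_zero]
  have hγ₀H : ∀ i, γ₀ (H i : g) = H i := by
    intro i
    have hle : Submodule.span F (Set.range H') ≤
        LinearMap.ker (((γ₀ : g →ₗ[F] g) - LinearMap.id) ∘ₗ a.toSubmodule.subtype) := by
      rw [Submodule.span_le]
      rintro _ ⟨j, rfl⟩
      have := hγ₀.2.2 j
      simp only [SetLike.mem_coe, LinearMap.mem_ker, LinearMap.comp_apply, LinearMap.sub_apply]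
      exact sub_eq_zero.2 this
    exact sub_eq_zero.1 (LinearMap.mem_ker.1 (hle (hspan i)))
  -- The decomposition is `γ₀ exp (ad z) = (γ₀ γ) exp (-ad w)`.
  refine ⟨γ₀ * γ, ⟨mul_mem_aut0 hγ₀.1 hγaut, ?_, fun i => ?_⟩, (expAd w hw).symm,
    ⟨-w, neg_mem hwS, by rw [map_neg]; exact hw.neg, ?_⟩, ?_⟩
  · rw [LinearEquiv.mul_apply, hγ0, hγ₀.2.1]
  · rw [LinearEquiv.mul_apply, hγH, hγ₀H]
  · ext y
    exact expAd_symm_apply w hw y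
  · ext y
    simp [hγ, LinearEquiv.mul_apply]

end Inclusion

/-! ### Even block sizes in the split case. -/

section Parity

variable {F : Type*} [Field F] [CharZero F] {g : Type*} [LieRing g] [LieAlgebra F g]
  [FiniteDimensional F g] {a : LieSubalgebra F g}

/-- If `a` is a Cartan subalgebra, the root spaces are lines. -/
theorem exists_smul_eq_of_mem_rootSpace [LieAlgebra.IsKilling F g] (hs : IsSplitAbelian F a)
    (hC : a.IsCartanSubalgebra) {lam : Module.Dual F a} (h0 : lam ≠ 0) {x y : g}
    (hx : x ∈ rootSpace lam) (hx0 : x ≠ 0) (hy : y ∈ rootSpace lam) : ∃ c : F, c • x = y := by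
  have : LieModule.IsTriangularizable F a g := by
    refine ⟨fun v => ?_⟩
    have h1 : LieModule.toEnd F a g v = LieAlgebra.ad F g (v : g) := rfl
    rw [h1, eq_top_iff, ← hs.2 v v.2]
    exact iSup_mono fun μ => Module.End.eigenspace_le_maxGenEigenspace
  have hle : ∀ z ∈ rootSpace lam, z ∈ LieAlgebra.rootSpace a (lam : a → F) := fun z hz =>
    LieModule.weightSpace_le_genWeightSpace g _ ((LieModule.mem_weightSpace _ _).2 hz)
  let al : LieModule.Weight F a g := ⟨lam, fun h => hx0 (by
    have := hle x hx
    rw [LieAlgebra.rootSpace, h] at this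
    exact this)⟩
  have hal : al.IsNonZero := fun h => h0 (DFunLike.coe_injective h)
  have h1 := LieAlgebra.IsKilling.finrank_rootSpace_eq_one al hal
  obtain ⟨c, hc⟩ := (finrank_eq_one_iff_of_nonzero' (⟨x, hle x hx⟩ : LieAlgebra.rootSpace a (al : a → F))
    (fun h => hx0 (congrArg Subtype.val h))).1 h1 ⟨y, hle y hy⟩
  exact ⟨c, congrArg Subtype.val hc⟩

variable {n : ℕ} {e : Module.Basis (Fin n) F a} {R : CType} {k : ℕ} {H₀ : a}

theorem IsOfType.eq_two_smul_coord (htype : IsOfType e R k H₀) {lam : Module.Dual F a}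
    (hl : lam ∈ roots a) {i : Fin n} (hi : lam (e i) = 2) : lam = (2 : F) • e.coord i := by
  rw [htype.1] at hl
  rcases hl with hl | hl
  · rcases mem_posRoots_iff.1 hl with ⟨p, q, hpq, rfl | rfl⟩ | ⟨-, p, rfl⟩ | ⟨-, p, rfl⟩ <;>
      simp only [LinearMap.sub_apply, LinearMap.add_apply, LinearMap.smul_apply, smul_eq_mul,
        coord_basis] at hi <;> grind
  · rcases mem_posRoots_iff.1 hl with ⟨p, q, hpq, h | h⟩ | ⟨-, p, h⟩ | ⟨-, p, h⟩ <;>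
      rw [neg_eq_iff_eq_neg] at h <;> subst h <;>
      simp only [LinearMap.neg_apply, LinearMap.sub_apply, LinearMap.add_apply,
        LinearMap.smul_apply, smul_eq_mul, coord_basis] at hi <;> grind

theorem eq_zero_of_lie_eq_smul (hs : IsSplitAbelian F a) {v w : a} {p q : F} {x : g}
    (hv : ⁅(v : g), x⁆ = p • x) (hw : ⁅(w : g), x⁆ = q • x) (hp : p ≠ 0)
    (h : ∀ lam ∈ roots a, lam v = p → lam w ≠ q) : x = 0 := by
  by_contra hx0
  obtain ⟨lam, hl, hI⟩ := exists_weight_of_lie_eq_smul hs (I := {(v, p), (w, q)}) hx0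
    (by rintro i (rfl | rfl) <;> assumption)
  have h1 : lam v = p := hI (v, p) (by simp)
  refine h lam ⟨?_, hl⟩ h1 (hI (w, q) (by simp))
  rintro rfl
  exact hp (by simpa using h1.symm)

theorem det_eq_zero_of_transpose_eq_neg {ι : Type*} [Fintype ι] [DecidableEq ι] (A : Matrix ι ι F)
    (hA : A.transpose = -A) (hodd : Odd (Fintype.card ι)) : A.det = 0 := by
  have h := A.det_transpose
  rw [hA, Matrix.det_neg, hodd.neg_one_pow] at h
  linear_combination (-1 / 2 : F) * h

variable [LieAlgebra.IsKilling F g]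

/-- For `z` of weight `2ε_s`, `[v, z] = 0` because `3ε_s + ε_j` is not a root, so `[v, [f, z]] = [h,
z] = 2z` for the triple `(v, h, f)`. Root spaces being lines, `w` is a nonzero multiple of `[f, z]`.
-/
theorem IsOfType.lie_ne_zero_of_cartan (htype : IsOfType e R k H₀)
    (ha : Maximal (IsSplitAbelian F) a) (hC : a.IsCartanSubalgebra) (hn : 3 ≤ n)
    {s j : Fin n} (hsj : s ≠ j) (h2 : (2 : F) • e.coord s ∈ roots a) {v w : g}
    (hv : v ∈ rootSpace (e.coord s + e.coord j)) (hv0 : v ≠ 0)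
    (hw : w ∈ rootSpace (e.coord s - e.coord j)) (hw0 : w ≠ 0) : ⁅v, w⁆ ≠ 0 := by
  have hv' : v ∈ rootSpace (e.coord s + (1 : F) • e.coord j) := by rwa [one_smul]
  obtain ⟨f, hf, t⟩ := htype.exists_sl2_basis ha hn hsj (Or.inl rfl) hv' hv0
  rw [one_smul] at hf t
  obtain ⟨z, hz, hz0⟩ := exists_ne_zero_of_mem_roots h2
  have hvz : ⁅v, z⁆ = 0 := by
    by_contra h0
    have h1 := lie_mem_rootSpace hv hz
    have h3 : (e.coord s + e.coord j + (2 : F) • e.coord s) (e s) = 3 := by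
      simp [coord_basis, hsj]; norm_num
    have hr := mem_roots_of_ne_zero (fun h => by rw [h] at h3; simp at h3) h1 h0
    rw [htype.1] at hr
    rcases hr with hr | hr
    · rcases mem_posRoots_iff.1 hr with ⟨p, q, hpq, h | h⟩ | ⟨-, p, h⟩ | ⟨-, p, h⟩ <;>
        rw [h] at h3 <;>
        simp only [LinearMap.sub_apply, LinearMap.add_apply, LinearMap.smul_apply, smul_eq_mul,
          coord_basis] at h3 <;> grind
    · rcases mem_posRoots_iff.1 hr with ⟨p, q, hpq, h | h⟩ | ⟨-, p, h⟩ | ⟨-, p, h⟩ <;>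
        rw [neg_eq_iff_eq_neg] at h <;> rw [h] at h3 <;>
        simp only [LinearMap.neg_apply, LinearMap.sub_apply, LinearMap.add_apply,
          LinearMap.smul_apply, smul_eq_mul, coord_basis] at h3 <;> grind
  have hvfz : ⁅v, ⁅f, z⁆⁆ = (2 : F) • z := by
    rw [leibniz_lie, t.lie_e_f, hvz, lie_zero, add_zero, hz]
    simp [coord_basis, hsj.symm]
  have hfz0 : ⁅f, z⁆ ≠ 0 := by
    intro h
    rw [h, lie_zero] at hvfz
    exact hz0 (by simpa using hvfz.symm)
  have hfz : ⁅f, z⁆ ∈ rootSpace (e.coord s - e.coord j) := by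
    have := lie_mem_rootSpace hf hz
    convert this using 2
    rw [two_smul]; abel
  have hne : e.coord s - e.coord j ≠ 0 := (htype.sub_mem hsj).1
  obtain ⟨c, rfl⟩ := exists_smul_eq_of_mem_rootSpace ha.prop hC hne hfz hfz0 hw
  rw [lie_smul, hvfz]
  have hc : c ≠ 0 := fun h => hw0 (by rw [h, zero_smul])
  simp [hc, hz0]

/-- If `a` is a Cartan subalgebra and `2ε_s` is a root, a 1-simple `∑_{j ∈ T} 2 e_j`, `s ∉ T`, has an
even number of terms. -/
theorem IsOfType.even_card (htype : IsOfType e R k H₀)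
    (ha : Maximal (IsSplitAbelian F) a) (hC : a.IsCartanSubalgebra) (hn : 3 ≤ n) {h : a}
    (ho : OneSimple F (H₀ : g) (h : g)) {T : Finset (Fin n)}
    (hT : ∀ i, e.coord i h = if i ∈ T then 2 else 0) (hTk : ∀ i ∈ T, (i : ℕ) < k) {s : Fin n}
    (hsT : s ∉ T) (hsk : (s : ℕ) < k) (h2 : (2 : F) • e.coord s ∈ roots a) : Even T.card := by
  have hs := ha.prop
  obtain ⟨x, y, t, -, -, hxy⟩ := ho.exists_triple hs (fun _ => htype.neg_mem)
  obtain ⟨hsx, hsy⟩ := hxy (e s) (by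
    intro be hb h1 hb2
    obtain ⟨i, hi, rfl | ⟨j, hj, rfl | rfl⟩⟩ := htype.cases_of_degree_one hb h1 <;>
      simp only [LinearMap.sub_apply, LinearMap.add_apply, hT] at hb2 <;>
      simp only [LinearMap.sub_apply, LinearMap.add_apply, coord_basis] <;> grind)
  have hhy : ⁅(h : g), y⁆ = (-2 : F) • y := by
    rw [t.lie_h_f_nsmul, neg_smul, two_smul, two_smul]
  have hhx : ⁅(h : g), x⁆ = (2 : F) • x := t.lie_h_e_smul F
  have hsh : e.coord s h = 0 := by rw [hT, if_neg hsT]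
  have hne : ∀ j ∈ T, s ≠ j := fun j hj h => hsT (h ▸ hj)
  have hw1 : ∀ lam ∈ roots a, lam (e s) = 1 → lam h = 0 ∨ lam h = 2 ∨ lam h = -2 := by
    intro lam hl h1
    rcases htype.cases_of_apply_eq_one hl h1 with rfl | ⟨l, hl, rfl | rfl⟩ <;>
      simp only [LinearMap.sub_apply, LinearMap.add_apply, hT] <;> grind
  have hw1' : ∀ lam ∈ roots a, lam (e s) = 1 → lam h = -2 →
      ∃ j ∈ T, lam = e.coord s - e.coord j := by
    intro lam hl h1 h2
    rcases htype.cases_of_apply_eq_one hl h1 with rfl | ⟨l, hl, rfl | rfl⟩ <;>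
      simp only [LinearMap.sub_apply, LinearMap.add_apply, hT] at h2
    · grind
    · grind
    · exact ⟨l, by grind, rfl⟩
  have hw2 : ∀ lam ∈ roots a, lam (e s) = 2 → lam h = 0 := by
    intro lam hl h1
    rw [htype.eq_two_smul_coord hl h1, LinearMap.smul_apply, hsh, smul_zero]
  have hz2 : ∀ {q : F}, q ≠ 0 → ∀ u : g, ⁅((e s : a) : g), u⁆ = (2 : F) • u → ⁅(h : g), u⁆ = q • u →
      u = 0 := fun hq u h1 h2 => eq_zero_of_lie_eq_smul hs h1 h2 two_ne_zero
    fun lam hl hls hlh => hq (by rw [← hlh, hw2 lam hl hls])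
  have hder : ∀ (v : a) (p q : F) (u w : g), ⁅(v : g), u⁆ = p • u → ⁅(v : g), w⁆ = q • w →
      ⁅(v : g), ⁅u, w⁆⁆ = (p + q) • ⁅u, w⁆ := by
    intro v p q u w h1 h2
    rw [leibniz_lie, h1, h2, smul_lie, lie_smul, add_smul]
  have hsy' : ⁅((e s : a) : g), y⁆ = (0 : F) • y := by rw [hsy, zero_smul]
  have hsx' : ⁅((e s : a) : g), x⁆ = (0 : F) • x := by rw [hsx, zero_smul]
  choose v hv hv0 using fun j : T => exists_ne_zero_of_mem_roots (htype.add_mem (hne j j.2))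
  obtain ⟨z, hz, hz0⟩ := exists_ne_zero_of_mem_roots h2
  have hvs : ∀ j, ⁅((e s : a) : g), v j⁆ = (1 : F) • v j := by
    intro j
    rw [hv j, LinearMap.add_apply, coord_basis, coord_basis, if_pos rfl, if_neg (hne j j.2), add_zero]
  have hvh : ∀ j, ⁅(h : g), v j⁆ = (2 : F) • v j := by
    intro j
    rw [hv j, LinearMap.add_apply, hsh, hT, if_pos j.2, zero_add]
  -- The form `(i, j) ↦ [v_i, (ad y)² v_j]` has values in the line of weight `2ε_s`. The vector
  -- `[[y, v_i], v_j]` has value 2 under both `e_s` and `h`, which no root has, so it is 0; applying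
  -- `ad y` rewrites the form as a bracket of `[y, v_i]` and `[y, v_j]`, which is skew.
  have hskew : ∀ i j, ⁅v i, ⁅y, ⁅y, v j⁆⁆⁆ = -⁅v j, ⁅y, ⁅y, v i⁆⁆⁆ := by
    have hyv : ∀ i j, ⁅⁅y, v i⁆, v j⁆ = 0 := fun i j => hz2 (q := -2 + 2 + 2) (by norm_num) _
      (by rw [hder _ _ _ _ _ (hder _ _ _ _ _ hsy' (hvs i)) (hvs j)]; norm_num)
      (hder _ _ _ _ _ (hder _ _ _ _ _ hhy (hvh i)) (hvh j))
    have key : ∀ i j, ⁅v j, ⁅y, ⁅y, v i⁆⁆⁆ = ⁅⁅y, v i⁆, ⁅y, v j⁆⁆ := by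
      intro i j
      have h1 := congrArg (fun u => ⁅y, u⁆) (hyv i j)
      simp only [lie_zero] at h1
      rw [leibniz_lie, ← lie_skew] at h1
      exact (neg_add_eq_zero.1 h1)
    intro i j
    rw [key, key, lie_skew]
  by_contra hodd
  rw [Nat.not_even_iff_odd] at hodd
  have hzz : (2 : F) • e.coord s ≠ 0 := h2.1
  have hline : ∀ i j : T, ∃ c : F, c • z = ⁅v i, ⁅y, ⁅y, v j⁆⁆⁆ := by
    intro i j
    refine exists_smul_eq_of_mem_rootSpace hs hC hzz hz hz0 ?_
    have h1 : ⁅((e s : a) : g), ⁅v i, ⁅y, ⁅y, v j⁆⁆⁆⁆ = (2 : F) • ⁅v i, ⁅y, ⁅y, v j⁆⁆⁆ := by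
      rw [hder _ _ _ _ _ (hvs i) (hder _ _ _ _ _ hsy' (hder _ _ _ _ _ hsy' (hvs j)))]; norm_num
    have h3 := mem_sumRoots_of_lie_eq_smul hs (I := {(e s, (2 : F))})
      (x := ⁅v i, ⁅y, ⁅y, v j⁆⁆⁆) (by rintro i rfl; exact h1)
    refine (sumRoots_le (W := rootSpace ((2 : F) • e.coord s)) ?_) h3
    rintro lam ⟨hl, hI⟩ u hu -
    have h4 : lam (e s) = 2 := hI _ rfl
    rwa [htype.eq_two_smul_coord ⟨fun h => by simp [h] at h4, hl⟩ h4] at hu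
  choose A hA using hline
  -- A skew matrix of odd size is singular; a kernel vector gives `u ≠ 0` with `[v_j, (ad y)² u] =
  -- 0` for all `j`.
  obtain ⟨c, hc0, hc⟩ := Matrix.exists_mulVec_eq_zero_iff.2
    (det_eq_zero_of_transpose_eq_neg (Matrix.of A) (by
      ext i j
      have := hskew j i
      rw [← hA, ← hA, ← neg_smul] at this
      exact smul_left_injective F hz0 this) (by rwa [Fintype.card_coe]))
  set u : g := ∑ i, c i • v i with hu
  have hus : ⁅((e s : a) : g), u⁆ = (1 : F) • u := by
    simp only [hu, lie_sum, lie_smul, hvs, one_smul]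
  have huh : ⁅(h : g), u⁆ = (2 : F) • u := by
    rw [hu, lie_sum, Finset.smul_sum]
    exact Finset.sum_congr rfl fun i _ => by rw [lie_smul, hvh, smul_comm]
  have hu0 : u ≠ 0 := by
    intro h0
    apply hc0
    ext j
    have h1 := congrArg (rootProj hs (e.coord s + e.coord (j : Fin n))) h0
    rw [hu, map_zero, map_sum, Finset.sum_eq_single j] at h1
    · rw [map_smul, rootProj_of_mem hs (hv j)] at h1
      exact (smul_eq_zero.1 h1).resolve_right (hv0 j)
    · intro i _ hij
      rw [map_smul, rootProj_of_mem_ne hs (hv i), smul_zero]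
      intro h3
      have := LinearMap.congr_fun h3 (e j)
      simp only [LinearMap.add_apply, coord_basis] at this
      have hij' : (j : Fin n) ≠ i := fun h => hij (Subtype.ext h.symm)
      simp [hij', (hne j j.2).symm] at this
    · simp
  have hYu : ∀ j : T, ⁅v j, ⁅y, ⁅y, u⁆⁆⁆ = 0 := by
    intro j
    have h1 : ⁅v j, ⁅y, ⁅y, u⁆⁆⁆ = (Matrix.mulVec (Matrix.of A) c j) • z := by
      simp only [hu, lie_sum, lie_smul, ← hA, Matrix.mulVec, dotProduct, Finset.sum_smul,
        Matrix.of_apply, smul_smul]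
      exact Finset.sum_congr rfl fun i _ => by rw [mul_comm]
    rw [h1, hc, Pi.zero_apply, zero_smul]
  -- Its components have weights `ε_s - ε_j` with `j ∈ T`, and `v_j` brackets nontrivially with a
  -- nonzero component of that weight.
  have hY0 : ⁅y, ⁅y, u⁆⁆ = 0 := by
    have hYs : ⁅((e s : a) : g), ⁅y, ⁅y, u⁆⁆⁆ = (1 : F) • ⁅y, ⁅y, u⁆⁆ := by
      rw [hder _ _ _ _ _ hsy' (hder _ _ _ _ _ hsy' hus)]; norm_num
    have hYh : ⁅(h : g), ⁅y, ⁅y, u⁆⁆⁆ = (-2 : F) • ⁅y, ⁅y, u⁆⁆ := by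
      rw [hder _ _ _ _ _ hhy (hder _ _ _ _ _ hhy huh)]; norm_num
    have h4 : ⁅y, ⁅y, u⁆⁆ ∈ sumRoots (∅ : Set (Module.Dual F a)) := by
      refine mem_sumRoots_of_rootProj hs fun lam hl => ?_
      exfalso
      have hb := rootSpace_ne_bot_of_mem (rootProj_mem hs lam _) hl
      have hval : ∀ (w : a) (q : F), ⁅(w : g), ⁅y, ⁅y, u⁆⁆⁆ = q • ⁅y, ⁅y, u⁆⁆ → lam w = q := by
        intro w q hw
        have h1 := rootProj_lie hs (mu := lam) (coe_mem_rootSpace_zero hs w) ⁅y, ⁅y, u⁆⁆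
        rw [zero_add, hw, map_smul, rootProj_mem hs lam _ w] at h1
        exact (smul_left_injective F hl h1).symm
      have hl1 := hval _ _ hYs
      obtain ⟨j, hj, rfl⟩ := hw1' lam ⟨fun h => by simp [h] at hl1, hb⟩ hl1 (hval _ _ hYh)
      refine htype.lie_ne_zero_of_cartan ha hC hn (hne j hj) h2 (hv ⟨j, hj⟩) (hv0 ⟨j, hj⟩)
        (rootProj_mem hs _ _) hl ?_
      rw [← rootProj_lie hs (hv ⟨j, hj⟩), hYu, map_zero]
    simpa [sumRoots] using h4
  -- `u` is a highest weight vector of weight 2 for the triple, so `(ad y)² u = 0` forces `u = 0`.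
  have hxu : ⁅x, u⁆ = 0 := eq_zero_of_lie_eq_smul hs (hder _ _ _ _ _ hsx' hus)
    (hder _ _ _ _ _ hhx huh) (by norm_num) fun lam hl h1 h2 => by
      rcases hw1 lam hl (by rw [h1]; norm_num) with h3 | h3 | h3 <;> rw [h3] at h2 <;> norm_num at h2
  have hxyu : ⁅x, ⁅y, u⁆⁆ = (2 : F) • u := by
    rw [leibniz_lie, t.lie_e_f, hxu, lie_zero, add_zero, huh]
  have hyu : (2 : F) • ⁅y, u⁆ = 0 := by
    have h1 := congrArg (fun w => ⁅x, w⁆) hY0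
    simp only [lie_zero] at h1
    rw [leibniz_lie, t.lie_e_f, hxyu, hder _ _ _ _ _ hhy huh, lie_smul] at h1
    simpa using h1
  have hyu0 : ⁅y, u⁆ = 0 := (smul_eq_zero.1 hyu).resolve_left two_ne_zero
  rw [hyu0, lie_zero] at hxyu
  exact hu0 ((smul_eq_zero.1 hxyu.symm).resolve_left two_ne_zero)

end Parity

/-! ### Coroots in coordinates. -/

section Coroots

variable {F : Type*} [Field F] [CharZero F] {g : Type*} [LieRing g] [LieAlgebra F g]
  {a : LieSubalgebra F g} {n : ℕ}

theorem eq_of_coord_eq (e : Module.Basis (Fin n) F a) {v w : a}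
    (h : ∀ i, e.coord i v = e.coord i w) : v = w :=
  e.repr.injective (Finsupp.ext h)

theorem coord_coroot (e : Module.Basis (Fin n) F a) (v : Module.Dual F a) (i : Fin n) :
    e.coord i (coroot e v) = (2 / ∑ j, v (e j) ^ 2) * v (e i) := by
  rw [coroot, map_smul, map_sum, smul_eq_mul]
  congr 1
  rw [Finset.sum_eq_single i]
  · simp [coord_basis]
  · intro j _ hj
    simp [coord_basis, hj]
  · simp

theorem coroot_coord (e : Module.Basis (Fin n) F a) (j : Fin n) :
    coroot e (e.coord j) = (2 : F) • e j := by
  refine eq_of_coord_eq e fun i => ?_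
  rw [coord_coroot, Finset.sum_eq_single j]
  · simp only [map_smul, coord_basis, smul_eq_mul]
    split_ifs <;> grind
  · intro l _ hl
    simp [coord_basis, hl]
  · simp

theorem coroot_two_smul_coord (e : Module.Basis (Fin n) F a) (j : Fin n) :
    coroot e ((2 : F) • e.coord j) = e j := by
  refine eq_of_coord_eq e fun i => ?_
  rw [coord_coroot, Finset.sum_eq_single j]
  · simp only [LinearMap.smul_apply, coord_basis, smul_eq_mul]
    split_ifs <;> grind
  · intro l _ hl
    simp [coord_basis, hl]
  · simp

theorem coroot_coord_add_smul_coord (e : Module.Basis (Fin n) F a) {i j : Fin n} (hij : i ≠ j)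
    {s : F} (hs : s = 1 ∨ s = -1) : coroot e (e.coord i + s • e.coord j) = e i + s • e j := by
  have hsum : ∑ l, (e.coord i + s • e.coord j) (e l) ^ 2 = 2 := by
    have : ∀ l, (e.coord i + s • e.coord j) (e l) ^ 2
        = (if l = i then 1 else 0) + (if l = j then 1 else 0) := by
      intro l
      simp only [LinearMap.add_apply, LinearMap.smul_apply, coord_basis, smul_eq_mul]
      split_ifs <;> grind
    simp only [this, Finset.sum_add_distrib, Finset.sum_ite_eq', Finset.mem_univ, if_true]
    norm_num
  refine eq_of_coord_eq e fun l => ?_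
  rw [coord_coroot, hsum]
  simp only [map_add, map_smul, LinearMap.add_apply, LinearMap.smul_apply, coord_basis, smul_eq_mul]
  split_ifs <;> grind

theorem coroot_eps_add (e : Module.Basis (Fin n) F a) {i j : Fin n} (hij : i ≠ j) :
    coroot e (eps e (i + 1) + eps e (j + 1)) = e i + e j := by
  have := coroot_coord_add_smul_coord e hij (s := 1) (Or.inl rfl)
  rwa [one_smul, one_smul, ← eps_succ, ← eps_succ] at this

theorem coroot_eps_sub (e : Module.Basis (Fin n) F a) {i j : Fin n} (hij : i ≠ j) :
    coroot e (eps e (i + 1) - eps e (j + 1)) = e i - e j := by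
  have := coroot_coord_add_smul_coord e hij (s := -1) (Or.inr rfl)
  rwa [neg_one_smul F (e.coord j), neg_one_smul F (e j), ← sub_eq_add_neg, ← sub_eq_add_neg,
    ← eps_succ, ← eps_succ] at this

theorem coord_coroot_eps (e : Module.Basis (Fin n) F a) (i : Fin n) {j : ℕ} (h1 : 1 ≤ j)
    (h2 : j ≤ n) : e.coord i (coroot e (eps e j)) = if (i : ℕ) + 1 = j then 2 else 0 := by
  rw [eps_eq_coord e h1 h2, coroot_coord, map_smul, coord_basis]
  have : (⟨j - 1, by omega⟩ : Fin n) = i ↔ (i : ℕ) + 1 = j := by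
    rw [Fin.ext_iff]
    simp only
    omega
  simp [this]

theorem coord_coroot_two_smul_eps (e : Module.Basis (Fin n) F a) (i : Fin n) {j : ℕ} (h1 : 1 ≤ j)
    (h2 : j ≤ n) : e.coord i (coroot e ((2 : F) • eps e j)) = if (i : ℕ) + 1 = j then 1 else 0 := by
  rw [eps_eq_coord e h1 h2, coroot_two_smul_coord, coord_basis]
  have : (⟨j - 1, by omega⟩ : Fin n) = i ↔ (i : ℕ) + 1 = j := by
    rw [Fin.ext_iff]
    simp only
    omega
  simp [this]

theorem coord_coroot_eps_pair (e : Module.Basis (Fin n) F a) {k : ℕ} (hk : 2 * k ≤ n) (l : Fin n)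
    {i : ℕ} (h1 : 1 ≤ i) (h2 : i ≤ k) :
    e.coord l (coroot e (eps e i - eps e (2 * k - i + 1))) =
      (if (l : ℕ) + 1 = i then 1 else 0) - (if 2 * k - l = i ∧ (l : ℕ) < 2 * k then 1 else 0) ∧
    e.coord l (coroot e (eps e i + eps e (2 * k - i + 1))) =
      (if (l : ℕ) + 1 = i then 1 else 0) + (if 2 * k - l = i ∧ (l : ℕ) < 2 * k then 1 else 0) := by
  obtain ⟨i, rfl⟩ : ∃ r, i = r + 1 := ⟨i - 1, by omega⟩
  let p : Fin n := ⟨i, by omega⟩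
  let q : Fin n := ⟨2 * k - (i + 1), by omega⟩
  have hpq : p ≠ q := by
    rw [Ne, Fin.ext_iff]
    simp only [p, q]
    omega
  have hp : p = l ↔ (l : ℕ) + 1 = i + 1 := by
    rw [Fin.ext_iff]
    simp only [p]
    omega
  have hq : q = l ↔ 2 * k - l = i + 1 ∧ (l : ℕ) < 2 * k := by
    rw [Fin.ext_iff]
    simp only [q]
    omega
  have ha := coroot_eps_add e hpq
  have hb := coroot_eps_sub e hpq
  simp only [p, q] at ha hb
  rw [ha, hb, map_sub, map_add, coord_basis, coord_basis]
  simp only [← hp, ← hq, p, q, and_self]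

/-- `P'_0` in coordinates. -/
theorem P_eq_P0' (e : Module.Basis (Fin n) F a) {k : ℕ} (hk : 2 * k ≤ n) (H₀ : a) {H : Fin 2 → a}
    (h0 : ∀ i : Fin n, e.coord i (H 0) =
      if (i : ℕ) < k then 1 else if (i : ℕ) < 2 * k then -1 else 0)
    (h1 : ∀ i : Fin n, e.coord i (H 1) = if (i : ℕ) < 2 * k then 1 else 0) :
    P H₀ H = P0' e k H₀ := by
  rw [P0']
  congr 1
  funext q
  refine eq_of_coord_eq e fun l => ?_
  have s1 : ∑ i ∈ Finset.Icc 1 k, (if (l : ℕ) + 1 = i then (1 : F) else 0)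
      = if (l : ℕ) < k then 1 else 0 := by
    rw [Finset.sum_ite_eq]
    simp [Nat.succ_le_iff]
  have s2 : ∑ i ∈ Finset.Icc 1 k, (if 2 * k - l = i ∧ (l : ℕ) < 2 * k then (1 : F) else 0)
      = if k ≤ (l : ℕ) ∧ (l : ℕ) < 2 * k then 1 else 0 := by
    by_cases hl : (l : ℕ) < 2 * k
    · simp only [hl, and_true]
      rw [Finset.sum_ite_eq]
      have : 2 * k - l ∈ Finset.Icc 1 k ↔ k ≤ (l : ℕ) := by rw [Finset.mem_Icc]; omega
      simp only [this]
    · simp [hl]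
  fin_cases q
  · simp only [Fin.zero_eta, Matrix.cons_val_zero, map_sum]
    rw [Finset.sum_congr rfl fun i hi => (coord_coroot_eps_pair e hk l (Finset.mem_Icc.1 hi).1
      (Finset.mem_Icc.1 hi).2).1, Finset.sum_sub_distrib, s1, s2, h0]
    grind
  · simp only [Fin.mk_one, Matrix.cons_val_one, Matrix.cons_val_zero, map_sum]
    rw [Finset.sum_congr rfl fun i hi => (coord_coroot_eps_pair e hk l (Finset.mem_Icc.1 hi).1
      (Finset.mem_Icc.1 hi).2).2, Finset.sum_add_distrib, s1, s2, h1]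
    grind

theorem coord_flipLast (e : Module.Basis (Fin n) F a) (i : Fin n) (v : a) :
    (flipLast e).coord i v = if (i : ℕ) + 1 = n then -e.coord i v else e.coord i v := by
  rw [flipLast, Module.Basis.coord_unitsSMul]
  split_ifs <;> simp [Units.smul_def]

end Coroots

/-! ### Parabolic subgroups of ordered partitions. -/

section Index

variable {F : Type*} [Field F] [CharZero F] {g : Type*} [LieRing g] [LieAlgebra F g]
  [FiniteDimensional F g] {a : LieSubalgebra F g} {n : ℕ} {e : Module.Basis (Fin n) F a}
  {R : CType} {k : ℕ} {H₀ : a} {p : ℕ} {H : Fin p → a} {idx : ℕ → ℕ}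

/-- The roots of the second alternative vanish on every family given by a partition, so only the
differences `ε_i - ε_j` need comparing. -/
theorem IsOfType.cases_of_degree_zero (htype : IsOfType e R k H₀) {lam : Module.Dual F a}
    (hl : lam ∈ roots a) (h0 : lam H₀ = 0) :
    (∃ i j : Fin n, (i : ℕ) < k ∧ (j : ℕ) < k ∧ lam = e.coord i - e.coord j) ∨
      ∀ i : Fin n, (i : ℕ) < k → lam (e i) = 0 := by
  rw [htype.1] at hl
  rcases hl with hl | hl
  · rcases mem_posRoots_iff.1 hl with ⟨p, q, hpq, rfl | rfl⟩ | ⟨-, p, rfl⟩ | ⟨-, p, rfl⟩ <;>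
      simp only [LinearMap.sub_apply, LinearMap.add_apply, LinearMap.smul_apply, smul_eq_mul,
        htype.coord_H₀] at h0
    · by_cases hp : (p : ℕ) < k
      · exact Or.inl ⟨p, q, hp, by grind, rfl⟩
      · refine Or.inr fun i hi => ?_
        simp only [LinearMap.sub_apply, coord_basis]
        grind
    all_goals
      refine Or.inr fun i hi => ?_
      simp only [LinearMap.add_apply, LinearMap.smul_apply, smul_eq_mul, coord_basis]
      grind
  · rcases mem_posRoots_iff.1 hl with ⟨p, q, hpq, h | h⟩ | ⟨-, p, h⟩ | ⟨-, p, h⟩ <;>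
      rw [neg_eq_iff_eq_neg] at h <;> subst h <;>
      simp only [LinearMap.neg_apply, LinearMap.sub_apply, LinearMap.add_apply,
        LinearMap.smul_apply, smul_eq_mul, htype.coord_H₀] at h0
    · by_cases hp : (p : ℕ) < k
      · exact Or.inl ⟨q, p, by grind, hp, neg_sub _ _⟩
      · refine Or.inr fun i hi => ?_
        simp only [LinearMap.neg_apply, LinearMap.sub_apply, coord_basis]
        grind
    all_goals
      refine Or.inr fun i hi => ?_
      simp only [LinearMap.neg_apply, LinearMap.add_apply, LinearMap.smul_apply, smul_eq_mul,
        coord_basis]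
      grind

/-- The family `H` is given by a partition of the first `k` basis vectors:
`H q = ∑ 2 e_i`, sum over the `i < k` with `idx i = q`. -/
def IsPartition (e : Module.Basis (Fin n) F a) (k : ℕ) {p : ℕ} (H : Fin p → a)
    (idx : ℕ → ℕ) : Prop :=
  (∀ i < k, idx i < p) ∧
    ∀ (i : Fin n) (q : Fin p), e.coord i (H q) = if (i : ℕ) < k ∧ idx i = q then 2 else 0

/-- When the blocks differ, `ε_i - ε_j` is 2 on the block of `i` and -2 on that of `j`; the later
block decides. -/
theorem IsPartition.succ_iff (hH : IsPartition e k H idx) {i j : Fin n} (hi : (i : ℕ) < k)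
    (hj : (j : ℕ) < k) : Succ H (e.coord i - e.coord j) ↔ idx j < idx i := by
  constructor
  · rintro ⟨q, ⟨m, hm, hm'⟩, hq⟩
    rw [LinearMap.sub_apply, hH.2, hH.2] at hm'
    have hm0 : (m : F) ≠ 0 := by exact_mod_cast hm.ne'
    by_cases h1 : idx i = q
    · by_cases h2 : idx j = q
      · simp [hi, hj, h1, h2] at hm'
        exact absurd hm'.symm hm0
      · by_contra h3
        have := hq ⟨idx j, hH.1 j hj⟩ (by rw [Fin.lt_def]; simp only; omega)
        rw [LinearMap.sub_apply, hH.2, hH.2] at this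
        simp only [hi, hj, true_and, if_true] at this
        rw [if_neg (by omega)] at this
        norm_num at this
    · exfalso
      simp only [hi, hj, h1, true_and, if_false] at hm'
      split_ifs at hm'
      · have : ((m + 2 : ℕ) : F) = 0 := by push_cast; rw [← hm']; ring
        norm_cast at this
      · simp at hm'
        exact hm0 hm'.symm
  · intro h
    refine ⟨⟨idx i, hH.1 i hi⟩, ⟨2, by norm_num, ?_⟩, fun q hq => ?_⟩
    · rw [LinearMap.sub_apply, hH.2, hH.2, if_pos ⟨hi, rfl⟩,
        if_neg (fun h' => by have := h'.2; simp only at this; omega)]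
      simp
    · rw [Fin.lt_def] at hq
      simp only at hq
      rw [LinearMap.sub_apply, hH.2, hH.2, if_neg (fun h' => by have := h'.2; omega),
        if_neg (fun h' => by have := h'.2; omega), sub_zero]

theorem IsPartition.eq_sum (hH : IsPartition e k H idx) (q : Fin p) :
    H q = ∑ i : Fin n, (if (i : ℕ) < k ∧ idx i = q then (2 : F) else 0) • e i := by
  conv_lhs => rw [← e.sum_repr (H q)]
  exact Finset.sum_congr rfl fun i _ => by rw [← hH.2]; rfl

theorem IsPartition.apply_eq_zero (hH : IsPartition e k H idx) {lam : Module.Dual F a}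
    (hl : ∀ i : Fin n, (i : ℕ) < k → lam (e i) = 0) (q : Fin p) : lam (H q) = 0 := by
  rw [hH.eq_sum q, map_sum]
  refine Finset.sum_eq_zero fun i _ => ?_
  split_ifs with h
  · rw [map_smul, hl i h.1, smul_zero]
  · rw [zero_smul, map_zero]

/-- A finer partition with compatible order gives a smaller parabolic subgroup. -/
theorem IsPartition.P_subset_P (htype : IsOfType e R k H₀) (hs : IsSplitAbelian F a)
    {p' : ℕ} {H' : Fin p' → a} {idx' : ℕ → ℕ} (hH : IsPartition e k H idx)
    (hH' : IsPartition e k H' idx')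
    (hle : ∀ i < k, ∀ j < k, idx' j ≤ idx' i → idx j ≤ idx i) : P H₀ H' ⊆ P H₀ H := by
  classical
  have hcH : ∀ i : Fin n, e.coord i (∑ q : Fin p, ((q : ℕ) + 1 : F) • H q)
      = if (i : ℕ) < k then 2 * (idx i + 1 : F) else 0 := by
    intro i
    rw [map_sum]
    simp only [map_smul, smul_eq_mul, hH.2]
    split_ifs with hi
    · rw [Finset.sum_eq_single ⟨idx i, hH.1 i hi⟩]
      · simp [hi]; ring
      · intro q _ hq
        rw [if_neg (fun h => hq (Fin.ext h.2.symm)), mul_zero]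
      · simp
    · simp [hi]
  have hval : ∀ i j : Fin n, (i : ℕ) < k → (j : ℕ) < k →
      (e.coord i - e.coord j) (∑ q : Fin p, ((q : ℕ) + 1 : F) • H q)
        = ((2 * ((idx i : ℤ) - idx j) : ℤ) : F) := by
    intro i j hi hj
    rw [LinearMap.sub_apply, hcH, hcH, if_pos hi, if_pos hj]
    push_cast
    ring
  have hzero : ∀ lam : Module.Dual F a, (∀ i : Fin n, (i : ℕ) < k → lam (e i) = 0) →
      lam (∑ q : Fin p, ((q : ℕ) + 1 : F) • H q) = 0 := by
    intro lam hl
    rw [map_sum]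
    exact Finset.sum_eq_zero fun q _ => by rw [map_smul, hH.apply_eq_zero hl q, smul_zero]
  -- With the increasing weights `q + 1`, the degree of `ε_i - ε_j` is `2 (idx i - idx j)`, positive
  -- exactly when the root is `≻ 0`.
  refine Prehom.P_subset_P (c := ∑ q : Fin p, ((q : ℕ) + 1 : F) • H q) hs ?_ ?_ ?_ ?_ ?_ ?_
  · intro q
    have : H q = ∑ m : Fin p', (if ∃ i < k, idx' i = m ∧ idx i = q then (1 : F) else 0) • H' m := by
      refine eq_of_coord_eq e fun i => ?_
      rw [map_sum, hH.2]
      simp only [map_smul, smul_eq_mul, hH'.2]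
      by_cases hi : (i : ℕ) < k
      · rw [Finset.sum_eq_single ⟨idx' i, hH'.1 i hi⟩]
        · have : (∃ j < k, idx' j = idx' i ∧ idx j = q) ↔ idx i = q := by
            constructor
            · rintro ⟨j, hj, h1, h2⟩
              rw [← h2]
              exact le_antisymm (hle j hj i hi h1.ge) (hle i hi j hj h1.le)
            · exact fun h => ⟨i, hi, rfl, h⟩
          simp [hi, this]
        · intro m _ hm
          rw [if_neg (c := (i : ℕ) < k ∧ idx' i = m) (fun h => hm (Fin.ext h.2.symm)), mul_zero]
        · simp
      · simp [hi]
    rw [this]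
    exact sum_mem fun m _ => Submodule.smul_mem _ _ (Submodule.subset_span ⟨m, rfl⟩)
  · exact sum_mem fun m _ => Submodule.smul_mem _ _ (Submodule.subset_span ⟨m, rfl⟩)
  · rintro lam ⟨hl, h0, hS⟩
    rcases htype.cases_of_degree_zero hl h0 with ⟨i, j, hi, hj, rfl⟩ | h
    · rw [hH'.succ_iff hi hj] at hS
      rcases (hle i hi j hj hS.le).lt_or_eq with h | h
      · exact Or.inl ⟨hl, h0, (hH.succ_iff hi hj).2 h⟩
      · refine Or.inr fun q => ?_
        rw [LinearMap.sub_apply, hH.2, hH.2]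
        simp [hi, hj, h]
    · exact Or.inr (hH.apply_eq_zero h)
  · rintro lam hl h0 ⟨m, hm, hm'⟩
    rcases htype.cases_of_degree_zero hl h0 with ⟨i, j, hi, hj, rfl⟩ | h
    · refine ⟨hl, h0, (hH.succ_iff hi hj).2 ?_⟩
      rw [hval i j hi hj] at hm'
      have : 2 * ((idx i : ℤ) - idx j) = m := by exact_mod_cast hm'
      omega
    · rw [hzero lam h] at hm'
      have : m = 0 := by exact_mod_cast hm'.symm
      omega
  · rintro lam ⟨hl, h0, hS⟩
    rcases htype.cases_of_degree_zero hl h0 with ⟨i, j, hi, hj, rfl⟩ | h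
    · rw [hH.succ_iff hi hj] at hS
      refine ⟨2 * (idx i - idx j), by omega, ?_⟩
      rw [hval i j hi hj]
      push_cast [Nat.cast_sub hS.le]
      rfl
    · obtain ⟨q, ⟨m, hm, hm'⟩, -⟩ := hS
      rw [hH.apply_eq_zero h] at hm'
      have : m = 0 := by exact_mod_cast hm'.symm
      omega
  · intro lam hl
    choose m hm using htype.exists_int hl
    refine ⟨∑ i : Fin n, (if (i : ℕ) < k then 2 * ((idx i : ℤ) + 1) else 0) * m i, ?_⟩
    rw [← e.sum_repr (∑ q : Fin p, ((q : ℕ) + 1 : F) • H q), map_sum, Int.cast_sum]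
    refine Finset.sum_congr rfl fun i _ => ?_
    rw [map_smul, hm, ← Module.Basis.coord_apply, hcH]
    push_cast
    rfl

end Index

/-! ### Standard very special families. -/

section Families

theorem mem_iff_lt_card_of_lower {S : Finset ℕ} (hS : ∀ i j, i < j → j ∈ S → i ∈ S) (j : ℕ) :
    j ∈ S ↔ j < S.card := by
  constructor
  · intro hj
    have : Finset.range (j + 1) ⊆ S := by
      intro i hi
      rw [Finset.mem_range, Nat.lt_succ_iff] at hi
      rcases hi.lt_or_eq with h | rfl
      · exact hS i j h hj
      · exact hj
    simpa using Finset.card_le_card this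
  · intro hj
    by_contra hjS
    have : S ⊆ Finset.range j := by
      intro i hi
      rw [Finset.mem_range]
      by_contra! h
      rcases h.lt_or_eq with h | rfl
      · exact hjS (hS j i h hi)
      · exact hjS hi
    have := Finset.card_le_card this
    rw [Finset.card_range] at this
    omega

variable {F : Type*} [Field F] [CharZero F] {g : Type*} [LieRing g] [LieAlgebra F g]
  [FiniteDimensional F g] {a : LieSubalgebra F g} {n : ℕ} {e : Module.Basis (Fin n) F a}
  {R : CType} {k : ℕ} {H₀ : a} {p : ℕ} {H : Fin p → a}

theorem VerySpecialFamily.sum_coord (htype : IsOfType e R k H₀) (hH : VerySpecialFamily H₀ H)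
    (i : Fin n) : ∑ q, e.coord i (H q) = if (i : ℕ) < k then 2 else 0 := by
  rw [← map_sum, hH.2, map_smul, htype.coord_H₀]
  split_ifs <;> simp

theorem VerySpecialFamily.ne_zero (hH : VerySpecialFamily H₀ H) (q : Fin p) : H q ≠ 0 :=
  (hH.1 q).1.1.ne_zero

/-- Each of the first `k` coordinates takes values in `{0, 1, 2}` with sum 2 over the family. A
member of the second kind contributes 1, so exactly one further member contributes 1 and is of the
second kind; a third member would have its first `k` coordinates 0, hence be 0. -/
theorem VerySpecialFamily.cases (htype : IsOfType e R k H₀) (hs : IsSplitAbelian F a)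
    (hH : VerySpecialFamily H₀ H) :
    (∃ idx : ℕ → ℕ, IsPartition e k H idx ∧ ∀ q < p, ∃ i < k, idx i = q) ∨
    (p = 2 ∧ ∀ q, (∀ i : Fin n, (i : ℕ) < k → e.coord i (H q) = 1) ∧
      (∀ j : Fin n, k ≤ (j : ℕ) → e.coord j (H q) = 0 ∨ e.coord j (H q) = 1 ∨
        e.coord j (H q) = -1) ∧
      ∃ j : Fin n, k ≤ (j : ℕ) ∧ e.coord j (H q) ≠ 0) := by
  classical
  have hk1 : 1 ≤ k := htype.2.2.1
  have hkn : k ≤ n := htype.2.2.2.1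
  have hc := fun q => htype.classification hs (hH.1 q)
  have hnat : ∀ i : Fin n, ∀ q, ∃ m : ℕ, (i : ℕ) < k → m ≤ 2 ∧ e.coord i (H q) = m := by
    intro i q
    by_cases hi : (i : ℕ) < k
    · rcases hc q with h | h
      · rcases h.1 i hi with h | h
        · exact ⟨0, fun _ => ⟨by norm_num, by simpa using h⟩⟩
        · exact ⟨2, fun _ => ⟨le_rfl, by simpa using h⟩⟩
      · exact ⟨1, fun _ => ⟨by norm_num, by simpa using h.1 i hi⟩⟩
    · exact ⟨0, fun h => absurd h hi⟩
  choose c hc2 using hnat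
  have hcs : ∀ i : Fin n, (i : ℕ) < k → ∑ q, c i q = 2 := by
    intro i hi
    have h1 := hH.sum_coord htype i
    rw [if_pos hi, Finset.sum_congr rfl fun q _ => (hc2 i q hi).2] at h1
    exact_mod_cast h1
  by_cases hall : ∀ q, (∀ i : Fin n, (i : ℕ) < k → e.coord i (H q) = 0 ∨ e.coord i (H q) = 2) ∧
      (∀ j : Fin n, k ≤ (j : ℕ) → e.coord j (H q) = 0)
  · left
    have hidx : ∀ i : ℕ, ∃ m : ℕ, ∀ hi : i < k, m < p ∧
        ∀ q : Fin p, e.coord ⟨i, by omega⟩ (H q) = if m = q then 2 else 0 := by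
      intro i
      by_cases hi : i < k
      · let i' : Fin n := ⟨i, by omega⟩
        have hi' : (i' : ℕ) < k := hi
        have hne : ∑ q, c i' q ≠ 0 := by rw [hcs i' hi']; norm_num
        obtain ⟨q, -, hq⟩ := Finset.exists_ne_zero_of_sum_ne_zero hne
        have hval : ∀ q, c i' q = 0 ∨ c i' q = 2 := by
          intro q
          rcases (hall q).1 i' hi' with h | h <;> rw [(hc2 i' q hi').2] at h
          · exact Or.inl (by exact_mod_cast h)
          · exact Or.inr (by exact_mod_cast h)
        have hq2 := (hval q).resolve_left hq
        refine ⟨q, fun _ => ⟨q.2, fun r => ?_⟩⟩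
        change e.coord i' (H r) = _
        rw [(hc2 i' r hi').2]
        by_cases hr : r = q
        · subst hr; simp [hq2]
        · have h1 := Finset.sum_le_sum_of_subset (f := c i')
            (Finset.subset_univ ({r, q} : Finset (Fin p)))
          rw [Finset.sum_pair hr, hcs i' hi', hq2] at h1
          rw [if_neg (fun h => hr (Fin.ext h.symm)), show c i' r = 0 by omega, Nat.cast_zero]
      · exact ⟨0, fun h => absurd h hi⟩
    choose idx hidx using hidx
    have hpart : IsPartition e k H idx := by
      refine ⟨fun i hi => (hidx i hi).1, fun i q => ?_⟩
      by_cases hi : (i : ℕ) < k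
      · simp only [hi, true_and]
        exact (hidx i hi).2 q
      · rw [if_neg (fun h => hi h.1)]
        exact (hall q).2 i (not_lt.1 hi)
    refine ⟨idx, hpart, fun q hq => ?_⟩
    by_contra! hcon
    refine hH.ne_zero ⟨q, hq⟩ (eq_of_coord_eq e fun i => ?_)
    rw [hpart.2, if_neg (fun h => hcon i h.1 h.2), map_zero]
  · right
    push Not at hall
    obtain ⟨q₀, hq₀⟩ := hall
    have hB₀ := (hc q₀).resolve_left (fun h => by
      obtain ⟨j, hj, hj'⟩ := hq₀ h.1
      exact hj' (h.2 j hj))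
    let z : Fin n := ⟨0, by omega⟩
    have hz : (z : ℕ) < k := hk1
    have hone : ∀ q, (∀ i : Fin n, (i : ℕ) < k → e.coord i (H q) = 1) →
        ∀ i : Fin n, (i : ℕ) < k → c i q = 1 := by
      intro q h i hi
      have := h i hi
      rw [(hc2 i q hi).2] at this
      exact_mod_cast this
    have hc0 := hone q₀ hB₀.1
    have herase : ∑ q ∈ Finset.univ.erase q₀, c z q = 1 := by
      have := Finset.add_sum_erase Finset.univ (c z) (Finset.mem_univ q₀)
      rw [hcs z hz, hc0 z hz] at this
      omega
    obtain ⟨q₁, hq₁, hq₁0⟩ := Finset.exists_ne_zero_of_sum_ne_zero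
      (by rw [herase]; norm_num : ∑ q ∈ Finset.univ.erase q₀, c z q ≠ 0)
    have hne : q₁ ≠ q₀ := Finset.ne_of_mem_erase hq₁
    have hq₁1 : c z q₁ = 1 := by
      have := Finset.single_le_sum (f := c z) (fun _ _ => Nat.zero_le _) hq₁
      omega
    have hB₁ := (hc q₁).resolve_left (fun h => by
      have := h.1 z hz
      rw [(hc2 z q₁ hz).2, hq₁1] at this
      norm_num at this)
    have hc1 := hone q₁ hB₁.1
    have hq : ∀ q, q = q₀ ∨ q = q₁ := by
      intro q
      by_contra! hcon
      have hrest : ∀ i : Fin n, (i : ℕ) < k → e.coord i (H q) = 0 := by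
        intro i hi
        have h1 := Finset.sum_le_sum_of_subset (f := c i)
          (Finset.subset_univ ({q, q₀, q₁} : Finset (Fin p)))
        rw [Finset.sum_insert (by simp [hcon]), Finset.sum_pair hne.symm, hcs i hi, hc0 i hi,
          hc1 i hi] at h1
        rw [(hc2 i q hi).2, show c i q = 0 by omega, Nat.cast_zero]
      rcases hc q with h | h
      · refine hH.ne_zero q (eq_of_coord_eq e fun i => ?_)
        rw [map_zero]
        by_cases hi : (i : ℕ) < k
        · exact hrest i hi
        · exact h.2 i (not_lt.1 hi)
      · have := h.1 z hz
        rw [hrest z hz] at this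
        norm_num at this
    refine ⟨?_, fun q => ?_⟩
    · have : (Finset.univ : Finset (Fin p)) = {q₀, q₁} := by
        ext q
        simpa using hq q
      have := congrArg Finset.card this
      rwa [Finset.card_univ, Fintype.card_fin, Finset.card_pair hne.symm] at this
    · rcases hq q with rfl | rfl
      · exact hB₀
      · exact hB₁

theorem IsStandard.succ (hstd : IsStandard (posRoots e R) H₀ H) {lam : Module.Dual F a}
    (hl : lam ∈ posRoots e R) (h0 : lam H₀ = 0) {q : Fin p} (hq : lam (H q) ≠ 0) : Succ H lam := by
  have : lam ∈ succRoots H₀ H := by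
    rw [IsStandard] at hstd
    rw [hstd]
    exact ⟨hl, h0, q, hq⟩
  exact this.2.2

/-- Since `H 1` comes last in the order, standardness makes every positive root of degree 0 take a
natural value on it: its coordinates beyond `k` form a dominant vector. Such a vector with entries
`0, ±1` is determined by its number of nonzero entries, up to one sign in type `D`. -/
theorem VerySpecialFamily.P_eq_P0' (htype : IsOfType e R k H₀)
    (ha : Maximal (IsSplitAbelian F) a) (hsimple : AbsolutelySimple F g) {H : Fin 2 → a}
    (hH : VerySpecialFamily H₀ H)
    (hB : ∀ q, (∀ i : Fin n, (i : ℕ) < k → e.coord i (H q) = 1) ∧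
      (∀ j : Fin n, k ≤ (j : ℕ) → e.coord j (H q) = 0 ∨ e.coord j (H q) = 1 ∨
        e.coord j (H q) = -1) ∧
      ∃ j : Fin n, k ≤ (j : ℕ) ∧ e.coord j (H q) ≠ 0)
    (hstd : IsStandard (posRoots e R) H₀ H) :
    (2 * k ≤ n ∧ P H₀ H = P0' e k H₀) ∨
      (R = CType.D ∧ n = 2 * k ∧ P H₀ H = P0' (flipLast e) k H₀) := by
  classical
  have hs := ha.prop
  have hk1 : 1 ≤ k := htype.2.2.1
  obtain ⟨j₀, hj₀, hj₀'⟩ := (hB 1).2.2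
  have hn2 : 2 ≤ n := by omega
  have : LieAlgebra.IsKilling F g := htype.isKilling hs hsimple hn2
  have hsum : H 0 + H 1 = (2 : F) • H₀ := by rw [← hH.2, Fin.sum_univ_two]
  have hlow := (hB 1).1
  have hval := (hB 1).2.1
  have hH0 : ∀ i : Fin n, e.coord i (H 0) = if (i : ℕ) < k then 1 else -e.coord i (H 1) := by
    intro i
    have h1 := congrArg (e.coord i) hsum
    rw [map_add, map_smul, htype.coord_H₀] at h1
    split_ifs with hi
    · exact (hB 0).1 i hi
    · rw [if_neg hi, smul_zero] at h1
      linear_combination h1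
  have hpos : ∀ lam ∈ posRoots e R, lam H₀ = 0 → ∃ m : ℕ, lam (H 1) = m := by
    intro lam hl h0
    by_cases h1 : lam (H 1) = 0
    · exact ⟨0, by simpa using h1⟩
    obtain ⟨q, ⟨m, hm, hm'⟩, hq⟩ := hstd.succ hl h0 h1
    have hq1 : q = 1 := by
      by_contra hq1
      exact h1 (hq 1 (by omega))
    subst hq1
    exact ⟨m, hm'⟩
  have hH₀j : ∀ j : Fin n, k ≤ (j : ℕ) → e.coord j H₀ = 0 := fun j hj => by
    rw [htype.coord_H₀, if_neg (not_lt.2 hj)]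
  have hsub : ∀ i j : Fin n, k ≤ (i : ℕ) → i < j →
      ∃ m : ℕ, e.coord i (H 1) - e.coord j (H 1) = m := fun i j hi hij =>
    hpos (e.coord i - e.coord j) (mem_posRoots_iff.2 (Or.inl ⟨i, j, hij, Or.inl rfl⟩))
      (by rw [LinearMap.sub_apply, hH₀j i hi, hH₀j j (hi.trans hij.le), sub_zero])
  have hadd : ∀ i j : Fin n, k ≤ (i : ℕ) → i < j →
      ∃ m : ℕ, e.coord i (H 1) + e.coord j (H 1) = m := fun i j hi hij =>
    hpos (e.coord i + e.coord j) (mem_posRoots_iff.2 (Or.inl ⟨i, j, hij, Or.inr rfl⟩))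
      (by rw [LinearMap.add_apply, hH₀j i hi, hH₀j j (hi.trans hij.le), add_zero])
  have hneg : ∀ (m r : ℕ), 0 < r → (m : F) ≠ -(r : F) := by
    intro m r hr h
    have : ((m + r : ℕ) : F) = 0 := by push_cast; rw [h]; ring
    have : m + r = 0 := by exact_mod_cast this
    omega
  have hneg1 : ∀ m : ℕ, (m : F) ≠ -1 := fun m => by simpa using hneg m 1 one_pos
  have hneg2 : ∀ m : ℕ, (m : F) ≠ -2 := fun m => by simpa using hneg m 2 two_pos
  set S : Finset ℕ := (Finset.univ.filter fun j : Fin n => k ≤ (j : ℕ) ∧ e.coord j (H 1) ≠ 0).map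
    Fin.valEmbedding with hS
  have hmemS : ∀ j : Fin n, (j : ℕ) ∈ S ↔ k ≤ (j : ℕ) ∧ e.coord j (H 1) ≠ 0 := by
    intro j
    simp only [hS, Finset.mem_map, Finset.mem_filter, Finset.mem_univ, true_and,
      Fin.valEmbedding_apply]
    constructor
    · rintro ⟨i, hi, hij⟩
      rwa [Fin.ext hij] at hi
    · exact fun h => ⟨j, h, rfl⟩
  have hSsub : ∀ j ∈ S, k ≤ j ∧ j < n := by
    intro j hj
    simp only [hS, Finset.mem_map, Finset.mem_filter, Finset.mem_univ, true_and,
      Fin.valEmbedding_apply] at hj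
    obtain ⟨i, hi, rfl⟩ := hj
    exact ⟨hi.1, i.2⟩
  have hSk : S.card = k := by
    -- For `n ≥ 3` the count is the orthogonality of `H 1` and `2H₀ - H 1`; for `n = 2` the only
    -- index beyond `k = 1` carries a nonzero entry.
    rcases hn2.lt_or_eq with hn3 | hn2'
    · have h0 := htype.sum_coord_eq_zero ha hn3 (hH.1 1).1.1
      have hterm : ∀ i : Fin n, e.coord i (H 1) * (2 * e.coord i H₀ - e.coord i (H 1))
          = (if (i : ℕ) < k then 1 else 0) - if k ≤ (i : ℕ) ∧ e.coord i (H 1) ≠ 0 then 1 else 0 := by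
        intro i
        rw [htype.coord_H₀]
        by_cases hi : (i : ℕ) < k
        · rw [hlow i hi, if_pos hi, if_neg (fun h => by omega)]; norm_num
        · rw [if_neg hi]
          rcases hval i (not_lt.1 hi) with h | h | h <;> simp [h, not_lt.1 hi]
      rw [Finset.sum_congr rfl fun i _ => hterm i, Finset.sum_sub_distrib, Finset.sum_boole,
        Finset.sum_boole, sub_eq_zero] at h0
      have h1 : (Finset.univ.filter fun i : Fin n => (i : ℕ) < k).card
          = (Finset.univ.filter fun j : Fin n => k ≤ (j : ℕ) ∧ e.coord j (H 1) ≠ 0).card := by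
        exact_mod_cast h0
      rw [hS, Finset.card_map, ← h1]
      have h2 : (Finset.univ.filter fun i : Fin n => (i : ℕ) < k).map Fin.valEmbedding
          = Finset.range k := by
        ext j
        simp only [Finset.mem_map, Finset.mem_filter, Finset.mem_univ, true_and,
          Fin.valEmbedding_apply, Finset.mem_range]
        constructor
        · rintro ⟨i, hi, rfl⟩; exact hi
        · exact fun hj => ⟨⟨j, by omega⟩, hj, rfl⟩
      rw [← Finset.card_map, h2, Finset.card_range]
    · have hk : k = 1 := by omega
      have : S = {1} := by
        ext j
        rw [Finset.mem_singleton]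
        constructor
        · intro hj
          have := hSsub j hj
          omega
        · rintro rfl
          have := (hmemS j₀).2 ⟨hj₀, hj₀'⟩
          rwa [show (j₀ : ℕ) = 1 by omega] at this
      rw [this, hk, Finset.card_singleton]
  by_cases hm1 : ∃ j : Fin n, k ≤ (j : ℕ) ∧ e.coord j (H 1) = -1
  · right
    obtain ⟨j, hj, hj1⟩ := hm1
    have hD : R = .D := by
      rcases hR : R with _ | _ | _ | _
      · obtain ⟨m, hm⟩ := hpos (e.coord j)
          (mem_posRoots_iff.2 (Or.inr (Or.inl ⟨Or.inl hR, j, rfl⟩))) (hH₀j j hj)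
        exact absurd (hm.symm.trans hj1) (hneg1 m)
      · obtain ⟨m, hm⟩ := hpos ((2 : F) • e.coord j)
          (mem_posRoots_iff.2 (Or.inr (Or.inr ⟨Or.inl hR, j, rfl⟩)))
          (by rw [LinearMap.smul_apply, hH₀j j hj, smul_zero])
        rw [LinearMap.smul_apply, hj1, smul_eq_mul] at hm
        exact absurd (hm.symm.trans (by norm_num)) (hneg2 m)
      · obtain ⟨m, hm⟩ := hpos (e.coord j)
          (mem_posRoots_iff.2 (Or.inr (Or.inl ⟨Or.inr hR, j, rfl⟩))) (hH₀j j hj)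
        exact absurd (hm.symm.trans hj1) (hneg1 m)
      · rfl
    -- For a later `l`, the natural numbers `x_j - x_l` and `x_j + x_l` would add up to -2.
    have hlast : ∀ l, ¬ j < l := by
      intro l hl
      obtain ⟨m, hm⟩ := hsub j l hj hl
      obtain ⟨m', hm'⟩ := hadd j l hj hl
      apply hneg2 (m + m')
      push_cast
      rw [← hm, ← hm', hj1]
      ring
    have hjn : (j : ℕ) + 1 = n := by
      by_contra h
      exact hlast ⟨j + 1, by omega⟩ (by rw [Fin.lt_def]; simp)
    have hbefore : ∀ i : Fin n, k ≤ (i : ℕ) → i < j → e.coord i (H 1) = 1 := by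
      intro i hi hij
      obtain ⟨m, hm⟩ := hadd i j hi hij
      rw [hj1] at hm
      rcases hval i hi with h | h | h
      · rw [h] at hm
        exact absurd (hm.symm.trans (by norm_num)) (hneg1 m)
      · exact h
      · rw [h] at hm
        exact absurd (hm.symm.trans (by norm_num)) (hneg2 m)
    have hn2k : n = 2 * k := by
      have : S = Finset.Ico k n := by
        ext i
        rw [Finset.mem_Ico]
        refine ⟨hSsub i, fun ⟨h1, h2⟩ => (hmemS ⟨i, h2⟩).2 ⟨h1, ?_⟩⟩
        by_cases hij : (⟨i, h2⟩ : Fin n) < j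
        · rw [hbefore _ h1 hij]; exact one_ne_zero
        · have : (⟨i, h2⟩ : Fin n) = j := Fin.ext (by rw [Fin.lt_def] at hij; simp only at hij ⊢; omega)
          rw [this, hj1]; norm_num
      rw [this, Nat.card_Ico] at hSk
      omega
    have hone : ∀ i : Fin n, (flipLast e).coord i (H 1) = 1 := by
      intro i
      rw [coord_flipLast]
      split_ifs with hi
      · rw [show i = j from Fin.ext (by omega), hj1, neg_neg]
      · by_cases hik : (i : ℕ) < k
        · exact hlow i hik
        · exact hbefore i (not_lt.1 hik) (by rw [Fin.lt_def]; omega)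
    refine ⟨hD, hn2k, Prehom.P_eq_P0' (flipLast e) hn2k.ge H₀ (fun i => ?_) fun i => ?_⟩
    · have h1 := hone i
      rw [coord_flipLast] at h1 ⊢
      rw [hH0]
      have := i.2
      grind
    · rw [hone, if_pos (by omega)]
  · left
    push Not at hm1
    -- A 0 before a 1 would give `ε_i - ε_j` the value -1; so the nonzero entries occupy the
    -- positions from `k` to `2k - 1`, counted from 0.
    have hclosed : ∀ i j : Fin n, k ≤ (i : ℕ) → i < j → e.coord j (H 1) ≠ 0 →
        e.coord i (H 1) ≠ 0 := by
      intro i j hi hij hj h0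
      have hj' : k ≤ (j : ℕ) := hi.trans hij.le
      obtain ⟨m, hm⟩ := hsub i j hi hij
      have h1 := ((hval j hj').resolve_left hj).resolve_right (hm1 j hj')
      rw [h0, h1] at hm
      exact hneg1 m (by rw [← hm]; norm_num)
    have hlower : ∀ i j, i < j → j ∈ Finset.range k ∪ S → i ∈ Finset.range k ∪ S := by
      intro i j hij hj
      rw [Finset.mem_union, Finset.mem_range] at hj ⊢
      by_cases hi : i < k
      · exact Or.inl hi
      · right
        have hj := hj.resolve_left (by omega)
        have hjn := hSsub j hj
        exact (hmemS ⟨i, by omega⟩).2 ⟨not_lt.1 hi, hclosed ⟨i, by omega⟩ ⟨j, hjn.2⟩ (not_lt.1 hi) hij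
          ((hmemS ⟨j, hjn.2⟩).1 hj).2⟩
    have hcard : (Finset.range k ∪ S).card = 2 * k := by
      rw [Finset.card_union_of_disjoint, Finset.card_range, hSk, two_mul]
      rw [Finset.disjoint_left]
      intro i hi hiS
      have := hSsub i hiS
      rw [Finset.mem_range] at hi
      omega
    have hmem := mem_iff_lt_card_of_lower hlower
    rw [hcard] at hmem
    have h2k : 2 * k ≤ n := by
      have h1 := (hmem (2 * k - 1)).2 (by omega)
      rw [Finset.mem_union, Finset.mem_range] at h1
      have := (hSsub _ (h1.resolve_left (by omega))).2
      omega
    have hone : ∀ i : Fin n, e.coord i (H 1) = if (i : ℕ) < 2 * k then 1 else 0 := by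
      intro i
      have h1 := hmem i
      rw [Finset.mem_union, Finset.mem_range, hmemS] at h1
      by_cases hik : (i : ℕ) < k
      · rw [hlow i hik, if_pos (by omega)]
      · rcases hval i (not_lt.1 hik) with h | h | h
        · rw [h, if_neg]
          rw [← h1, h]
          simp [hik]
        · rw [h, if_pos]
          rw [← h1, h]
          exact Or.inr ⟨not_lt.1 hik, one_ne_zero⟩
        · exact absurd h (hm1 i (not_lt.1 hik))
    refine ⟨h2k, Prehom.P_eq_P0' e h2k H₀ (fun i => ?_) hone⟩
    rw [hH0, hone]
    split_ifs <;> simp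

theorem IsPartition.antitone {idx : ℕ → ℕ} (htype : IsOfType e R k H₀) (hH : IsPartition e k H idx)
    (hstd : IsStandard (posRoots e R) H₀ H) {i j : ℕ} (hij : i ≤ j) (hj : j < k) :
    idx j ≤ idx i := by
  have hkn : k ≤ n := htype.2.2.2.1
  rcases hij.lt_or_eq with hij | rfl
  swap
  · exact le_rfl
  by_cases h : idx i = idx j
  · exact h.ge
  let i' : Fin n := ⟨i, by omega⟩
  let j' : Fin n := ⟨j, by omega⟩
  have hi' : (i' : ℕ) < k := hij.trans hj
  have hj' : (j' : ℕ) < k := hj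
  refine ((hH.succ_iff hi' hj').1 (hstd.succ (q := ⟨idx i, hH.1 i hi'⟩)
    (mem_posRoots_iff.2 (Or.inl ⟨i', j', hij, Or.inl rfl⟩)) ?_ ?_)).le
  · rw [LinearMap.sub_apply, htype.coord_H₀, htype.coord_H₀, if_pos hi', if_pos hj', sub_self]
  · rw [LinearMap.sub_apply, hH.2, hH.2, if_pos ⟨hi', rfl⟩, if_neg (fun h' => h h'.2.symm), sub_zero]
    exact two_ne_zero

/-- A single member would be `2H₀`, and its complement 0 is not 1-simple. -/
theorem VerySpecialFamily.two_le (hH : VerySpecialFamily H₀ H) (hp : 0 < p) : 2 ≤ p := by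
  by_contra h
  obtain rfl : p = 1 := by omega
  have h1 := hH.2
  rw [Fin.sum_univ_one] at h1
  have h2 : OneSimple F (H₀ : g) (((2 : F) • H₀ - H 0 : a) : g) := (hH.1 0).2.1
  exact h2.ne_zero (by rw [h1, sub_self])

/-- The member of index `q`, counted from 0, is `h_{ε_{k-q}}`, which sits at position `k - 1 - q` of
the basis. -/
theorem isPartition_coroot_eps (e : Module.Basis (Fin n) F a) (hkn : k ≤ n) :
    IsPartition e k (fun i : Fin k => coroot e (eps e (k - (i + 1) + 1))) fun i => k - 1 - i := by
  refine ⟨fun i hi => by dsimp only; omega, fun i q => ?_⟩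
  have := q.2
  rw [coord_coroot_eps e i (by omega) (by omega)]
  refine if_congr ?_ rfl rfl
  dsimp only
  omega

theorem isPartition_coroot_eps_pair (e : Module.Basis (Fin n) F a) (hkn : k ≤ n) (hk : Even k) :
    IsPartition e k (fun i : Fin (k / 2) =>
      (2 : F) • (coroot e ((2 : F) • eps e (k - 2 * (i + 1) + 1)) +
        coroot e ((2 : F) • eps e (k - 2 * (i + 1) + 2)))) fun i => (k - 1 - i) / 2 := by
  obtain ⟨r, hr⟩ := hk
  refine ⟨fun i hi => by dsimp only; omega, fun i q => ?_⟩
  have := q.2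
  rw [map_smul, map_add, coord_coroot_two_smul_eps e i (by omega) (by omega),
    coord_coroot_two_smul_eps e i (by omega) (by omega)]
  have h1 : ((i : ℕ) < k ∧ (k - 1 - i) / 2 = q) ↔
      ((i : ℕ) + 1 = k - 2 * (q + 1) + 1 ∨ (i : ℕ) + 1 = k - 2 * (q + 1) + 2) := by omega
  simp only [h1]
  split_ifs <;> first | omega | simp_all

theorem IsPartition.two_le_and_P0_subset_and_exists_intervals {idx : ℕ → ℕ} (htype : IsOfType e R k H₀)
    (ha : Maximal (IsSplitAbelian F) a) (hsimple : AbsolutelySimple F g)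
    (hH : VerySpecialFamily H₀ H) (hpart : IsPartition e k H idx)
    (hsurj : ∀ q < p, ∃ i < k, idx i = q) (hstd : IsStandard (posRoots e R) H₀ H) :
    2 ≤ k ∧ P0 e R k H₀ ⊆ P H₀ H ∧
      ∃ l : ℕ → ℕ, l (p + 1) = 0 ∧ l 1 = k ∧
        (∀ i, 1 ≤ i → i ≤ p → l (i + 1) < l i) ∧
        ∀ i : Fin p, H i =
          ∑ j ∈ Finset.Icc (l (i + 2) + 1) (l (i + 1)), coroot e (eps e j) := by
  have hk1 : 1 ≤ k := htype.2.2.1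
  have hkn : k ≤ n := htype.2.2.2.1
  have hp0 : 0 < p := (Nat.zero_le _).trans_lt (hpart.1 0 hk1)
  have hp2 := hH.two_le hp0
  have hanti : ∀ i j, i ≤ j → j < k → idx j ≤ idx i := fun i j => hpart.antitone htype hstd
  -- `idx` counts blocks from 0 and `l` from 1. As `idx` is antitone, `l m` is the length of the
  -- initial segment of blocks numbered at least `m`, and block `q` occupies the positions from `l
  -- (q + 2)` to `l (q + 1) - 1`.
  let l : ℕ → ℕ := fun m => ((Finset.range k).filter fun j => m ≤ idx j + 1).card
  have hl : ∀ m j, j < l m ↔ j < k ∧ m ≤ idx j + 1 := by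
    intro m j
    rw [← mem_iff_lt_card_of_lower (S := (Finset.range k).filter fun j => m ≤ idx j + 1),
      Finset.mem_filter, Finset.mem_range]
    intro i j hij hj
    rw [Finset.mem_filter, Finset.mem_range] at hj ⊢
    have := hanti i j hij.le hj.1
    omega
  have hl1 : l 1 = k := by
    apply eq_of_forall_lt_iff
    intro j
    rw [hl]
    omega
  have hlp : l (p + 1) = 0 := by
    by_contra h
    have := (hl (p + 1) 0).1 (Nat.pos_of_ne_zero h)
    have := hpart.1 0 hk1
    omega
  have hlt : ∀ i, 1 ≤ i → i ≤ p → l (i + 1) < l i := by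
    intro i h1 h2
    obtain ⟨j, hj, hj'⟩ := hsurj (i - 1) (by omega)
    have h3 := (hl i j).2 ⟨hj, by omega⟩
    have h4 := mt (hl (i + 1) j).1 (by omega)
    omega
  have hlk : ∀ m, l m ≤ k := by
    intro m
    by_contra! h
    exact lt_irrefl _ ((hl m k).1 h).1
  have hmem : ∀ i q, (l (q + 2) ≤ i ∧ i < l (q + 1)) ↔ (i < k ∧ idx i = q) := by
    intro i q
    have h1 := hl (q + 2) i
    have h2 := hl (q + 1) i
    omega
  have hk2 : 2 ≤ k := by
    have h1 : l 2 < l 1 := hlt 1 le_rfl (by omega)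
    have h2 := hlt 2 (by omega) hp2
    omega
  refine ⟨hk2, ?_, l, hlp, hl1, hlt, fun q => ?_⟩
  · rw [P0]
    split_ifs with hsplit
    · obtain ⟨hR, hC⟩ := hsplit
      have hn3 : 3 ≤ n := by have := htype.2.2.2.2.1 hR; omega
      have : LieAlgebra.IsKilling F g := htype.isKilling ha.prop hsimple (by omega)
      -- The parity lemma needs an index `s` outside the block, which exists because `p ≥ 2`.
      have hevenT : ∀ q, q < p → Even (l (q + 1) - l (q + 2)) := by
        intro q hq
        obtain ⟨s, hs, hsq⟩ : ∃ s < k, idx s ≠ q := by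
          obtain ⟨s, hs, hs'⟩ := hsurj (if q = 0 then 1 else 0) (by split_ifs <;> omega)
          exact ⟨s, hs, by rw [hs']; split_ifs <;> omega⟩
        let T : Finset (Fin n) := Finset.univ.filter fun i => (i : ℕ) < k ∧ idx i = q
        have hTmem : ∀ i, i ∈ T ↔ (i : ℕ) < k ∧ idx i = q := fun i => by simp [T]
        have hT := htype.even_card ha hC hn3 (hH.1 ⟨q, hq⟩).1.1 (T := T)
          (fun i => by rw [hpart.2]; simp only [hTmem])
          (fun i hi => ((hTmem i).1 hi).1) (s := ⟨s, by omega⟩)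
          (fun h => hsq ((hTmem _).1 h).2) hs (by
            rw [htype.1]
            exact Or.inl (mem_posRoots_iff.2 (Or.inr (Or.inr ⟨Or.inl hR, _, rfl⟩))))
        have hTm : T.map Fin.valEmbedding = Finset.Ico (l (q + 2)) (l (q + 1)) := by
          ext j
          rw [Finset.mem_Ico, hmem]
          simp only [Finset.mem_map, hTmem, Fin.valEmbedding_apply]
          constructor
          · rintro ⟨i, hi, rfl⟩; exact hi
          · exact fun h => ⟨⟨j, by omega⟩, h, rfl⟩
        rwa [← Finset.card_map Fin.valEmbedding, hTm, Nat.card_Ico] at hT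
      have heven : ∀ d, d ≤ p → Even (l (p + 1 - d)) := by
        intro d
        induction d with
        | zero => simp [hlp]
        | succ d ih =>
          intro hd
          have h1 := ih (by omega)
          have h2 := hevenT (p - (d + 1)) (by omega)
          have h3 := hlt (p - (d + 1) + 1) (by omega) (by omega)
          rw [show p - (d + 1) + 2 = p + 1 - d by omega] at h2
          rw [show p - (d + 1) + 1 = p + 1 - (d + 1) by omega] at h2 h3
          rw [show p + 1 - (d + 1) + 1 = p + 1 - d by omega] at h3
          have := h2.add h1
          rwa [Nat.sub_add_cancel h3.le] at this
      have hlev : ∀ m, 1 ≤ m → m ≤ p + 1 → Even (l m) := by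
        intro m h1 h2
        have := heven (p + 1 - m) (by omega)
        rwa [show p + 1 - (p + 1 - m) = m by omega] at this
      have hkev : Even k := hl1 ▸ hlev 1 le_rfl (by omega)
      refine IsPartition.P_subset_P htype ha.prop hpart (isPartition_coroot_eps_pair e hkn hkev) ?_
      intro i hi j hj hij
      rcases le_or_gt i j with h | h
      · exact hanti i j h hj
      · obtain ⟨r, hr⟩ := hkev
        have hpair : i = j + 1 ∧ Even j := by
          refine ⟨by omega, ?_⟩
          rw [Nat.even_iff]
          omega
        obtain ⟨rfl, hje⟩ := hpair
        -- The positions `j`, `j + 1` form a pair of `P_0` with `j` even. If a block ended between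
        -- them, `l (idx j + 1) = j + 1` would be odd.
        by_contra! hlt'
        have hjp := hpart.1 j hj
        obtain ⟨c, hc⟩ := hlev (idx j + 1) (by omega) (by omega)
        have h1 := (hl (idx j + 1) j).2 ⟨hj, le_rfl⟩
        have h2 := mt (hl (idx j + 1) (j + 1)).1 (by omega)
        obtain ⟨b, hb⟩ := hje
        omega
    · refine IsPartition.P_subset_P htype ha.prop hpart (isPartition_coroot_eps e hkn) ?_
      intro i hi j hj hij
      exact hanti i j (by omega) hj
  · refine eq_of_coord_eq e fun i => ?_
    have := hlk (q + 1)
    rw [map_sum, hpart.2, Finset.sum_congr rfl fun j hj => coord_coroot_eps e i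
      (by have := (Finset.mem_Icc.1 hj).1; omega) (by have := (Finset.mem_Icc.1 hj).2; omega),
      Finset.sum_ite_eq]
    refine if_congr ?_ rfl rfl
    rw [Finset.mem_Icc, ← hmem]
    omega

end Families

end Prehom

end

open Prehom in
theorem proposition2p4p3 {F : Type*} [Field F] [CharZero F]
    {g : Type*} [LieRing g] [LieAlgebra F g] [FiniteDimensional F g]
    (hsimple : AbsolutelySimple F g)
    (a : LieSubalgebra F g) (ha : Maximal (IsSplitAbelian F) a) (H₀ : a)
    (R : CType) (n k : ℕ) (e : Module.Basis (Fin n) F a)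
    (htype : IsOfType e R k H₀)
    (hirr : AbsolutelyIrreducible F (H₀ : g))
    (hreg : Regular F (H₀ : g))
    (p : ℕ) (H : Fin p → a)
    (hH : VerySpecialFamily H₀ H)
    (hstd : IsStandard (posRoots e R) H₀ H) :
    (2 * k ≤ n ∧ P H₀ H = P0' e k H₀) ∨
    (R = CType.D ∧ n = 2 * k ∧ P H₀ H = P0' (flipLast e) k H₀) ∨
    (2 ≤ k ∧ P0 e R k H₀ ⊆ P H₀ H ∧
      ∃ l : ℕ → ℕ, l (p + 1) = 0 ∧ l 1 = k ∧
        (∀ i, 1 ≤ i → i ≤ p → l (i + 1) < l i) ∧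
        ∀ i : Fin p, H i =
          ∑ j ∈ Finset.Icc (l (i + 2) + 1) (l (i + 1)), coroot e (eps e j)) := by
  rcases hH.cases htype ha.prop with ⟨idx, hpart, hsurj⟩ | ⟨rfl, hB⟩
  · exact Or.inr (Or.inr (hpart.two_le_and_P0_subset_and_exists_intervals htype ha hsimple hH hsurj hstd))
  · rcases hH.P_eq_P0' htype ha hsimple hB hstd with h | h
    · exact Or.inl h
    · exact Or.inr (Or.inl h)
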